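/- Let $\alpha>0$ and let $V\in C^3(\mathbb R)$ satisfy: there are constants $a,b>0$ with $uV'(u)\ge au^2-b$ for all $u\in\mathbb R$; $V(0)=0$, $V'(0)=0$, $V''(0)>0$; $V(1)<0$, $V'(1)=0$, $V''(1)>0$; and $\{u\in\mathbb R: V'(u)=0,\ V(u)\le 0\}=\{0,1\}$. For $u\in L^2_{\mathrm{loc}}(\mathbb R)$ put $\|u\|_{L^2_{\mathrm{ul}}}=\sup_{\xi\in\mathbb R}\bigl(\int_\xi^{\xi+1}|u(x)|^2\,dx\bigr)^{1/2}$, and with $(T_\xi u)(x)=u(x-\xi)$ let $L^2_{\mathrm{ul}}(\mathbb R)=\{u\in L^2_{\mathrm{loc}}(\mathbb R):\|u\|_{L^2_{\mathrm{ul}}}<\infty,\ \lim_{\xi\to0}\|T_\xi u-u\|_{L^2_{\mathrm{ul}}}=0\}$. Let $H^1_{\mathrm{ul}}(\mathbb R)$ be the space of all $u\in L^2_{\mathrm{ul}}(\mathbb R)$ whose weak derivative $\partial u$ belongs to $L^2_{\mathrm{ul}}(\mathbb R)$, with norm $\|u\|_{H^1_{\mathrm{ul}}}=(\|u\|_{L^2_{\mathrm{ul}}}^2+\|\partial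 u\|_{L^2_{\mathrm{ul}}}^2)^{1/2}$. Let $X=H^1_{\mathrm{ul}}(\mathbb R)\times L^2_{\mathrm{ul}}(\mathbb R)$, with $\|(u_0,u_1)\|_X^2=\|u_0\|_{H^1_{\mathrm{ul}}}^2+\|u_1\|_{L^2_{\mathrm{ul}}}^2$. Consider the damped wave equation $$\alpha u_{tt}+u_t=u_{xx}-V'(u),\qquad x\in\mathbb R,\ t\ge0. \tag{1}$$ A global solution of (1) with data $(u_0,u_1)\in X$ is a $u\in C^0([0,\infty),H^1_{\mathrm{ul}}(\mathbb R))\cap C^1([0,\infty),L^2_{\mathrm{ul}}(\mathbb R))$ with $u(0)=u_0$, $u_t(0)=u_1$, such that for every $\varphi\in C_c^\infty(\mathbb R)$ the function $t\mapsto\int u_t\varphi\,dx$ is differentiable on $[0,\infty)$ and, for all $t\ge0$, $$\alpha\frac{d}{dt}\int_{\mathbb R}u_t\varphi\,dx+\int_{\mathbb R}u_t\varphi\,dx=-\int_{\mathbb R}u_x\varphi'\,dx-\int_{\mathbb R}V'(u)\varphi\,dx .$$ Then: 1. For all $(u_0,u_1)\in X$, equation (1) has a unique global solution with data $(u_0,u_1)$.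 2. The solution depends continuously on the data, uniformly on compact time intervals: for every global solution $u$ with data $(u_0,u_1)\in X$, every $T>0$ and every $\varepsilon>0$ there is $\delta>0$ such that every global solution $v$ with data $(v_0,v_1)\in X$, $\|(v_0,v_1)-(u_0,u_1)\|_X<\delta$, satisfies $\|(v(t),v_t(t))-(u(t),u_t(t))\|_X<\varepsilon$ for all $t\in[0,T]$. 3. There is a constant $K_\infty>0$, depending only on $\alpha$ and $V$, such that every global solution satisfies $$\limsup_{t\to+\infty}\bigl(\|u(\cdot,t)\|_{H^1_{\mathrm{ul}}}^2+\|u_t(\cdot,t)\|_{L^2_{\mathrm{ul}}}^2\bigr)\le K_\infty .$$ -/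

import Mathlib

open MeasureTheory Filter Topology Set
open scoped ENNReal ContDiff

noncomputable section

namespace DampedWave

/-! ### The uniformly local Lebesgue space -/

/-- The uniformly local `L²` norm `sup_ξ ‖f‖_{L²([ξ, ξ+1])}`, with values in `[0, ∞]`. -/
def ulENorm (f : ℝ → ℝ) : ℝ≥0∞ :=
  ⨆ ξ : ℝ, eLpNorm f 2 (volume.restrict (Icc ξ (ξ + 1)))

/-- The function `T_ξ f - f`, where `(T_ξ f)(x) = f (x - ξ)`. -/
def translateSub (f : ℝ → ℝ) (ξ : ℝ) : ℝ → ℝ := fun x => f (x - ξ) - f x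

theorem ulENorm_congr {f g : ℝ → ℝ} (h : f =ᵐ[volume] g) : ulENorm f = ulENorm g := by
  unfold ulENorm
  exact iSup_congr fun ξ => eLpNorm_congr_ae (ae_restrict_of_ae h)

theorem ulENorm_zero : ulENorm (fun _ => (0 : ℝ)) = 0 := by
  simp [ulENorm]

theorem ulENorm_add_le {f g : ℝ → ℝ} (hf : AEStronglyMeasurable f volume)
    (hg : AEStronglyMeasurable g volume) :
    ulENorm (fun x => f x + g x) ≤ ulENorm f + ulENorm g := by
  refine iSup_le fun ξ => ?_
  refine (eLpNorm_add_le hf.restrict hg.restrict (by norm_num)).trans ?_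
  exact add_le_add (le_iSup (fun ξ : ℝ => eLpNorm f 2 (volume.restrict (Icc ξ (ξ + 1)))) ξ)
    (le_iSup (fun ξ : ℝ => eLpNorm g 2 (volume.restrict (Icc ξ (ξ + 1)))) ξ)

theorem ulENorm_const_mul (c : ℝ) (f : ℝ → ℝ) :
    ulENorm (fun x => c * f x) = ‖c‖ₑ * ulENorm f := by
  unfold ulENorm
  rw [ENNReal.mul_iSup]
  exact iSup_congr fun ξ => eLpNorm_const_smul c f 2 _

theorem ae_eq_zero_of_ulENorm {f : ℝ → ℝ} (hf : AEStronglyMeasurable f volume)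
    (h : ulENorm f = 0) : f =ᵐ[volume] 0 := by
  have h1 : ∀ n : ℤ, f =ᵐ[volume.restrict (Icc (n : ℝ) (n + 1))] 0 := fun n => by
    rw [← eLpNorm_eq_zero_iff (p := 2) hf.restrict (by norm_num)]
    exact ENNReal.iSup_eq_zero.1 h (n : ℝ)
  have h2 : f =ᵐ[volume.restrict (⋃ n : ℤ, Icc (n : ℝ) (n + 1))] 0 :=
    (ae_restrict_iUnion_iff _ _).2 h1
  rwa [iUnion_Icc_intCast, Measure.restrict_univ] at h2

theorem ae_translate {f g : ℝ → ℝ} (h : f =ᵐ[volume] g) (ξ : ℝ) :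
    (fun x => f (x - ξ)) =ᵐ[volume] fun x => g (x - ξ) :=
  (measurePreserving_sub_right volume ξ).quasiMeasurePreserving.ae_eq_comp h

theorem translateSub_congr {f g : ℝ → ℝ} (h : f =ᵐ[volume] g) (ξ : ℝ) :
    translateSub f ξ =ᵐ[volume] translateSub g ξ :=
  (ae_translate h ξ).sub h

theorem aesm_translateSub {f : ℝ → ℝ} (hf : AEStronglyMeasurable f volume) (ξ : ℝ) :
    AEStronglyMeasurable (translateSub f ξ) volume :=
  (hf.comp_measurePreserving (measurePreserving_sub_right volume ξ)).sub hf

/-- `L²_ul(ℝ)`: the (classes of) measurable functions `f` with `‖f‖_{L²_ul} < ∞` (which entails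
`f ∈ L²_loc`) and `‖T_ξ f - f‖_{L²_ul} → 0` as `ξ → 0`. -/
def L2ul : Submodule ℝ (ℝ →ₘ[volume] ℝ) where
  carrier := {f | ulENorm f < ⊤ ∧ Tendsto (fun ξ => ulENorm (translateSub f ξ)) (𝓝 0) (𝓝 0)}
  zero_mem' := by
    have h0 : ((0 : ℝ →ₘ[volume] ℝ) : ℝ → ℝ) =ᵐ[volume] fun _ => (0 : ℝ) := AEEqFun.coeFn_zero
    refine ⟨by rw [ulENorm_congr h0, ulENorm_zero]; exact ENNReal.zero_lt_top, ?_⟩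
    have : ∀ ξ : ℝ, ulENorm (translateSub ((0 : ℝ →ₘ[volume] ℝ) : ℝ → ℝ) ξ) = 0 := fun ξ => by
      rw [ulENorm_congr (translateSub_congr h0 ξ), ← ulENorm_zero]
      congr 1
      funext x
      simp [translateSub]
    simp [this]
  add_mem' := by
    rintro f g ⟨hf, hf'⟩ ⟨hg, hg'⟩
    have h0 : ((f + g : ℝ →ₘ[volume] ℝ) : ℝ → ℝ) =ᵐ[volume] fun x => f x + g x :=
      AEEqFun.coeFn_add f g
    refine ⟨?_, ?_⟩
    · rw [ulENorm_congr h0]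
      exact (ulENorm_add_le f.aestronglyMeasurable g.aestronglyMeasurable).trans_lt
        (ENNReal.add_lt_top.2 ⟨hf, hg⟩)
    · refine tendsto_of_tendsto_of_tendsto_of_le_of_le tendsto_const_nhds
        (by simpa using hf'.add hg') (fun _ => zero_le) fun ξ => ?_
      have h1 : translateSub (fun x => f x + g x) ξ
          = fun x => translateSub f ξ x + translateSub g ξ x := by
        funext x
        simp only [translateSub]
        ring
      show ulENorm _ ≤ _
      rw [ulENorm_congr (translateSub_congr h0 ξ), h1]
      exact ulENorm_add_le (aesm_translateSub f.aestronglyMeasurable ξ)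
        (aesm_translateSub g.aestronglyMeasurable ξ)
  smul_mem' := by
    rintro c f ⟨hf, hf'⟩
    have h0 : ((c • f : ℝ →ₘ[volume] ℝ) : ℝ → ℝ) =ᵐ[volume] fun x => c * f x :=
      AEEqFun.coeFn_smul c f
    refine ⟨?_, ?_⟩
    · rw [ulENorm_congr h0, ulENorm_const_mul]
      exact ENNReal.mul_lt_top (by simp) hf
    · have h1 : ∀ ξ : ℝ, ulENorm (translateSub ((c • f : ℝ →ₘ[volume] ℝ) : ℝ → ℝ) ξ)
          = ‖c‖ₑ * ulENorm (translateSub f ξ) := fun ξ => by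
        rw [ulENorm_congr (translateSub_congr h0 ξ), ← ulENorm_const_mul]
        congr 1
        funext x
        simp only [translateSub]
        ring
      simp only [h1]
      simpa using ENNReal.Tendsto.const_mul hf' (Or.inr (by simp : ‖c‖ₑ ≠ ⊤))

instance : CoeFun L2ul (fun _ => ℝ → ℝ) := ⟨fun f => ((f : ℝ →ₘ[volume] ℝ) : ℝ → ℝ)⟩

/-- `‖f‖_{L²_ul} = sup_ξ (∫_ξ^{ξ+1} |f|²)^{1/2}`. -/
instance : Norm L2ul := ⟨fun f => (ulENorm f).toReal⟩

theorem norm_L2ul (f : L2ul) : ‖f‖ = (ulENorm f).toReal := rfl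

instance : NormedAddCommGroup L2ul :=
  AddGroupNorm.toNormedAddCommGroup
    { toFun := fun f : L2ul => ‖f‖
      map_zero' := by
        have h0 : ((0 : ℝ →ₘ[volume] ℝ) : ℝ → ℝ) =ᵐ[volume] fun _ => (0 : ℝ) :=
          AEEqFun.coeFn_zero
        rw [norm_L2ul, Submodule.coe_zero, ulENorm_congr h0, ulENorm_zero, ENNReal.toReal_zero]
      add_le' := fun f g => by
        have h0 : ((f + g : L2ul) : ℝ → ℝ) =ᵐ[volume] fun x => f x + g x :=
          AEEqFun.coeFn_add f.1 g.1
        rw [norm_L2ul, norm_L2ul, norm_L2ul, ← ENNReal.toReal_add f.2.1.ne g.2.1.ne,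
          ulENorm_congr h0]
        exact ENNReal.toReal_mono (ENNReal.add_ne_top.2 ⟨f.2.1.ne, g.2.1.ne⟩)
          (ulENorm_add_le f.1.aestronglyMeasurable g.1.aestronglyMeasurable)
      neg' := fun f => by
        have h0 : ((-f : L2ul) : ℝ → ℝ) =ᵐ[volume] fun x => (-1) * f x :=
          (AEEqFun.coeFn_neg f.1).trans (.of_forall fun x => by simp)
        rw [norm_L2ul, norm_L2ul, ulENorm_congr h0, ulENorm_const_mul]
        simp
      eq_zero_of_map_eq_zero' := fun f hf => by
        have h1 : ulENorm f = 0 :=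
          ((ENNReal.toReal_eq_zero_iff _).1 hf).resolve_right f.2.1.ne
        exact Subtype.ext (AEEqFun.ext ((ae_eq_zero_of_ulENorm f.1.aestronglyMeasurable h1).trans
          AEEqFun.coeFn_zero.symm)) }

instance : NormedSpace ℝ L2ul where
  norm_smul_le c f := by
    have h0 : ((c • f : L2ul) : ℝ → ℝ) =ᵐ[volume] fun x => c * f x := AEEqFun.coeFn_smul c f.1
    show (ulENorm (c • f : L2ul)).toReal ≤ ‖c‖ * (ulENorm f).toReal
    rw [ulENorm_congr h0, ulENorm_const_mul, ENNReal.toReal_mul]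
    simp

/-! ### The uniformly local Sobolev space -/

/-- Smooth compactly supported test functions on `ℝ`. -/
def IsTest (φ : ℝ → ℝ) : Prop := ContDiff ℝ ∞ φ ∧ HasCompactSupport φ

/-- `g` is the weak derivative of `f` on `ℝ`. -/
def HasWeakDeriv (f g : ℝ → ℝ) : Prop :=
  ∀ φ : ℝ → ℝ, IsTest φ → ∫ x, f x * deriv φ x = -∫ x, g x * φ x

theorem locallyIntegrable_L2ul (f : L2ul) : LocallyIntegrable (f : ℝ → ℝ) := fun x => by
  refine ⟨Icc (x - 1 / 2) (x - 1 / 2 + 1), Icc_mem_nhds (by linarith) (by linarith), ?_⟩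
  have h1 : MemLp (f : ℝ → ℝ) 2 (volume.restrict (Icc (x - 1 / 2) (x - 1 / 2 + 1))) :=
    ⟨f.1.aestronglyMeasurable.restrict, (le_iSup (fun ξ : ℝ =>
      eLpNorm (f : ℝ → ℝ) 2 (volume.restrict (Icc ξ (ξ + 1)))) _).trans_lt f.2.1⟩
  exact h1.integrable (by norm_num)

theorem integrable_L2ul_mul (f : L2ul) {φ : ℝ → ℝ} (hφ : Continuous φ)
    (hc : HasCompactSupport φ) : Integrable (fun x => f x * φ x) := by
  simpa [mul_comm] using
    (locallyIntegrable_L2ul f).integrable_smul_left_of_hasCompactSupport hφ hc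

theorem IsTest.continuous_deriv {φ : ℝ → ℝ} (h : IsTest φ) : Continuous (deriv φ) :=
  h.1.continuous_deriv (by simp)

/-- `H¹_ul(ℝ)`: the `u ∈ L²_ul` having a weak derivative `∂u ∈ L²_ul`. An element is stored as the
pair `(u, ∂u)`, in which `∂u` is determined by `u`; the norm it inherits from the `ℓ²` product is
`(‖u‖²_{L²_ul} + ‖∂u‖²_{L²_ul})^{1/2}`. -/
def H1ul : Submodule ℝ (WithLp 2 (L2ul × L2ul)) where
  carrier := {p | HasWeakDeriv p.fst p.snd}
  zero_mem' := fun φ _ => by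
    have h0 : ((0 : L2ul) : ℝ → ℝ) =ᵐ[volume] fun _ => (0 : ℝ) := AEEqFun.coeFn_zero
    have h1 : ∀ ψ : ℝ → ℝ, ∫ x, (0 : L2ul) x * ψ x = 0 := fun ψ => by
      rw [← integral_zero ℝ ℝ (μ := volume)]
      exact integral_congr_ae (h0.mono fun x hx => by simp only [hx, zero_mul])
    show ∫ x, (0 : L2ul) x * deriv φ x = -∫ x, (0 : L2ul) x * φ x
    rw [h1, h1, neg_zero]
  add_mem' := fun {p q} hp hq φ hφ => by
    have h1 : ∀ (f g : L2ul) (ψ : ℝ → ℝ), Continuous ψ → HasCompactSupport ψ →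
        ∫ x, (f + g) x * ψ x = (∫ x, f x * ψ x) + ∫ x, g x * ψ x := fun f g ψ hψ hc => by
      rw [← integral_add (integrable_L2ul_mul f hψ hc) (integrable_L2ul_mul g hψ hc)]
      refine integral_congr_ae ((AEEqFun.coeFn_add f.1 g.1).mono fun x hx => ?_)
      show ((f.1 + g.1 : ℝ →ₘ[volume] ℝ) : ℝ → ℝ) x * ψ x = _
      rw [hx, Pi.add_apply, add_mul]
    show ∫ x, (p.fst + q.fst) x * deriv φ x = -∫ x, (p.snd + q.snd) x * φ x
    rw [h1 _ _ _ hφ.continuous_deriv hφ.2.deriv, h1 _ _ _ hφ.1.continuous hφ.2, hp φ hφ, hq φ hφ]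
    ring
  smul_mem' := fun c p hp φ hφ => by
    have h1 : ∀ (f : L2ul) (ψ : ℝ → ℝ), ∫ x, (c • f) x * ψ x = c * ∫ x, f x * ψ x :=
      fun f ψ => by
        rw [← integral_const_mul]
        refine integral_congr_ae ((AEEqFun.coeFn_smul c f.1).mono fun x hx => ?_)
        show ((c • f.1 : ℝ →ₘ[volume] ℝ) : ℝ → ℝ) x * ψ x = _
        rw [hx, Pi.smul_apply, smul_eq_mul, mul_assoc]
    show ∫ x, (c • p.fst) x * deriv φ x = -∫ x, (c • p.snd) x * φ x
    rw [h1, h1, hp φ hφ, mul_neg]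

/-- The function `u` underlying an element of `H¹_ul`. -/
def toL2 (u : H1ul) : L2ul := u.1.fst

/-- The weak derivative `∂u` of an element of `H¹_ul`. -/
def dx (u : H1ul) : L2ul := u.1.snd

/-- An element of `H¹_ul` is determined by its underlying function. -/
theorem toL2_injective : Function.Injective toL2 := fun u v h => by
  have h1 : ((dx u : L2ul) : ℝ → ℝ) =ᵐ[volume] (dx v : L2ul) := by
    refine ae_eq_of_integral_contDiff_smul_eq (locallyIntegrable_L2ul _)
      (locallyIntegrable_L2ul _) fun φ hφ hc => ?_
    have hu := u.2 φ ⟨hφ, hc⟩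
    have hv := v.2 φ ⟨hφ, hc⟩
    have h2 : u.1.fst = v.1.fst := h
    rw [h2] at hu
    have h3 := neg_injective (hu.symm.trans hv)
    simpa only [dx, smul_eq_mul, mul_comm] using h3
  exact Subtype.ext (WithLp.ofLp_injective 2 (Prod.ext h (Subtype.ext (AEEqFun.ext h1))))

theorem norm_sq_H1ul (u : H1ul) : ‖u‖ ^ 2 = ‖toL2 u‖ ^ 2 + ‖dx u‖ ^ 2 :=
  WithLp.prod_norm_sq_eq_of_L2 u.1

/-! ### The damped wave equation -/

/-- The assumptions on the potential: `V` is of class `C³`, coercive, and bistable. -/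
structure IsBistable (V : ℝ → ℝ) : Prop where
  contDiff : ContDiff ℝ 3 V
  coercive : ∃ a b : ℝ, 0 < a ∧ 0 < b ∧ ∀ u : ℝ, a * u ^ 2 - b ≤ u * deriv V u
  zero : V 0 = 0 ∧ deriv V 0 = 0 ∧ 0 < deriv (deriv V) 0
  one : V 1 < 0 ∧ deriv V 1 = 0 ∧ 0 < deriv (deriv V) 1
  crit : {u : ℝ | deriv V u = 0 ∧ V u ≤ 0} = {0, 1}

/-- The time derivative `u_t(t) ∈ L²_ul` of a curve `u : [0,∞) → H¹_ul`, taken in `L²_ul`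
(one-sided at `t = 0`). -/
def timeDeriv (u : ℝ → H1ul) (t : ℝ) : L2ul :=
  derivWithin (fun s => toL2 (u s)) (Ici 0) t

/-- `u ∈ C⁰([0,∞), H¹_ul) ∩ C¹([0,∞), L²_ul)` is a solution of `α u_tt + u_t = u_xx - V'(u)` with
`u(0) = u₀` and `u_t(0) = u₁`. The equation is understood weakly: for each test function `φ(x)` the
function `t ↦ ⟨u_t(t), φ⟩` is differentiable on `[0,∞)`, and
`α (d/dt) ⟨u_t, φ⟩ + ⟨u_t, φ⟩ = - ⟨u_x, φ'⟩ - ⟨V'(u), φ⟩`.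
Only the values `u(t)` with `t ≥ 0` matter. -/
structure IsSolution (α : ℝ) (V : ℝ → ℝ) (u₀ : H1ul) (u₁ : L2ul) (u : ℝ → H1ul) : Prop where
  continuousOn : ContinuousOn u (Ici 0)
  contDiffOn : ContDiffOn ℝ 1 (fun t => toL2 (u t)) (Ici 0)
  initial : u 0 = u₀
  initial_timeDeriv : timeDeriv u 0 = u₁
  equation : ∀ φ : ℝ → ℝ, IsTest φ → ∃ A : ℝ → ℝ, ∀ t : ℝ, 0 ≤ t →
    HasDerivWithinAt (fun s => ∫ x, timeDeriv u s x * φ x) (A t) (Ici 0) t ∧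
    α * A t + (∫ x, timeDeriv u t x * φ x)
      = -(∫ x, dx (u t) x * deriv φ x) - (∫ x, deriv V (toL2 (u t) x) * φ x)

end DampedWave

end

noncomputable section

namespace DampedWave

open scoped NNReal

/-! ### Basic facts on `L²_ul` -/

/-! Let `c` be the wave speed, `α c² = 1`, and set `p = u_t + c u_x`, `q = u_t - c u_x`. The
equation becomes two transport equations `p_t - c p_x = q_t + c q_x = -c² (u_t + V'(u))` together
with `u_t = (p + q) / 2`. Translations are isometries of `L²_ul` and, by the definition of that
space, strongly continuous. Hence, if `V'` is replaced by a globally Lipschitz `f`, the unknowns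
`(u, T_{ct} p, T_{-ct} q)` solve an ordinary differential equation in the Banach space `(L²_ul)³`
with a Lipschitz field, and Picard–Lindelöf and Gronwall apply (`exists_charSol`,
`CharSol.norm_sub_le`). The constraint `c u_x = (p - q) / 2` is propagated (`CharSol.compat`), and
the system is equivalent to the weak formulation (`CharSol.of_isSolution`, `isSolution_of_charSol`).

The truncation is removed by an energy estimate. With the weight `e^{-κ|x-ξ|}`, the energy built
from `α p + u/2`, `α q + u/2`, `u` and the primitive `F` of `f` dissipates a multiple of the
weighted square norm of `(u, p, q)`, up to a constant, as soon as `κ` is small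
(`eventually_slope_energy_lt`). Its constants involve only the coercivity of `f` and a lower bound
of `F`, which are uniform in the truncation level (`IsBistable.exists_truncation`). This bounds `(u,
p, q)` on `[0,T]`, hence `u` in `L^∞` by Sobolev, independently of the level; beyond a large level
the truncation is never felt. Existence, uniqueness and Lipschitz dependence on bounded sets of data
follow.

For the absorbing ball the dissipation has to control the energy, but the weighted square norm does
not bound the weighted potential energy, as `V` may grow arbitrarily fast. If the square norm at `ξ`
is bounded, then `u` is bounded near `ξ`; the energy far from `ξ` is a small fraction of the
energies centred at `ξ ± L`. So the energy at `ξ` is at most half of any common bound of the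
energies, plus a constant (`HasTruncations.exists_local_bound`). Therefore any centre whose energy
is close to a large common bound has a large square norm, and its energy decreases at speed at least
one. A barrier argument (`le_barrier`) brings all energies below a fixed constant in finite time. -/

theorem aesm (f : L2ul) : AEStronglyMeasurable (f : ℝ → ℝ) volume :=
  f.1.aestronglyMeasurable

theorem L2ul_ext {f g : L2ul} (h : (f : ℝ → ℝ) =ᵐ[volume] g) : f = g :=
  Subtype.ext (AEEqFun.ext h)

theorem coeFn_add (f g : L2ul) : ((f + g : L2ul) : ℝ → ℝ) =ᵐ[volume] fun x => f x + g x :=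
  AEEqFun.coeFn_add f.1 g.1

theorem coeFn_sub (f g : L2ul) : ((f - g : L2ul) : ℝ → ℝ) =ᵐ[volume] fun x => f x - g x :=
  AEEqFun.coeFn_sub f.1 g.1

theorem coeFn_smul (c : ℝ) (f : L2ul) :
    ((c • f : L2ul) : ℝ → ℝ) =ᵐ[volume] fun x => c * f x :=
  AEEqFun.coeFn_smul c f.1

theorem ulENorm_eq (f : L2ul) : ulENorm f = ENNReal.ofReal ‖f‖ := by
  rw [norm_L2ul, ENNReal.ofReal_toReal f.2.1.ne]

theorem ulENorm_sub_eq (f g : L2ul) :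
    ulENorm (fun x => f x - g x) = ENNReal.ofReal ‖f - g‖ := by
  rw [← ulENorm_eq, ulENorm_congr (coeFn_sub f g)]

theorem ulENorm_le_of_ae {f g : ℝ → ℝ} {C : ℝ≥0} (h : ∀ᵐ x, ‖f x‖ ≤ C * ‖g x‖) :
    ulENorm f ≤ C * ulENorm g := by
  refine iSup_le fun ξ => ?_
  refine (eLpNorm_le_nnreal_smul_eLpNorm_of_ae_le_mul (c := C) (g := g) (ae_restrict_of_ae ?_)
    2).trans ?_
  · filter_upwards [h] with x hx
    exact_mod_cast hx
  · rw [ENNReal.smul_def, smul_eq_mul]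
    gcongr
    exact le_iSup (fun ξ : ℝ => eLpNorm g 2 (volume.restrict (Icc ξ (ξ + 1)))) ξ

theorem norm_le_of_ae {f g : L2ul} {C : ℝ≥0} (h : ∀ᵐ x, ‖f x‖ ≤ C * ‖g x‖) :
    ‖f‖ ≤ C * ‖g‖ := by
  have h1 := ulENorm_le_of_ae h
  rw [ulENorm_eq, ulENorm_eq, ← ENNReal.ofReal_coe_nnreal, ← ENNReal.ofReal_mul C.coe_nonneg] at h1
  exact (ENNReal.ofReal_le_ofReal_iff (by positivity)).1 h1

/-- Build an element of `L²_ul` from a function. -/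
def mkL2 (g : ℝ → ℝ) (hg : AEStronglyMeasurable g volume) (h1 : ulENorm g < ⊤)
    (h2 : Tendsto (fun ξ => ulENorm (translateSub g ξ)) (𝓝 0) (𝓝 0)) : L2ul :=
  ⟨AEEqFun.mk g hg, by
    have h0 : (AEEqFun.mk g hg : ℝ → ℝ) =ᵐ[volume] g := AEEqFun.coeFn_mk g hg
    refine ⟨by rwa [ulENorm_congr h0], ?_⟩
    refine h2.congr fun ξ => ?_
    exact (ulENorm_congr (translateSub_congr h0 ξ)).symm⟩

theorem coeFn_mkL2 {g : ℝ → ℝ} (hg : AEStronglyMeasurable g volume) (h1 : ulENorm g < ⊤)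
    (h2 : Tendsto (fun ξ => ulENorm (translateSub g ξ)) (𝓝 0) (𝓝 0)) :
    (mkL2 g hg h1 h2 : ℝ → ℝ) =ᵐ[volume] g := AEEqFun.coeFn_mk g hg

/-! ### Translations -/

theorem ulENorm_translate {f : ℝ → ℝ} (hf : AEStronglyMeasurable f volume) (ξ : ℝ) :
    ulENorm (fun x => f (x - ξ)) = ulENorm f := by
  unfold ulENorm
  have h : ∀ a : ℝ, eLpNorm (fun x => f (x - ξ)) 2 (volume.restrict (Icc a (a + 1)))
      = eLpNorm f 2 (volume.restrict (Icc (a - ξ) (a - ξ + 1))) := fun a => by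
    have hm := (measurePreserving_sub_right volume ξ).restrict_preimage
      (measurableSet_Icc : MeasurableSet (Icc (a - ξ) (a - ξ + 1)))
    have hp : (fun x => x - ξ) ⁻¹' Icc (a - ξ) (a - ξ + 1) = Icc a (a + 1) := by
      ext x
      simp only [mem_preimage, mem_Icc]
      constructor <;> rintro ⟨h1, h2⟩ <;> constructor <;> linarith
    rw [hp] at hm
    exact eLpNorm_comp_measurePreserving hf.restrict hm
  simp_rw [h]
  exact (Equiv.subRight ξ).iSup_congr fun a => rfl

theorem translate_aesm {f : ℝ → ℝ} (hf : AEStronglyMeasurable f volume) (ξ : ℝ) :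
    AEStronglyMeasurable (fun x => f (x - ξ)) volume :=
  hf.comp_measurePreserving (measurePreserving_sub_right volume ξ)

theorem ulENorm_translate_lt_top (ξ : ℝ) (f : L2ul) : ulENorm (fun x => f (x - ξ)) < ⊤ := by
  rw [ulENorm_translate (aesm f)]
  exact f.2.1

theorem tendsto_translateSub_translate (ξ : ℝ) (f : L2ul) :
    Tendsto (fun η => ulENorm (translateSub (fun x => f (x - ξ)) η)) (𝓝 0) (𝓝 0) := by
  refine f.2.2.congr fun η => ?_
  rw [← ulENorm_translate (aesm_translateSub (aesm f) η) ξ]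
  congr 1
  funext x
  simp only [translateSub]
  congr 2
  ring

/-- The translation `T_ξ` on `L²_ul`. -/
def Tr (ξ : ℝ) : L2ul →ₗᵢ[ℝ] L2ul where
  toFun f := mkL2 (fun x => f (x - ξ)) (translate_aesm (aesm f) ξ)
    (ulENorm_translate_lt_top ξ f) (tendsto_translateSub_translate ξ f)
  map_add' f g := by
    refine L2ul_ext ?_
    filter_upwards [coeFn_mkL2 (translate_aesm (aesm (f + g)) ξ) _ _,
      coeFn_mkL2 (translate_aesm (aesm f) ξ) _ _, coeFn_mkL2 (translate_aesm (aesm g) ξ) _ _,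
      coeFn_add (mkL2 (fun x => f (x - ξ)) (translate_aesm (aesm f) ξ) _ _)
        (mkL2 (fun x => g (x - ξ)) (translate_aesm (aesm g) ξ) _ _),
      ae_translate (coeFn_add f g) ξ] with x h1 h2 h3 h4 h5
    rw [h1, h4, h5, h2, h3]
  map_smul' c f := by
    refine L2ul_ext ?_
    filter_upwards [coeFn_mkL2 (translate_aesm (aesm (c • f)) ξ) _ _,
      coeFn_mkL2 (translate_aesm (aesm f) ξ) _ _,
      coeFn_smul c (mkL2 (fun x => f (x - ξ)) (translate_aesm (aesm f) ξ) _ _),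
      ae_translate (coeFn_smul c f) ξ] with x h1 h2 h4 h5
    rw [h1, RingHom.id_apply, h4, h5, h2]
  norm_map' f := by
    show (ulENorm (mkL2 _ (translate_aesm (aesm f) ξ) (ulENorm_translate_lt_top ξ f)
      (tendsto_translateSub_translate ξ f) : L2ul)).toReal = (ulENorm f).toReal
    rw [ulENorm_congr (coeFn_mkL2 _ _ _), ulENorm_translate (aesm f)]

theorem coeFn_Tr (ξ : ℝ) (f : L2ul) : (Tr ξ f : ℝ → ℝ) =ᵐ[volume] fun x => f (x - ξ) :=
  coeFn_mkL2 (translate_aesm (aesm f) ξ) (ulENorm_translate_lt_top ξ f)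
    (tendsto_translateSub_translate ξ f)

theorem Tr_Tr (ξ η : ℝ) (f : L2ul) : Tr ξ (Tr η f) = Tr (ξ + η) f := by
  refine L2ul_ext ?_
  filter_upwards [coeFn_Tr ξ (Tr η f), coeFn_Tr (ξ + η) f, ae_translate (coeFn_Tr η f) ξ]
    with x h1 h2 h3
  rw [h1, h2, h3]
  congr 1
  ring

@[simp] theorem Tr_zero (f : L2ul) : Tr 0 f = f := by
  refine L2ul_ext ?_
  filter_upwards [coeFn_Tr 0 f] with x h1
  rw [h1, sub_zero]

@[simp] theorem Tr_neg_Tr (ξ : ℝ) (f : L2ul) : Tr (-ξ) (Tr ξ f) = f := by simp [Tr_Tr]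

theorem tendsto_norm_Tr_sub (f : L2ul) : Tendsto (fun ξ => ‖Tr ξ f - f‖) (𝓝 0) (𝓝 0) := by
  have h := (ENNReal.tendsto_toReal ENNReal.zero_ne_top).comp f.2.2
  rw [ENNReal.toReal_zero] at h
  refine h.congr fun ξ => ?_
  simp only [Function.comp]
  rw [norm_L2ul, ulENorm_congr (coeFn_sub _ _)]
  congr 1
  refine ulENorm_congr ?_
  filter_upwards [coeFn_Tr ξ f] with x hx
  rw [hx, translateSub]

/-- Since each `Tr ξ` is an isometry, joint continuity reduces to continuity at `ξ = 0` for one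
fixed element, which is the second condition defining `L2ul`. -/
theorem continuous_Tr : Continuous fun z : ℝ × L2ul => Tr z.1 z.2 := by
  refine continuous_iff_continuousAt.2 fun z => ?_
  rw [ContinuousAt, tendsto_iff_norm_sub_tendsto_zero]
  have h1 : Tendsto (fun w : ℝ × L2ul => ‖w.2 - z.2‖ + ‖Tr (w.1 - z.1) z.2 - z.2‖) (𝓝 z)
      (𝓝 0) := by
    have h2 : Tendsto (fun w : ℝ × L2ul => ‖w.2 - z.2‖) (𝓝 z) (𝓝 0) :=
      tendsto_iff_norm_sub_tendsto_zero.1 (continuous_snd.tendsto z)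
    have h3 : Tendsto (fun w : ℝ × L2ul => w.1 - z.1) (𝓝 z) (𝓝 0) := by
      have : Continuous fun w : ℝ × L2ul => w.1 - z.1 := by fun_prop
      simpa using this.tendsto z
    simpa using h2.add ((tendsto_norm_Tr_sub z.2).comp h3)
  refine squeeze_zero (fun _ => norm_nonneg _) (fun w => ?_) h1
  have e : Tr w.1 w.2 - Tr z.1 z.2
      = Tr w.1 (w.2 - z.2) + Tr z.1 (Tr (w.1 - z.1) z.2 - z.2) := by
    simp only [map_sub, Tr_Tr]
    rw [add_sub_cancel]
    abel
  rw [e]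
  refine (norm_add_le _ _).trans ?_
  rw [(Tr _).norm_map, (Tr _).norm_map]

theorem _root_.ContinuousWithinAt.Tr {S : Set ℝ} {a : ℝ → ℝ} {w : ℝ → L2ul} {s : ℝ}
    (ha : ContinuousWithinAt a S s) (hw : ContinuousWithinAt w S s) :
    ContinuousWithinAt (fun t => Tr (a t) (w t)) S s :=
  continuous_Tr.continuousAt.comp_continuousWithinAt (ha.prodMk hw)

/-! ### Completeness -/

/-- Riesz–Fischer on unit intervals gives an almost everywhere limit on the whole line. Fatou's
lemma on each interval keeps the rate `2^{-N}` uniformly in the interval, and continuity of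
translations survives by an `ε/3` argument. -/
instance : CompleteSpace L2ul := by
  refine Metric.complete_of_convergent_controlled_sequences (fun n => (1 / 2 : ℝ) ^ n)
    (fun n => by positivity) fun u hu => ?_
  have hu' : ∀ N n m, N ≤ n → N ≤ m →
      ulENorm (fun x => u n x - u m x) < ENNReal.ofReal ((1 / 2 : ℝ) ^ N) := fun N n m hn hm => by
    rw [ulENorm_sub_eq, ← dist_eq_norm]
    exact (ENNReal.ofReal_lt_ofReal_iff (by positivity)).2 (hu N n m hn hm)
  have hB : ∑' n, ENNReal.ofReal ((1 / 2 : ℝ) ^ n) ≠ ⊤ := by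
    rw [← ENNReal.ofReal_tsum_of_nonneg (fun n => by positivity)
      (summable_geometric_of_lt_one (by norm_num) (by norm_num))]
    exact ENNReal.ofReal_ne_top
  have hloc : ∀ ξ : ℝ, ∀ᵐ x ∂(volume.restrict (Icc ξ (ξ + 1))), ∃ l : ℝ,
      Tendsto (fun n => u n x) atTop (𝓝 l) := fun ξ => by
    refine Lp.ae_tendsto_of_cauchy_eLpNorm (p := 2) (fun n => (aesm (u n)).restrict) (by norm_num)
      hB fun N n m hn hm => ?_
    exact (le_iSup (fun ξ : ℝ => eLpNorm (fun x => u n x - u m x) 2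
      (volume.restrict (Icc ξ (ξ + 1)))) ξ).trans_lt (hu' N n m hn hm)
  have hae : ∀ᵐ x : ℝ, ∃ l : ℝ, Tendsto (fun n => u n x) atTop (𝓝 l) := by
    have h2 := (ae_restrict_iUnion_iff (μ := volume) (fun n : ℤ => Icc (n : ℝ) (n + 1))
      (fun x => ∃ l : ℝ, Tendsto (fun n => u n x) atTop (𝓝 l))).2 fun n => hloc n
    rwa [iUnion_Icc_intCast, Measure.restrict_univ] at h2
  obtain ⟨g, hgm, hg⟩ := exists_stronglyMeasurable_limit_of_tendsto_ae
    (fun n => (aesm (u n))) hae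
  have hga : AEStronglyMeasurable g volume := hgm.aestronglyMeasurable
  have hlim : ∀ N, ulENorm (fun x => u N x - g x) ≤ ENNReal.ofReal ((1 / 2 : ℝ) ^ N) :=
    fun N => by
    refine iSup_le fun ξ => ?_
    refine (Lp.eLpNorm_lim_le_liminf_eLpNorm (f := fun n x => u N x - u n x)
      (fun n => ((aesm (u N)).sub (aesm (u n))).restrict) _ (ae_restrict_of_ae ?_)).trans ?_
    · filter_upwards [hg] with x hx
      exact tendsto_const_nhds.sub hx
    · refine liminf_le_of_le (by isBoundedDefault) fun b hb => ?_
      obtain ⟨n, hn, hn'⟩ := (hb.and (eventually_ge_atTop N)).exists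
      refine hn.trans (le_trans ?_ (hu' N N n le_rfl hn').le)
      exact le_iSup (fun ξ : ℝ => eLpNorm (fun x => u N x - u n x) 2
        (volume.restrict (Icc ξ (ξ + 1)))) ξ
  have hdm : ∀ N, AEStronglyMeasurable (fun x => u N x - g x) volume := fun N =>
    (aesm (u N)).sub hga
  have hneg : ∀ N, ulENorm (fun x => g x - u N x) = ulENorm (fun x => u N x - g x) := fun N => by
    have := ulENorm_const_mul (-1) (fun x => u N x - g x)
    simpa using this
  have hgt : ulENorm g < ⊤ := by
    have : g = fun x => u 0 x + (g x - u 0 x) := by funext x; ring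
    rw [this]
    refine (ulENorm_add_le (aesm (u 0)) (hga.sub (aesm (u 0)))).trans_lt (ENNReal.add_lt_top.2
      ⟨(u 0).2.1, ?_⟩)
    show ulENorm (fun x => g x - u 0 x) < ⊤
    rw [hneg]
    exact (hlim 0).trans_lt ENNReal.ofReal_lt_top
  have hpow : Tendsto (fun N : ℕ => ENNReal.ofReal ((1 / 2 : ℝ) ^ N)) atTop (𝓝 0) := by
    have := ENNReal.tendsto_ofReal
      (tendsto_pow_atTop_nhds_zero_of_lt_one (r := (1 / 2 : ℝ)) (by norm_num) (by norm_num))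
    simpa using this
  have hgc : Tendsto (fun ξ => ulENorm (translateSub g ξ)) (𝓝 0) (𝓝 0) := by
    rw [ENNReal.tendsto_nhds_zero]
    intro ε hε
    have hε3 : 0 < ε / 3 := ENNReal.div_pos hε.ne' (by norm_num)
    obtain ⟨N, hN⟩ := ((ENNReal.tendsto_nhds_zero.1 hpow) (ε / 3) hε3).exists
    have hNc := (ENNReal.tendsto_nhds_zero.1 (u N).2.2) (ε / 3) hε3
    filter_upwards [hNc] with ξ hξ
    have e : translateSub g ξ = fun x => (g (x - ξ) - u N (x - ξ))
        + (translateSub (u N) ξ x + (u N x - g x)) := by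
      funext x
      simp only [translateSub]
      ring
    rw [e]
    refine (ulENorm_add_le (translate_aesm (hga.sub (aesm (u N))) ξ)
      ((aesm_translateSub (aesm (u N)) ξ).add (hdm N))).trans ?_
    have a1 : ulENorm (fun x => g (x - ξ) - u N (x - ξ)) ≤ ε / 3 := by
      rw [ulENorm_translate (f := fun x => g x - u N x) (hga.sub (aesm (u N))) ξ, hneg]
      exact (hlim N).trans hN
    have a2 := (ulENorm_add_le (aesm_translateSub (aesm (u N)) ξ) (hdm N)).trans
      (add_le_add hξ ((hlim N).trans hN))
    refine (add_le_add a1 a2).trans ?_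
    rw [← add_assoc, ENNReal.add_thirds]
  refine ⟨mkL2 g hga hgt hgc, ?_⟩
  rw [tendsto_iff_norm_sub_tendsto_zero]
  refine squeeze_zero (fun _ => norm_nonneg _) (fun N => ?_)
    (tendsto_pow_atTop_nhds_zero_of_lt_one (r := (1 / 2 : ℝ)) (by norm_num) (by norm_num))
  refine (ENNReal.ofReal_le_ofReal_iff (by positivity)).1 ?_
  rw [← ulENorm_sub_eq]
  refine le_trans (le_of_eq (ulENorm_congr ?_)) (hlim N)
  filter_upwards [coeFn_mkL2 hga hgt hgc] with x hx
  rw [hx]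

/-! ### Nemytskii operators -/

theorem ulENorm_const_lt_top (a : ℝ) : ulENorm (fun _ => a) < ⊤ := by
  refine lt_of_le_of_lt (iSup_le fun ξ => ?_) (ENNReal.coe_lt_top (r := ‖a‖₊))
  rw [eLpNorm_const _ (by norm_num) (by simp)]
  simp [enorm]

/-- The operator `u ↦ f ∘ u` on `L²_ul`, for a Lipschitz function `f` vanishing at `0`. -/
def nem (f : ℝ → ℝ) (K : ℝ≥0) (hf : LipschitzWith K f) (h0 : f 0 = 0) (u : L2ul) : L2ul :=
  mkL2 (fun x => f (u x)) (hf.continuous.comp_aestronglyMeasurable (aesm u))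
    (by
      have : ∀ᵐ x : ℝ, ‖f (u x)‖ ≤ K * ‖u x‖ := .of_forall fun x => by
        simpa [h0] using hf.norm_sub_le (u x) 0
      exact (ulENorm_le_of_ae this).trans_lt (ENNReal.mul_lt_top ENNReal.coe_lt_top u.2.1))
    (by
      have h1 : ∀ ξ, ulENorm (translateSub (fun x => f (u x)) ξ)
          ≤ K * ulENorm (translateSub u ξ) := fun ξ =>
        ulENorm_le_of_ae (.of_forall fun x => hf.norm_sub_le _ _)
      refine tendsto_of_tendsto_of_tendsto_of_le_of_le tendsto_const_nhds ?_
        (fun _ => zero_le) h1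
      simpa using ENNReal.Tendsto.const_mul u.2.2 (Or.inr (by simp : (K : ℝ≥0∞) ≠ ⊤)))

theorem coeFn_nem {f : ℝ → ℝ} {K : ℝ≥0} (hf : LipschitzWith K f) (h0 : f 0 = 0) (u : L2ul) :
    (nem f K hf h0 u : ℝ → ℝ) =ᵐ[volume] fun x => f (u x) := coeFn_mkL2 _ _ _

theorem lipschitzWith_nem {f : ℝ → ℝ} {K : ℝ≥0} (hf : LipschitzWith K f) (h0 : f 0 = 0) :
    LipschitzWith K (nem f K hf h0) := by
  refine LipschitzWith.of_dist_le_mul fun u v => ?_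
  rw [dist_eq_norm, dist_eq_norm]
  refine norm_le_of_ae ?_
  filter_upwards [coeFn_sub (nem f K hf h0 u) (nem f K hf h0 v), coeFn_sub u v,
    coeFn_nem hf h0 u, coeFn_nem hf h0 v] with x h1 h2 h3 h4
  rw [h1, h2, h3, h4]
  exact hf.norm_sub_le _ _

/-- The constant function `1` in `L²_ul`. -/
def oneL2 : L2ul := mkL2 (fun _ => 1) aestronglyMeasurable_const (ulENorm_const_lt_top 1) (by
  have : ∀ ξ, translateSub (fun _ => (1 : ℝ)) ξ = fun _ => 0 := fun ξ => by
    funext x; simp [translateSub]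
  simp [this, ulENorm_zero])

theorem coeFn_oneL2 : (oneL2 : ℝ → ℝ) =ᵐ[volume] fun _ => 1 := coeFn_mkL2 _ _ _

/-! ### Exponential weights -/

/-- The exponential weight `e^{-κ|x-ξ|}`. -/
def wt (κ ξ x : ℝ) : ℝ := Real.exp (-(κ * |x - ξ|))

theorem wt_pos (κ ξ x : ℝ) : 0 < wt κ ξ x := Real.exp_pos _

theorem continuous_wt (κ ξ : ℝ) : Continuous (wt κ ξ) := by
  unfold wt
  fun_prop

theorem wt_le_exp_mul {κ : ℝ} (hκ : 0 ≤ κ) (ξ x y : ℝ) :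
    wt κ ξ x ≤ Real.exp (κ * |x - y|) * wt κ ξ y := by
  unfold wt
  rw [← Real.exp_add]
  refine Real.exp_le_exp.2 ?_
  have h1 := abs_sub_le y x ξ
  rw [abs_sub_comm y x] at h1
  nlinarith [mul_le_mul_of_nonneg_left h1 hκ]

theorem integrable_wt {κ : ℝ} (hκ : 0 < κ) (ξ : ℝ) : Integrable (wt κ ξ) := by
  have h0 : Integrable (fun x : ℝ => Real.exp (-(κ * |x|))) := by
    rw [← integrableOn_univ, ← Iic_union_Ioi (a := (0 : ℝ))]
    refine IntegrableOn.union ?_ ?_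
    · refine (integrableOn_exp_mul_Iic hκ 0).congr_fun (fun x hx => ?_) measurableSet_Iic
      simp only [abs_of_nonpos (mem_Iic.1 hx), mul_neg, neg_neg]
    · refine (integrableOn_exp_mul_Ioi (neg_lt_zero.2 hκ) 0).congr_fun (fun x hx => ?_)
        measurableSet_Ioi
      simp only [abs_of_pos (mem_Ioi.1 hx), neg_mul]
  exact h0.comp_sub_right ξ

/-- The constant comparing weighted integrals with uniformly local ones. -/
def wtC (κ : ℝ) : ℝ := Real.exp κ * ∫ x, wt κ 0 x

theorem integral_wt (κ ξ : ℝ) : ∫ x, wt κ ξ x = ∫ x, wt κ 0 x := by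
  rw [← integral_sub_right_eq_self (fun x => wt κ 0 x) ξ]
  simp [wt]

theorem wtC_nonneg (κ : ℝ) : 0 ≤ wtC κ :=
  mul_nonneg (Real.exp_pos _).le (integral_nonneg fun _ => (wt_pos _ _ _).le)

theorem integral_wt_le_wtC {κ : ℝ} (hκ : 0 ≤ κ) (ξ : ℝ) : ∫ x, wt κ ξ x ≤ wtC κ := by
  rw [integral_wt, wtC]
  exact le_mul_of_one_le_left (integral_nonneg fun _ => (wt_pos _ _ _).le) (Real.one_le_exp hκ)

/-- The weight at `x` is at most `e^κ` times its average over `[x-1, x]`. Tonelli then turns the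
integral over `x` into integrals of `h` over `[y, y+1]`, weighted in `y`. -/
theorem lintegral_wt_mul_le {κ : ℝ} (hκ : 0 < κ) (ξ : ℝ) {h : ℝ → ℝ≥0∞} (hh : Measurable h) :
    ∫⁻ x, ENNReal.ofReal (wt κ ξ x) * h x
      ≤ ENNReal.ofReal (wtC κ) * ⨆ y : ℝ, ∫⁻ x in Icc y (y + 1), h x := by
  have hw : Measurable fun x => ENNReal.ofReal (wt κ ξ x) :=
    (continuous_wt κ ξ).measurable.ennreal_ofReal
  set S : Set (ℝ × ℝ) := {z | z.2 ≤ z.1 ∧ z.1 ≤ z.2 + 1} with hS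
  have hSm : MeasurableSet S :=
    (measurableSet_le measurable_snd measurable_fst).inter
      (measurableSet_le measurable_fst (measurable_snd.add_const 1))
  set k : ℝ → ℝ → ℝ≥0∞ := fun x y =>
    S.indicator (fun z => ENNReal.ofReal (Real.exp κ) * ENNReal.ofReal (wt κ ξ z.2) * h z.1) (x, y)
    with hk
  have hkm : Measurable (Function.uncurry k) :=
    Measurable.indicator ((measurable_const.mul (hw.comp measurable_snd)).mul
      (hh.comp measurable_fst)) hSm
  have h1 : ∀ x, ENNReal.ofReal (wt κ ξ x) * h x ≤ ∫⁻ y, k x y := fun x => by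
    have e : ∀ y, k x y = (Icc (x - 1) x).indicator
        (fun y => ENNReal.ofReal (Real.exp κ) * ENNReal.ofReal (wt κ ξ y) * h x) y := fun y => by
      simp only [hk, hS, indicator, mem_ofPred_eq, mem_Icc]
      refine if_congr ?_ rfl rfl
      constructor <;> rintro ⟨a, b⟩ <;> constructor <;> linarith
    simp_rw [e]
    rw [lintegral_indicator measurableSet_Icc]
    calc ENNReal.ofReal (wt κ ξ x) * h x
        = ∫⁻ _ in Icc (x - 1) x, ENNReal.ofReal (wt κ ξ x) * h x := by
          rw [setLIntegral_const, Real.volume_Icc]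
          simp
      _ ≤ _ := by
          refine setLIntegral_mono' measurableSet_Icc fun y hy => ?_
          gcongr
          rw [← ENNReal.ofReal_mul (Real.exp_pos _).le]
          refine ENNReal.ofReal_le_ofReal ((wt_le_exp_mul hκ.le ξ x y).trans ?_)
          refine mul_le_mul_of_nonneg_right (Real.exp_le_exp.2 ?_) (wt_pos _ _ _).le
          have : |x - y| ≤ 1 := abs_le.2 ⟨by linarith [hy.2], by linarith [hy.1]⟩
          nlinarith
  calc ∫⁻ x, ENNReal.ofReal (wt κ ξ x) * h x ≤ ∫⁻ x, ∫⁻ y, k x y := lintegral_mono h1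
    _ = ∫⁻ y, ∫⁻ x, k x y := lintegral_lintegral_swap hkm.aemeasurable
    _ ≤ ∫⁻ y, (ENNReal.ofReal (Real.exp κ) * ENNReal.ofReal (wt κ ξ y))
          * ⨆ y : ℝ, ∫⁻ x in Icc y (y + 1), h x := by
        refine lintegral_mono fun y => ?_
        have e : ∀ x, k x y = (Icc y (y + 1)).indicator
            (fun x => (ENNReal.ofReal (Real.exp κ) * ENNReal.ofReal (wt κ ξ y)) * h x) x :=
          fun x => by simp only [hk, hS, indicator, mem_ofPred_eq, mem_Icc]
        simp_rw [e]
        rw [lintegral_indicator measurableSet_Icc, lintegral_const_mul _ hh]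
        gcongr
        exact le_iSup (fun y : ℝ => ∫⁻ x in Icc y (y + 1), h x) y
    _ = ENNReal.ofReal (wtC κ) * ⨆ y : ℝ, ∫⁻ x in Icc y (y + 1), h x := by
        rw [lintegral_mul_const _ (hw.const_mul _), lintegral_const_mul _ hw,
          ← ofReal_integral_eq_lintegral_ofReal (integrable_wt hκ ξ)
            (.of_forall fun x => (wt_pos _ _ _).le), integral_wt, wtC,
          ENNReal.ofReal_mul (Real.exp_pos _).le]

theorem lintegral_Icc_mul_le (f g : L2ul) (y : ℝ) :
    ∫⁻ x in Icc y (y + 1), ‖f x * g x‖ₑ ≤ ENNReal.ofReal (‖f‖ * ‖g‖) := by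
  have h := eLpNorm_smul_le_mul_eLpNorm (p := 2) (q := 2) (r := 1)
    (aesm g).restrict ((aesm f).restrict (s := Icc y (y + 1)))
  rw [eLpNorm_one_eq_lintegral_enorm] at h
  rw [ENNReal.ofReal_mul (norm_nonneg _), ← ulENorm_eq, ← ulENorm_eq]
  refine le_trans (le_of_eq ?_) (h.trans ?_)
  · rfl
  · gcongr
    · exact le_iSup (fun ξ : ℝ => eLpNorm f 2 (volume.restrict (Icc ξ (ξ + 1)))) y
    · exact le_iSup (fun ξ : ℝ => eLpNorm g 2 (volume.restrict (Icc ξ (ξ + 1)))) y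

theorem lintegral_wt_mul_mul_le {κ : ℝ} (hκ : 0 < κ) (ξ : ℝ) (f g : L2ul) :
    ∫⁻ x, ‖wt κ ξ x * (f x * g x)‖ₑ ≤ ENNReal.ofReal (wtC κ * (‖f‖ * ‖g‖)) := by
  have hm : Measurable fun x => ‖f x * g x‖ₑ :=
    (f.1.stronglyMeasurable.measurable.mul g.1.stronglyMeasurable.measurable).enorm
  have e : ∀ x, ‖wt κ ξ x * (f x * g x)‖ₑ = ENNReal.ofReal (wt κ ξ x) * ‖f x * g x‖ₑ :=
    fun x => by
    rw [enorm_mul (wt κ ξ x), Real.enorm_of_nonneg (wt_pos _ _ _).le]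
  simp_rw [e]
  refine (lintegral_wt_mul_le hκ ξ hm).trans ?_
  rw [ENNReal.ofReal_mul (wtC_nonneg κ)]
  gcongr
  exact iSup_le fun y => lintegral_Icc_mul_le f g y

theorem integrable_wt_mul {κ : ℝ} (hκ : 0 < κ) (ξ : ℝ) (f g : L2ul) :
    Integrable fun x => wt κ ξ x * (f x * g x) :=
  ⟨(continuous_wt κ ξ).aestronglyMeasurable.mul ((aesm f).mul (aesm g)),
    (lintegral_wt_mul_mul_le hκ ξ f g).trans_lt ENNReal.ofReal_lt_top⟩

theorem integral_abs_wt_mul_le {κ : ℝ} (hκ : 0 < κ) (ξ : ℝ) (f g : L2ul) :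
    ∫ x, |wt κ ξ x * (f x * g x)| ≤ wtC κ * (‖f‖ * ‖g‖) := by
  have h := lintegral_wt_mul_mul_le hκ ξ f g
  simp_rw [← Real.norm_eq_abs]
  rw [integral_norm_eq_lintegral_enorm (integrable_wt_mul hκ ξ f g).1]
  exact ENNReal.toReal_le_of_le_ofReal
    (mul_nonneg (wtC_nonneg κ) (mul_nonneg (norm_nonneg _) (norm_nonneg _))) h

theorem abs_integral_wt_mul_le {κ : ℝ} (hκ : 0 < κ) (ξ : ℝ) (f g : L2ul) :
    |∫ x, wt κ ξ x * (f x * g x)| ≤ wtC κ * (‖f‖ * ‖g‖) :=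
  (abs_integral_le_integral_abs).trans (integral_abs_wt_mul_le hκ ξ f g)

/-- The bilinear form `∫ e^{-κ|x-ξ|} f g` on `L²_ul`. -/
def J {κ : ℝ} (hκ : 0 < κ) (ξ : ℝ) : L2ul →L[ℝ] L2ul →L[ℝ] ℝ :=
  LinearMap.mkContinuous₂
    (LinearMap.mk₂ ℝ (fun f g : L2ul => ∫ x, wt κ ξ x * (f x * g x))
      (fun f₁ f₂ g => by
        rw [← integral_add (integrable_wt_mul hκ ξ f₁ g) (integrable_wt_mul hκ ξ f₂ g)]
        refine integral_congr_ae ?_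
        filter_upwards [coeFn_add f₁ f₂] with x hx
        rw [hx]
        ring)
      (fun c f g => by
        rw [smul_eq_mul, ← integral_const_mul]
        refine integral_congr_ae ?_
        filter_upwards [coeFn_smul c f] with x hx
        rw [hx]
        ring)
      (fun f g₁ g₂ => by
        rw [← integral_add (integrable_wt_mul hκ ξ f g₁) (integrable_wt_mul hκ ξ f g₂)]
        refine integral_congr_ae ?_
        filter_upwards [coeFn_add g₁ g₂] with x hx
        rw [hx]
        ring)
      (fun c f g => by
        rw [smul_eq_mul, ← integral_const_mul]
        refine integral_congr_ae ?_
        filter_upwards [coeFn_smul c g] with x hx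
        rw [hx]
        ring)) (wtC κ) (fun f g => by
    rw [Real.norm_eq_abs, mul_assoc]
    exact abs_integral_wt_mul_le hκ ξ f g)

theorem J_apply {κ : ℝ} (hκ : 0 < κ) (ξ : ℝ) (f g : L2ul) :
    J hκ ξ f g = ∫ x, wt κ ξ x * (f x * g x) := rfl

theorem abs_J_le {κ : ℝ} (hκ : 0 < κ) (ξ : ℝ) (f g : L2ul) :
    |J hκ ξ f g| ≤ wtC κ * (‖f‖ * ‖g‖) := abs_integral_wt_mul_le hκ ξ f g

theorem J_self_nonneg {κ : ℝ} (hκ : 0 < κ) (ξ : ℝ) (f : L2ul) : 0 ≤ J hκ ξ f f :=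
  integral_nonneg fun _ => mul_nonneg (wt_pos _ _ _).le (mul_self_nonneg _)

theorem J_comm {κ : ℝ} (hκ : 0 < κ) (ξ : ℝ) (f g : L2ul) : J hκ ξ f g = J hκ ξ g f := by
  rw [J_apply, J_apply]
  exact integral_congr_ae (.of_forall fun _ => by simp only [mul_comm (f _)])

theorem integrableOn_sq (f : L2ul) (y : ℝ) : IntegrableOn (fun x => f x * f x) (Icc y (y + 1)) :=
  ⟨((aesm f).mul (aesm f)).restrict, (lintegral_Icc_mul_le f f y).trans_lt ENNReal.ofReal_lt_top⟩

theorem norm_sq_le_of_integral {f : L2ul} {B : ℝ}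
    (h : ∀ y : ℝ, ∫ x in Icc y (y + 1), f x * f x ≤ B) : ‖f‖ ^ 2 ≤ B := by
  have hB : 0 ≤ B := (integral_nonneg fun x => mul_self_nonneg (f x)).trans (h 0)
  have h1 : ulENorm f ≤ ENNReal.ofReal (Real.sqrt B) := by
    refine iSup_le fun y => ?_
    have hmem : MemLp (f : ℝ → ℝ) 2 (volume.restrict (Icc y (y + 1))) :=
      ⟨(aesm f).restrict, (le_iSup (fun ξ : ℝ =>
        eLpNorm f 2 (volume.restrict (Icc ξ (ξ + 1)))) y).trans_lt f.2.1⟩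
    rw [hmem.eLpNorm_eq_integral_rpow_norm (by norm_num) (by norm_num)]
    refine ENNReal.ofReal_le_ofReal ?_
    rw [Real.sqrt_eq_rpow]
    have e : ∫ x in Icc y (y + 1), ‖f x‖ ^ (2 : ℝ≥0∞).toReal = ∫ x in Icc y (y + 1), f x * f x :=
      integral_congr_ae (.of_forall fun x => by
        simp only [ENNReal.toReal_ofNat, Real.rpow_ofNat, Real.norm_eq_abs, sq,
          abs_mul_abs_self])
    rw [e]
    simp only [ENNReal.toReal_ofNat, one_div]
    exact Real.rpow_le_rpow (integral_nonneg fun x => mul_self_nonneg (f x)) (h y) (by norm_num)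
  rw [ulENorm_eq, ENNReal.ofReal_le_ofReal_iff (Real.sqrt_nonneg _)] at h1
  calc ‖f‖ ^ 2 ≤ Real.sqrt B ^ 2 := by gcongr
    _ = B := Real.sq_sqrt hB

theorem integral_Icc_le_J {κ : ℝ} (hκ : 0 < κ) (f : L2ul) {y ξ r : ℝ}
    (hr : ∀ x ∈ Icc y (y + 1), |x - ξ| ≤ r) :
    ∫ x in Icc y (y + 1), f x * f x ≤ Real.exp (κ * r) * J hκ ξ f f := by
  rw [J_apply, ← integral_const_mul]
  refine (setIntegral_mono_on (integrableOn_sq f y)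
    (((integrable_wt_mul hκ ξ f f).const_mul _).integrableOn) measurableSet_Icc
    fun x hx => ?_).trans (setIntegral_le_integral ((integrable_wt_mul hκ ξ f f).const_mul _)
      (.of_forall fun _ => ?_))
  · rw [← mul_assoc]
    refine le_mul_of_one_le_left (mul_self_nonneg _) ?_
    rw [wt, ← Real.exp_add]
    refine Real.one_le_exp ?_
    nlinarith [hr x hx]
  · exact mul_nonneg (Real.exp_pos _).le (mul_nonneg (wt_pos _ _ _).le (mul_self_nonneg _))

/-- Centred at `y`, the weight is at least `e^{-κ}` on `[y, y+1]`; bounds uniform in the centre thus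
return to the norm of `L²_ul`. -/
theorem norm_sq_le_of_J {κ : ℝ} (hκ : 0 < κ) {f : L2ul} {B : ℝ} (h : ∀ ξ, J hκ ξ f f ≤ B) :
    ‖f‖ ^ 2 ≤ Real.exp κ * B := by
  refine norm_sq_le_of_integral fun y => ?_
  refine (integral_Icc_le_J hκ f (ξ := y) (r := 1) fun x hx => ?_).trans ?_
  · exact abs_le.2 ⟨by linarith [hx.1], by linarith [hx.2]⟩
  · rw [mul_one]
    exact mul_le_mul_of_nonneg_left (h y) (Real.exp_pos _).le

/-! ### Pairing with test functions -/

/-- On `[-A, A]` the weight times `e^A` is at least one, so `φ` is dominated by a multiple of the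
weight. Only the support radius and the size of `φ` enter, which gives uniform bounds for families
of test functions. -/
theorem abs_integral_mul_le (f : L2ul) {φ : ℝ → ℝ} {A M : ℝ}
    (hM : ∀ x, |φ x| ≤ M) (hA : ∀ x, A < |x| → φ x = 0) :
    |∫ x, f x * φ x| ≤ M * (Real.exp A * wtC 1 * ‖oneL2‖) * ‖f‖ := by
  have hM0 : 0 ≤ M := (abs_nonneg _).trans (hM 0)
  have hi := integrable_wt_mul one_pos 0 f oneL2
  have hb : ∀ᵐ x : ℝ, |f x * φ x| ≤ M * Real.exp A * |wt 1 0 x * (f x * oneL2 x)| := by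
    filter_upwards [coeFn_oneL2] with x hx
    rw [hx, mul_one, abs_mul, abs_mul, abs_of_pos (wt_pos _ _ _)]
    by_cases h : A < |x|
    · rw [hA x h]
      have := (wt_pos 1 0 x).le
      simp only [abs_zero, mul_zero]
      positivity
    · have h1 : 1 ≤ Real.exp A * wt 1 0 x := by
        rw [wt, ← Real.exp_add]
        exact Real.one_le_exp (by simp; linarith)
      calc |f x| * |φ x| ≤ |f x| * M * 1 := by rw [mul_one]; gcongr; exact hM x
        _ ≤ |f x| * M * (Real.exp A * wt 1 0 x) := by gcongr
        _ = _ := by ring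
  calc |∫ x, f x * φ x| ≤ ∫ x, |f x * φ x| := abs_integral_le_integral_abs
    _ ≤ ∫ x, M * Real.exp A * |wt 1 0 x * (f x * oneL2 x)| := by
        refine integral_mono_of_nonneg (.of_forall fun x => abs_nonneg _) (hi.abs.const_mul _) hb
    _ = M * Real.exp A * ∫ x, |wt 1 0 x * (f x * oneL2 x)| := integral_const_mul _ _
    _ ≤ M * Real.exp A * (wtC 1 * (‖f‖ * ‖oneL2‖)) := by
        gcongr
        exact integral_abs_wt_mul_le one_pos 0 f oneL2
    _ = _ := by ring

theorem _root_.HasCompactSupport.exists_abs_bound {φ : ℝ → ℝ} (hc : HasCompactSupport φ) :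
    ∃ A : ℝ, 0 ≤ A ∧ ∀ x, A < |x| → φ x = 0 := by
  obtain ⟨A, hA⟩ := hc.isBounded.subset_closedBall 0
  refine ⟨max A 0, le_max_right _ _, fun x hx => ?_⟩
  by_contra h
  have := hA (subset_tsupport φ h)
  rw [Metric.mem_closedBall, dist_zero_right, Real.norm_eq_abs] at this
  exact absurd (this.trans (le_max_left A 0)) (not_le.2 hx)

/-- Integration against a continuous compactly supported function, as a functional on `L²_ul`. -/
theorem exists_pairing {φ : ℝ → ℝ} (hφ : Continuous φ) (hc : HasCompactSupport φ) :
    ∃ Φ : L2ul →L[ℝ] ℝ, ∀ f : L2ul, Φ f = ∫ x, f x * φ x := by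
  obtain ⟨A, -, hA⟩ := hc.exists_abs_bound
  obtain ⟨M, hM⟩ := hc.exists_bound_of_continuous hφ
  refine ⟨LinearMap.mkContinuous
    { toFun := fun f : L2ul => ∫ x, f x * φ x
      map_add' := fun f g => by
        rw [← integral_add (integrable_L2ul_mul f hφ hc) (integrable_L2ul_mul g hφ hc)]
        refine integral_congr_ae ?_
        filter_upwards [coeFn_add f g] with x hx
        rw [hx]
        ring
      map_smul' := fun c f => by
        rw [RingHom.id_apply, smul_eq_mul, ← integral_const_mul]
        refine integral_congr_ae ?_
        filter_upwards [coeFn_smul c f] with x hx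
        rw [hx]
        ring } (M * (Real.exp A * wtC 1 * ‖oneL2‖))
    fun f => abs_integral_mul_le f hM hA, fun f => rfl⟩

theorem L2ul_ext_test {f g : L2ul} (h : ∀ φ, IsTest φ → ∫ x, f x * φ x = ∫ x, g x * φ x) :
    f = g := by
  refine L2ul_ext (ae_eq_of_integral_contDiff_smul_eq (locallyIntegrable_L2ul _)
    (locallyIntegrable_L2ul _) fun φ hφ hc => ?_)
  simpa only [smul_eq_mul, mul_comm] using h φ ⟨hφ, hc⟩

theorem integral_Tr_mul (ξ : ℝ) (f : L2ul) (φ : ℝ → ℝ) :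
    ∫ x, Tr ξ f x * φ x = ∫ x, f x * φ (x + ξ) := by
  rw [← integral_sub_right_eq_self (fun x => f x * φ (x + ξ)) ξ]
  refine integral_congr_ae ?_
  filter_upwards [coeFn_Tr ξ f] with x hx
  rw [hx, sub_add_cancel]

theorem IsTest.translate {φ : ℝ → ℝ} (h : IsTest φ) (ξ : ℝ) : IsTest fun x => φ (x + ξ) :=
  ⟨h.1.comp (contDiff_id.add contDiff_const), h.2.comp_homeomorph (Homeomorph.addRight ξ)⟩

theorem IsTest.deriv {φ : ℝ → ℝ} (h : IsTest φ) : IsTest (deriv φ) :=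
  ⟨(contDiff_infty_iff_deriv.1 h.1).2, h.2.deriv⟩

/-! ### Transport equations and characteristics -/

theorem abs_taylor_le {φ : ℝ → ℝ} (h1 : Differentiable ℝ φ) (h2 : Differentiable ℝ (deriv φ))
    {M : ℝ} (hM : ∀ x, |deriv (deriv φ) x| ≤ M) (x y : ℝ) :
    |φ y - φ x - (y - x) * deriv φ x| ≤ M * |y - x| ^ 2 := by
  have hL : ∀ z, |deriv φ z - deriv φ x| ≤ M * |z - x| := fun z =>
    convex_univ.norm_image_sub_le_of_norm_deriv_le (𝕜 := ℝ) (f := deriv φ)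
      (fun z _ => h2 z) (fun z _ => hM z) (mem_univ x) (mem_univ z)
  have hM0 : 0 ≤ M := (abs_nonneg _).trans (hM 0)
  have hd : ∀ z, HasDerivAt (fun z => φ z - deriv φ x * z) (deriv φ z - deriv φ x) z := fun z => 
    ((h1 z).hasDerivAt.sub ((hasDerivAt_id z).const_mul (deriv φ x))).congr_deriv (by simp)
  have := (convex_uIcc x y).norm_image_sub_le_of_norm_hasDerivWithin_le
    (f := fun z => φ z - deriv φ x * z) (C := M * |y - x|)
    (fun z _ => (hd z).hasDerivWithinAt) (fun z hz => (hL z).trans ?_) left_mem_uIcc right_mem_uIcc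
  · rw [Real.norm_eq_abs, Real.norm_eq_abs] at this
    calc |φ y - φ x - (y - x) * deriv φ x|
        = |φ y - deriv φ x * y - (φ x - deriv φ x * x)| := by congr 1; ring
      _ ≤ _ := this
      _ = _ := by ring
  · exact mul_le_mul_of_nonneg_left (abs_sub_left_of_mem_uIcc hz) hM0

/-- Differentiation of the pairing of a curve in `L²_ul` with a uniformly moving test function. -/
theorem hasDerivWithinAt_moving {S : Set ℝ} {w : ℝ → L2ul} {s lam d : ℝ} {φ : ℝ → ℝ}
    (hφ : IsTest φ) (hw : ContinuousWithinAt w S s)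
    (hd : HasDerivWithinAt (fun r => ∫ x, w r x * φ (x + lam * s)) d S s) :
    HasDerivWithinAt (fun r => ∫ x, w r x * φ (x + lam * r))
      (d + lam * ∫ x, w s x * deriv φ (x + lam * s)) S s := by
  obtain ⟨A, hA0, hA⟩ := hφ.2.exists_abs_bound
  have hA' : ∀ x, A < |x| → deriv φ x = 0 := fun x hx => by
    have : φ =ᶠ[𝓝 x] fun _ => 0 := by
      filter_upwards [(isOpen_lt continuous_const continuous_abs).mem_nhds hx] with y hy
      exact hA y hy
    rw [this.deriv_eq, deriv_const]
  obtain ⟨M1, hM1⟩ := hφ.deriv.2.exists_bound_of_continuous hφ.deriv.1.continuous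
  obtain ⟨M2, hM2⟩ := hφ.deriv.deriv.2.exists_bound_of_continuous hφ.deriv.deriv.1.continuous
  have hM1' := (norm_nonneg _).trans (hM1 0)
  have hM2' := (norm_nonneg _).trans (hM2 0)
  -- Outside `[-B, B]` every shifted function `φ(· + λ r)` with `|r - s| ≤ 1` vanishes, so one
  -- constant serves for all of them.
  set B : ℝ := A + |lam * s| + |lam| with hB
  set C : ℝ := Real.exp B * wtC 1 * ‖oneL2‖ with hC
  have hC0 : 0 ≤ C := by have := wtC_nonneg 1; positivity
  have hint : ∀ (f : L2ul) (r : ℝ), Integrable fun x => f x * φ (x + lam * r) := fun f r =>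
    integrable_L2ul_mul f (hφ.translate _).1.continuous (hφ.translate _).2
  have hint' : ∀ (f : L2ul) (r : ℝ), Integrable fun x => f x * deriv φ (x + lam * r) := fun f r =>
    integrable_L2ul_mul f (hφ.deriv.translate _).1.continuous (hφ.deriv.translate _).2
  -- Only the shift of the test function is differentiated here; `hd` covers the curve paired with
  -- the frozen test function. Continuity of `w` is enough, because `w r - w s` meets a factor of
  -- order `r - s`, while `w r` meets a second order Taylor remainder.
  have main : HasDerivWithinAt
      (fun r => (∫ x, w r x * φ (x + lam * r)) - ∫ x, w r x * φ (x + lam * s))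
      (lam * ∫ x, w s x * deriv φ (x + lam * s)) S s := by
    rw [hasDerivWithinAt_iff_isLittleO, Asymptotics.isLittleO_iff]
    intro ε hε
    have hη : Tendsto (fun r => M2 * lam ^ 2 * C * |r - s| * ‖w r‖
        + |lam| * M1 * C * ‖w r - w s‖) (𝓝[S] s) (𝓝 0) := by
      have t1 : Tendsto (fun r : ℝ => |r - s|) (𝓝[S] s) (𝓝 0) := by
        have : Continuous fun r : ℝ => |r - s| := by fun_prop
        simpa using (this.tendsto s).mono_left nhdsWithin_le_nhds
      have t2 := hw.tendsto.norm
      have t3 := tendsto_iff_norm_sub_tendsto_zero.1 hw.tendsto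
      simpa using ((t1.const_mul (M2 * lam ^ 2 * C)).mul t2).add
        (t3.const_mul (|lam| * M1 * C))
    filter_upwards [hη.eventually_lt_const hε,
      nhdsWithin_le_nhds (Metric.ball_mem_nhds s one_pos)] with r hr hrs
    rw [Metric.mem_ball, Real.dist_eq] at hrs
    have e0 : (∫ x, w r x * φ (x + lam * r)) - (∫ x, w r x * φ (x + lam * s))
        - ((∫ x, w s x * φ (x + lam * s)) - ∫ x, w s x * φ (x + lam * s))
        - (r - s) • (lam * ∫ x, w s x * deriv φ (x + lam * s))
        = (∫ x, w r x * (φ (x + lam * r) - φ (x + lam * s)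
              - (lam * (r - s)) * deriv φ (x + lam * s)))
          + (lam * (r - s)) * ∫ x, (w r - w s) x * deriv φ (x + lam * s) := by
      have e1 : ∫ x, w r x * (φ (x + lam * r) - φ (x + lam * s)
            - (lam * (r - s)) * deriv φ (x + lam * s))
          = (∫ x, w r x * φ (x + lam * r)) - (∫ x, w r x * φ (x + lam * s))
            - (lam * (r - s)) * ∫ x, w r x * deriv φ (x + lam * s) := by
        rw [← integral_const_mul, ← integral_sub (hint _ _) (hint _ _),
          ← integral_sub (by exact (hint _ _).sub (hint _ _)) ((hint' _ _).const_mul _)]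
        exact integral_congr_ae (.of_forall fun x => by ring)
      have e2 : ∫ x, (w r - w s) x * deriv φ (x + lam * s)
          = (∫ x, w r x * deriv φ (x + lam * s)) - ∫ x, w s x * deriv φ (x + lam * s) := by
        rw [← integral_sub (hint' _ _) (hint' _ _)]
        refine integral_congr_ae ?_
        filter_upwards [coeFn_sub (w r) (w s)] with x hx
        rw [hx]
        ring
      rw [e1, e2, smul_eq_mul]
      ring
    rw [e0]
    have hlr : |lam * r| ≤ |lam * s| + |lam| := by
      have : lam * r = lam * s + lam * (r - s) := by ring
      rw [this]
      refine (abs_add_le _ _).trans ?_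
      rw [abs_mul lam (r - s)]
      gcongr
      exact mul_le_of_le_one_right (abs_nonneg _) hrs.le
    have far : ∀ x, B < |x| → ∀ a : ℝ, |a| ≤ |lam * s| + |lam| → A < |x + a| := fun x hx a ha => by
      have h1 : |x| ≤ |x + a| + |a| := by
        have := abs_sub (x + a) a
        simpa using this
      linarith
    have b1 := abs_integral_mul_le (w r) (A := B) (M := M2 * lam ^ 2 * |r - s| ^ 2)
      (φ := fun x => φ (x + lam * r) - φ (x + lam * s)
              - (lam * (r - s)) * deriv φ (x + lam * s)) (fun x => by
        have := abs_taylor_le (hφ.1.differentiable (by simp)) (hφ.deriv.1.differentiable (by simp))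
          hM2 (x + lam * s) (x + lam * r)
        have e3 : x + lam * r - (x + lam * s) = lam * (r - s) := by ring
        rw [e3] at this
        refine this.trans (le_of_eq ?_)
        rw [abs_mul, mul_pow, sq_abs]
        ring) (fun x hx => by
        have f1 := far x hx (lam * s) (by linarith [abs_nonneg lam])
        rw [hA _ (far x hx _ hlr), hA _ f1, hA' _ f1]
        ring)
    have b2 := abs_integral_mul_le (w r - w s) (A := B) (M := M1)
      (φ := fun x => deriv φ (x + lam * s)) (fun x => hM1 _)
      (fun x hx => hA' _ (far x hx (lam * s) (by linarith [abs_nonneg lam])))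
    rw [Real.norm_eq_abs, Real.norm_eq_abs]
    calc _ ≤ M2 * lam ^ 2 * |r - s| ^ 2 * C * ‖w r‖
          + |lam * (r - s)| * (M1 * C * ‖w r - w s‖) := by
          refine (abs_add_le _ _).trans (add_le_add b1 ?_)
          rw [abs_mul]
          gcongr
      _ = (M2 * lam ^ 2 * C * |r - s| * ‖w r‖ + |lam| * M1 * C * ‖w r - w s‖) * |r - s| := by
          rw [abs_mul]
          ring
      _ ≤ ε * |r - s| := by gcongr
  have h2 := hd.add main
  refine h2.congr_deriv rfl |>.congr (fun r _ => ?_) ?_ <;> simp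

theorem mem_nhdsGE_of_mem_Ico {a b x : ℝ} (hx : x ∈ Ico a b) : Icc a b ∈ 𝓝[≥] x :=
  Icc_mem_nhdsGE_of_mem hx

/-- A continuous curve in `L²_ul` whose weak derivative is a continuous curve in `L²_ul` is
differentiable in norm. -/
theorem hasDerivWithinAt_of_weak {T : ℝ} {W H : ℝ → L2ul}
    (hH : ContinuousOn H (Icc 0 T))
    (h : ∀ φ, IsTest φ → ∀ t ∈ Icc 0 T,
      HasDerivWithinAt (fun r => ∫ x, W r x * φ x) (∫ x, H t x * φ x) (Icc 0 T) t) :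
    ∀ t ∈ Icc 0 T, HasDerivWithinAt W (H t) (Icc 0 T) t := by
  intro t ht
  have hT : (0 : ℝ) ≤ T := ht.1.trans ht.2
  -- The extension is constant beyond the endpoints, so the fundamental theorem of calculus applies
  -- at every real time.
  set H' : ℝ → L2ul := IccExtend hT (fun z : Icc 0 T => H z) with hH'
  have hc : Continuous H' := (continuousOn_iff_continuous_domRestrict.1 hH).Icc_extend'
  have hHH : ∀ r ∈ Icc 0 T, H' r = H r := fun r hr => by
    rw [hH', IccExtend_of_mem hT _ hr]
  set V : ℝ → L2ul := fun r => W 0 + ∫ s in (0 : ℝ)..r, H' s with hV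
  have hVd : ∀ r, HasDerivAt V (H' r) r := fun r =>
    (hc.integral_hasStrictDerivAt 0 r).hasDerivAt.const_add _
  -- Each pairing of `W - V` with a test function has zero derivative and starts at zero, and test
  -- functions separate points.
  have hEq : ∀ r ∈ Icc 0 T, W r = V r := fun r hr => by
    refine L2ul_ext_test fun φ hφ => ?_
    obtain ⟨Φ, hΦ⟩ := exists_pairing hφ.1.continuous hφ.2
    have hd : ∀ s ∈ Icc 0 T, HasDerivWithinAt
        (fun s => (∫ x, W s x * φ x) - ∫ x, V s x * φ x) 0 (Icc 0 T) s := fun s hs => by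
      have h1 := h φ hφ s hs
      have h2 : HasDerivWithinAt (fun s => ∫ x, V s x * φ x) (∫ x, H s x * φ x) (Icc 0 T) s := by
        have := (Φ.hasFDerivAt.comp_hasDerivAt s (hVd s)).hasDerivWithinAt (s := Icc 0 T)
        rw [hHH s hs, hΦ] at this
        exact this.congr (fun x _ => (hΦ _).symm) (hΦ _).symm
      exact (h1.sub h2).congr_deriv (sub_self _)
    have h0 := constant_of_has_deriv_right_zero (fun s hs => (hd s hs).continuousWithinAt)
      (fun s hs => (hd s (Ico_subset_Icc_self hs)).mono_of_mem_nhdsWithin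
        (mem_nhdsGE_of_mem_Ico hs)) r hr
    have e : V 0 = W 0 := by simp [hV]
    simp only [e, sub_self] at h0
    exact sub_eq_zero.1 h0
  have := (hVd t).hasDerivWithinAt (s := Icc 0 T)
  rw [hHH t ht] at this
  exact this.congr hEq (hEq t ht)

/-- `∂_t w = λ ∂_x w + h` on `[0,T]`, tested against functions of `x`. -/
def WeakTransport (lam T : ℝ) (w h : ℝ → L2ul) : Prop :=
  ∀ φ, IsTest φ → ∀ t ∈ Icc 0 T, HasDerivWithinAt (fun r => ∫ x, w r x * φ x)
    (-lam * (∫ x, w t x * deriv φ x) + ∫ x, h t x * φ x) (Icc 0 T) t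

/-- `∂_t w = λ ∂_x w + h` on `[0,T]`, in the norm of `L²_ul` along characteristics. -/
def CharTransport (lam T : ℝ) (w h : ℝ → L2ul) : Prop :=
  ∀ t ∈ Icc 0 T, HasDerivWithinAt (fun r => Tr (lam * r) (w r)) (Tr (lam * t) (h t)) (Icc 0 T) t

/-- Moving the translation onto the test function produces the term `λ ∫ w φ'`, which cancels the
transport term. The translated curve then has the continuous weak derivative `T_{λt} h`, and such a
weak derivative is a derivative in norm. -/
theorem WeakTransport.charTransport {lam T : ℝ} {w h : ℝ → L2ul} (hwh : WeakTransport lam T w h)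
    (hw : ContinuousOn w (Icc 0 T)) (hh : ContinuousOn h (Icc 0 T)) : CharTransport lam T w h := by
  have hl : Continuous fun r : ℝ => lam * r := by fun_prop
  refine hasDerivWithinAt_of_weak (fun s hs => hl.continuousWithinAt.Tr (hh s hs)) fun φ hφ t ht => ?_
  simp only [integral_Tr_mul]
  have h1 := hwh _ (hφ.translate (lam * t)) t ht
  have h2 := hasDerivWithinAt_moving hφ (hw t ht) h1
  refine h2.congr_deriv ?_
  simp only [deriv_comp_add_const]
  ring

theorem CharTransport.continuousOn {lam T : ℝ} {w h : ℝ → L2ul} (hwh : CharTransport lam T w h) :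
    ContinuousOn w (Icc 0 T) := fun s hs => by
  have hl : Continuous fun r : ℝ => -(lam * r) := by fun_prop
  simpa using hl.continuousWithinAt.Tr (hwh s hs).continuousWithinAt

/-- The same computation backwards: `T_{λr} w` is paired with a test function moving at speed `-λ`,
which undoes the translation. -/
theorem CharTransport.weakTransport {lam T : ℝ} {w h : ℝ → L2ul} (hwh : CharTransport lam T w h) :
    WeakTransport lam T w h := fun φ hφ t ht => by
  obtain ⟨Φ, hΦ⟩ := exists_pairing (hφ.translate (-lam * t)).1.continuous
    (hφ.translate (-lam * t)).2
  have h1 := Φ.hasFDerivAt.comp_hasDerivWithinAt t (hwh t ht)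
  have h2 : HasDerivWithinAt (fun r => ∫ x, Tr (lam * r) (w r) x * φ (x + -lam * t))
      (∫ x, h t x * φ x) (Icc 0 T) t := by
    refine (h1.congr (fun r _ => (hΦ _).symm) (hΦ _).symm).congr_deriv ?_
    rw [hΦ, integral_Tr_mul]
    simp
  have h3 := hasDerivWithinAt_moving hφ (hwh t ht).continuousWithinAt h2
  simp only [integral_Tr_mul] at h3
  refine (h3.congr (fun r _ => ?_) ?_).congr_deriv ?_
  · simp
  · simp
  · simp only [neg_mul, add_neg_cancel_right]
    ring

/-! ### The continuous representative of an element of `H¹_ul` -/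

theorem IsTest.deriv_eq_zero {φ : ℝ → ℝ} {A : ℝ} (hA : ∀ x, A < |x| → φ x = 0) (x : ℝ)
    (hx : A < |x|) : _root_.deriv φ x = 0 := by
  have : φ =ᶠ[𝓝 x] fun _ => 0 := by
    filter_upwards [(isOpen_lt continuous_const continuous_abs).mem_nhds hx] with y hy
    exact hA y hy
  rw [this.deriv_eq, deriv_const]

theorem support_subset_Ioc {φ : ℝ → ℝ} {A : ℝ} (hA : ∀ x, A < |x| → φ x = 0) :
    Function.support φ ⊆ Ioc (-(A + 1)) (A + 1) := fun x hx => by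
  have h1 : |x| ≤ A := not_lt.1 fun h => hx (hA x h)
  have := abs_le.1 h1
  exact ⟨by linarith, by linarith⟩

/-- Integration by parts for a primitive of a locally integrable function. -/
theorem hasWeakDeriv_integral {g : ℝ → ℝ} (hg : LocallyIntegrable g volume) :
    HasWeakDeriv (fun x => ∫ t in (0 : ℝ)..x, g t) g := by
  intro φ hφ
  obtain ⟨A, hA0, hA⟩ := hφ.2.exists_abs_bound
  have hi : ∀ a b, IntervalIntegrable g volume a b := fun a b =>
    (hg.integrableOn_isCompact isCompact_uIcc).intervalIntegrable
  set B := A + 1 with hB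
  have hac : AbsolutelyContinuousOnInterval (fun x => ∫ t in (0 : ℝ)..x, g t) (-B) B :=
    (hi (-B) B).absolutelyContinuousOnInterval_intervalIntegral
      (by rw [uIcc_of_le (by linarith)]; constructor <;> linarith)
  have hφac : AbsolutelyContinuousOnInterval φ (-B) B :=
    ContDiffOn.absolutelyContinuousOnInterval (hφ.1.of_le (by simp)).contDiffOn
  have h := hac.integral_mul_deriv_eq_deriv_mul hφac
  have hz : φ B = 0 ∧ φ (-B) = 0 :=
    ⟨hA _ (by rw [abs_of_pos (by linarith)]; linarith),
      hA _ (by rw [abs_neg, abs_of_pos (by linarith)]; linarith)⟩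
  rw [hz.1, hz.2, mul_zero, mul_zero, sub_zero, zero_sub] at h
  rw [intervalIntegral.integral_eq_integral_of_support_subset
    ((Function.support_mul_subset_right _ _).trans
      (support_subset_Ioc fun x hx => IsTest.deriv_eq_zero hA x hx))] at h
  rw [h]
  congr 1
  rw [← intervalIntegral.integral_eq_integral_of_support_subset
    ((Function.support_mul_subset_right g φ).trans (support_subset_Ioc hA))]
  refine intervalIntegral.integral_congr_ae ?_
  filter_upwards [_root_.LocallyIntegrable.ae_hasDerivAt_integral hg] with x hx _
  rw [(hx 0).deriv]

/-- A locally integrable function with vanishing weak derivative is constant. -/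
theorem ae_const_of_hasWeakDeriv_zero {h : ℝ → ℝ} (hh : LocallyIntegrable h volume)
    (h0 : HasWeakDeriv h fun _ => 0) : ∃ c : ℝ, h =ᵐ[volume] fun _ => c := by
  let b : ContDiffBump (0 : ℝ) := ⟨1, 2, one_pos, by norm_num⟩
  set θ : ℝ → ℝ := b.normed volume with hθ
  have hθt : IsTest θ := ⟨b.contDiff_normed (n := ⊤), b.hasCompactSupport_normed⟩
  have hθ1 : ∫ x, θ x = 1 := b.integral_normed
  have hint : ∀ ψ, IsTest ψ → Integrable fun x => h x * ψ x := fun ψ hψ => by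
    simpa [mul_comm] using hh.integrable_smul_left_of_hasCompactSupport hψ.1.continuous hψ.2
  have hint0 : ∀ ψ, IsTest ψ → Integrable ψ := fun ψ hψ =>
    hψ.1.continuous.integrable_of_hasCompactSupport hψ.2
  refine ⟨∫ x, h x * θ x, ae_eq_of_integral_contDiff_smul_eq hh (locallyIntegrable_const _)
    fun ψ hψ hψc => ?_⟩
  have hψt : IsTest ψ := ⟨hψ, hψc⟩
  obtain ⟨A, hA0, hA⟩ := hψc.exists_abs_bound
  obtain ⟨A', hA0', hA'⟩ := hθt.2.exists_abs_bound
  -- Subtracting the multiple of the unit-mass bump `θ` makes the integral vanish, so the primitive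
  -- of `η` is itself compactly supported and may serve as a test function.
  set η : ℝ → ℝ := fun x => ψ x - (∫ y, ψ y) * θ x with hη
  have hηs : ContDiff ℝ ∞ η := hψ.sub (contDiff_const.mul hθt.1)
  set B := max A A' + 1 with hB
  have hηz : ∀ x, max A A' < |x| → η x = 0 := fun x hx => by
    simp only [hη, hA x ((le_max_left _ _).trans_lt hx), hA' x ((le_max_right _ _).trans_lt hx)]
    ring
  have hηint : ∫ x, η x = 0 := by
    rw [hη, integral_sub (hint0 _ hψt) ((hint0 _ hθt).const_mul _), integral_const_mul, hθ1]
    ring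
  set φ : ℝ → ℝ := fun x => ∫ t in (-B)..x, η t with hφ
  have hφd : ∀ x, HasDerivAt φ (η x) x := fun x =>
    (hηs.continuous.integral_hasStrictDerivAt _ _).hasDerivAt
  have hderiv : deriv φ = η := funext fun x => (hφd x).deriv
  have hφt : IsTest φ := by
    refine ⟨contDiff_infty_iff_deriv.2 ⟨fun x => (hφd x).differentiableAt, by rwa [hderiv]⟩, ?_⟩
    refine HasCompactSupport.of_support_subset_isCompact (isCompact_Icc (a := -B) (b := B)) ?_
    intro x hx
    by_contra hx'
    apply hx
    rw [mem_Icc, not_and_or, not_le, not_le] at hx'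
    rcases hx' with hx' | hx'
    · have : ∫ t in (-B)..x, η t = ∫ t in (-B)..x, (0 : ℝ) :=
        intervalIntegral.integral_congr fun t ht => by
          rw [uIcc_of_ge hx'.le] at ht
          refine hηz t ?_
          have := neg_le_abs t
          linarith [ht.2]
      simp [hφ, this]
    · rw [hφ]
      show ∫ t in (-B)..x, η t = 0
      rw [intervalIntegral.integral_eq_integral_of_support_subset, hηint]
      exact (support_subset_Ioc hηz).trans (Ioc_subset_Ioc_right hx'.le)
  have key := h0 φ hφt
  rw [hderiv] at key
  simp only [zero_mul, integral_zero, neg_zero] at key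
  have e : ∫ x, h x * η x = (∫ x, h x * ψ x) - (∫ y, ψ y) * ∫ x, h x * θ x := by
    rw [← integral_const_mul, ← integral_sub (hint _ hψt) ((hint _ hθt).const_mul _)]
    exact integral_congr_ae (.of_forall fun x => by simp only [hη]; ring)
  simp only [smul_eq_mul]
  rw [integral_mul_const]
  simp only [mul_comm (ψ _)]
  linarith [e.symm.trans key]

/-- The difference between `u` and a primitive of its weak derivative has zero weak derivative,
hence is constant. -/
theorem exists_continuous_rep (u : H1ul) : ∃ U : ℝ → ℝ, Continuous U ∧
    (toL2 u : ℝ → ℝ) =ᵐ[volume] U ∧ ∀ x y, U y - U x = ∫ t in x..y, dx u t := by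
  have hg := locallyIntegrable_L2ul (dx u)
  have hi : ∀ a b, IntervalIntegrable (dx u : ℝ → ℝ) volume a b := fun a b =>
    (hg.integrableOn_isCompact isCompact_uIcc).intervalIntegrable
  set G : ℝ → ℝ := fun x => ∫ t in (0 : ℝ)..x, dx u t with hG
  have hGc : Continuous G := intervalIntegral.continuous_primitive hi 0
  have hw : HasWeakDeriv (fun x => toL2 u x - G x) fun _ => 0 := by
    intro φ hφ
    have h1 := u.2 φ hφ
    have h2 := hasWeakDeriv_integral hg φ hφ
    have i1 := integrable_L2ul_mul (toL2 u) hφ.continuous_deriv hφ.2.deriv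
    have i2 : Integrable fun x => G x * deriv φ x :=
      (hGc.mul hφ.continuous_deriv).integrable_of_hasCompactSupport hφ.2.deriv.mul_left
    simp only [sub_mul, zero_mul, integral_zero, neg_zero]
    rw [integral_sub i1 i2]
    exact sub_eq_zero.2 (h1.trans h2.symm)
  obtain ⟨c, hc⟩ := ae_const_of_hasWeakDeriv_zero
    ((locallyIntegrable_L2ul (toL2 u)).sub hGc.locallyIntegrable) hw
  refine ⟨fun x => c + G x, continuous_const.add hGc, ?_, fun x y => ?_⟩
  · filter_upwards [hc] with x hx
    have : toL2 u x - G x = c := hx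
    linarith
  · simp only [hG]
    rw [add_sub_add_left_eq_sub, intervalIntegral.integral_interval_sub_left (hi _ _) (hi _ _)]

/-- The local Sobolev inequality. -/
theorem rep_sq_le {u : H1ul} {U : ℝ → ℝ} (hU : Continuous U)
    (hae : (toL2 u : ℝ → ℝ) =ᵐ[volume] U) (hd : ∀ x y, U y - U x = ∫ t in x..y, dx u t) (x : ℝ) :
    U x ^ 2 ≤ 2 * (∫ t in Icc x (x + 1), toL2 u t * toL2 u t)
      + 2 * ∫ t in Icc x (x + 1), dx u t * dx u t := by
  set μ := volume.restrict (Icc x (x + 1)) with hμ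
  have hprob : μ.real univ = 1 := by simp [hμ]
  have hfin : IsFiniteMeasure μ := ⟨by simp [hμ]⟩
  have ig : Integrable (fun t => |dx u t|) μ :=
    ((locallyIntegrable_L2ul (dx u)).integrableOn_isCompact isCompact_Icc).abs
  have ig2 : Integrable (fun t => dx u t * dx u t) μ := integrableOn_sq (dx u) x
  set m := ∫ t, |dx u t| ∂μ with hm
  -- Cauchy–Schwarz on a probability space, in the form that a variance is nonnegative.
  have hm2 : m ^ 2 ≤ ∫ t, dx u t * dx u t ∂μ := by
    have h1 : 0 ≤ ∫ t, (|dx u t| - m) ^ 2 ∂μ := integral_nonneg fun _ => sq_nonneg _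
    have h2 : ∫ t, (|dx u t| - m) ^ 2 ∂μ = (∫ t, dx u t * dx u t ∂μ) - 2 * m * m + m ^ 2 := by
      have : ∀ t, (|dx u t| - m) ^ 2 = (dx u t * dx u t - 2 * m * |dx u t|) + m ^ 2 := fun t => by
        rw [sub_sq, sq_abs]
        ring
      simp_rw [this]
      rw [integral_add (by exact ig2.sub (ig.const_mul _)) (integrable_const _),
        integral_sub ig2 (ig.const_mul _), integral_const_mul, integral_const, hprob]
      simp [hm]
    nlinarith
  -- Integrating this over `y` in the unit interval replaces the value at `y` by the local `L²`
  -- norm.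
  have hb : ∀ y ∈ Icc x (x + 1), U x ^ 2 ≤ 2 * (U y * U y) + 2 * m ^ 2 := fun y hy => by
    have h1 : |U y - U x| ≤ m := by
      rw [hd, intervalIntegral.integral_of_le hy.1]
      refine abs_integral_le_integral_abs.trans ?_
      refine setIntegral_mono_set ig (.of_forall fun _ => abs_nonneg _)
        (Eventually.of_forall fun t ht => ?_)
      exact ⟨ht.1.le, ht.2.trans hy.2⟩
    have h2 := sq_le_sq' (abs_le.1 h1).1 (abs_le.1 h1).2
    nlinarith [sq_nonneg (U y + (U y - U x))]
  have hint : ∫ _ in Icc x (x + 1), U x ^ 2 ≤ ∫ t in Icc x (x + 1), (2 * (U t * U t) + 2 * m ^ 2) :=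
    setIntegral_mono_on (integrable_const _)
      ((Continuous.integrableOn_Icc (by fun_prop))) measurableSet_Icc hb
  have e1 : ∫ _ in Icc x (x + 1), U x ^ 2 = U x ^ 2 := by
    rw [integral_const]
    simp
  have e2 : ∫ t in Icc x (x + 1), (2 * (U t * U t) + 2 * m ^ 2)
      = 2 * (∫ t in Icc x (x + 1), toL2 u t * toL2 u t) + 2 * m ^ 2 := by
    rw [integral_add (Continuous.integrableOn_Icc (by fun_prop)) (integrable_const _),
      integral_const_mul, integral_const]
    congr 1
    · congr 1
      refine integral_congr_ae (ae_restrict_of_ae ?_)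
      filter_upwards [hae] with t ht
      rw [ht]
    · simp
  rw [e1, e2] at hint
  linarith

theorem integral_Icc_le_norm_sq (f : L2ul) (y : ℝ) :
    ∫ x in Icc y (y + 1), f x * f x ≤ ‖f‖ ^ 2 := by
  have h := lintegral_Icc_mul_le f f y
  have h1 : ∫ x in Icc y (y + 1), f x * f x ≤ ∫ x in Icc y (y + 1), ‖f x * f x‖ :=
    integral_mono_of_nonneg (.of_forall fun x => mul_self_nonneg _) (integrableOn_sq f y).norm
      (.of_forall fun x => le_abs_self _)
  refine h1.trans ?_
  rw [integral_norm_eq_lintegral_enorm (integrableOn_sq f y).1, sq]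
  exact ENNReal.toReal_le_of_le_ofReal (mul_self_nonneg _) h

/-- The Sobolev embedding `H¹_ul ⊂ L^∞`. -/
theorem ae_sq_le_norm_sq (u : H1ul) : ∀ᵐ x : ℝ, (toL2 u x) ^ 2 ≤ 2 * ‖u‖ ^ 2 := by
  obtain ⟨U, hU, hae, hd⟩ := exists_continuous_rep u
  filter_upwards [hae] with x hx
  rw [hx, norm_sq_H1ul]
  have := rep_sq_le hU hae hd x
  have h1 := integral_Icc_le_norm_sq (toL2 u) x
  have h2 := integral_Icc_le_norm_sq (dx u) x
  linarith

/-! ### Globally Lipschitz ordinary differential equations -/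

section ODE

variable {E : Type*} [NormedAddCommGroup E] [NormedSpace ℝ E]

theorem exists_hasDerivWithinAt_concat {v : ℝ → E → E} {a b c : ℝ} (hab : a ≤ b) (hbc : b ≤ c)
    {y z : ℝ → E} (hyz : y b = z b)
    (hy : ∀ t ∈ Icc a b, HasDerivWithinAt y (v t (y t)) (Icc a b) t)
    (hz : ∀ t ∈ Icc b c, HasDerivWithinAt z (v t (z t)) (Icc b c) t) :
    ∃ w : ℝ → E, w a = y a ∧ ∀ t ∈ Icc a c, HasDerivWithinAt w (v t (w t)) (Icc a c) t := by
  set w : ℝ → E := fun t => if t ≤ b then y t else z t with hw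
  have w1 : ∀ t ∈ Icc a b, w t = y t := fun t ht => if_pos ht.2
  have w2 : ∀ t ∈ Icc b c, w t = z t := fun t ht => by
    rcases ht.1.eq_or_lt with h | h
    · rw [← h, ← hyz]
      exact if_pos le_rfl
    · exact if_neg (not_le.2 h)
  have d1 : ∀ t ∈ Icc a b, HasDerivWithinAt w (v t (w t)) (Icc a b) t := fun t ht => by
    rw [w1 t ht]
    exact (hy t ht).congr w1 (w1 t ht)
  have d2 : ∀ t ∈ Icc b c, HasDerivWithinAt w (v t (w t)) (Icc b c) t := fun t ht => by
    rw [w2 t ht]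
    exact (hz t ht).congr w2 (w2 t ht)
  refine ⟨w, w1 a ⟨le_rfl, hab⟩, fun t ht => ?_⟩
  rw [← Icc_union_Icc_eq_Icc hab hbc]
  -- At a point outside the closed interval every vector is a derivative within it, so the union
  -- rule needs no case distinction at the junction.
  have out : ∀ {l r : ℝ}, t ∉ Icc l r → HasDerivWithinAt w (v t (w t)) (Icc l r) t :=
    fun h => hasDerivWithinAt_iff_hasFDerivWithinAt.2
      (.of_notMem_closure (by rwa [isClosed_Icc.closure_eq]))
  refine HasDerivWithinAt.union ?_ ?_
  · by_cases h : t ∈ Icc a b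
    · exact d1 t h
    · exact out h
  · by_cases h : t ∈ Icc b c
    · exact d2 t h
    · exact out h

theorem dist_le_of_hasDerivWithinAt {v : ℝ → E → E} {K : ℝ≥0}
    (hK : ∀ t, LipschitzWith K (v t)) {T : ℝ} {y z : ℝ → E}
    (hy : ∀ t ∈ Icc 0 T, HasDerivWithinAt y (v t (y t)) (Icc 0 T) t)
    (hz : ∀ t ∈ Icc 0 T, HasDerivWithinAt z (v t (z t)) (Icc 0 T) t) :
    ∀ t ∈ Icc 0 T, dist (y t) (z t) ≤ dist (y 0) (z 0) * Real.exp (K * t) := fun t ht => by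
  have := dist_le_of_trajectories_ODE hK (fun t ht => (hy t ht).continuousWithinAt)
    (fun t ht => (hy t (Ico_subset_Icc_self ht)).mono_of_mem_nhdsWithin
      (mem_nhdsGE_of_mem_Ico ht)) (fun t ht => (hz t ht).continuousWithinAt)
    (fun t ht => (hz t (Ico_subset_Icc_self ht)).mono_of_mem_nhdsWithin
      (mem_nhdsGE_of_mem_Ico ht)) le_rfl t ht
  simpa using this

variable [CompleteSpace E]

theorem exists_hasDerivWithinAt_short {v : ℝ → E → E} {K : ℝ≥0} (hK : ∀ t, LipschitzWith K (v t))
    (hc : ∀ x, Continuous fun t => v t x) (s : ℝ) {τ : ℝ} (hτ : 0 ≤ τ) (hKτ : K * τ ≤ 1 / 2)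
    (x : E) :
    ∃ y : ℝ → E, y s = x ∧ ∀ t ∈ Icc s (s + τ),
      HasDerivWithinAt y (v t (y t)) (Icc s (s + τ)) t := by
  obtain ⟨M, hM⟩ := isCompact_Icc.exists_bound_of_continuousOn
    ((hc x).continuousOn (s := Icc s (s + τ)))
  have hM0 : 0 ≤ M := (norm_nonneg _).trans (hM s ⟨le_rfl, by linarith⟩)
  lift M to ℝ≥0 using hM0
  lift τ to ℝ≥0 using hτ
  -- In the ball of radius `2 M τ` about `x` the speed is at most `M + K (2 M τ) ≤ 2 M` because `K τ
  -- ≤ 1/2`, so solutions do not leave the ball during time `τ`.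
  have hpl : IsPicardLindelof v (⟨s, le_rfl, by simp⟩ : Icc s (s + τ)) x (2 * M * τ) 0
      (M + K * (2 * M * τ)) K :=
    { lipschitzOnWith := fun t _ => (hK t).lipschitzOnWith
      continuousOn := fun x _ => (hc x).continuousOn
      norm_le := fun t ht z hz => by
        have h1 := (hK t).dist_le_mul z x
        rw [dist_eq_norm] at h1
        have h2 := hM t ht
        have h3 : ‖v t z‖ ≤ ‖v t z - v t x‖ + ‖v t x‖ := by
          simpa using norm_add_le (v t z - v t x) (v t x)
        rw [Metric.mem_closedBall] at hz
        have h4 : (K : ℝ) * dist z x ≤ K * ((2 * M * τ : ℝ≥0) : ℝ) := by gcongr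
        push_cast at h4 ⊢
        linarith
      mul_max_le := by
        push_cast
        simp only [add_sub_cancel_left, sub_self, sub_zero]
        rw [max_eq_left τ.coe_nonneg]
        have : (M : ℝ) * τ * (K * τ) ≤ M * τ * (1 / 2) := by gcongr
        nlinarith }
  exact hpl.exists_eq_forall_mem_Icc_hasDerivWithinAt₀

/-- The admissible time step depends on `K` alone, neither on the starting time nor on the point, so
finitely many steps of one length cover `[0, T]`. -/
theorem exists_hasDerivWithinAt_global {v : ℝ → E → E} {K : ℝ≥0}
    (hK : ∀ t, LipschitzWith K (v t)) (hc : ∀ x, Continuous fun t => v t x) (x : E) (T : ℝ) :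
    ∃ y : ℝ → E, y 0 = x ∧ ∀ t ∈ Icc 0 T, HasDerivWithinAt y (v t (y t)) (Icc 0 T) t := by
  obtain ⟨τ, hτ, hKτ⟩ : ∃ τ : ℝ, 0 < τ ∧ K * τ ≤ 1 / 2 := by
    refine ⟨1 / (2 * (K + 1)), by positivity, ?_⟩
    rw [mul_one_div, div_le_div_iff₀ (by positivity) (by norm_num)]
    nlinarith
  have step : ∀ n : ℕ, ∃ y : ℝ → E, y 0 = x ∧ ∀ t ∈ Icc 0 (n * τ),
      HasDerivWithinAt y (v t (y t)) (Icc 0 (n * τ)) t := by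
    intro n
    induction n with
    | zero =>
      obtain ⟨y, hy0, hy⟩ := exists_hasDerivWithinAt_short hK hc 0 le_rfl (by simp) x
      exact ⟨y, hy0, by simpa using hy⟩
    | succ n ih =>
      obtain ⟨y, hy0, hy⟩ := ih
      obtain ⟨z, hz0, hz⟩ := exists_hasDerivWithinAt_short hK hc (n * τ) hτ.le hKτ (y (n * τ))
      obtain ⟨w, hw0, hw⟩ := exists_hasDerivWithinAt_concat (by positivity) (by linarith)
        hz0.symm hy hz
      refine ⟨w, hw0.trans hy0, ?_⟩
      have e : ((n + 1 : ℕ) : ℝ) * τ = n * τ + τ := by push_cast; ring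
      rwa [e]
  obtain ⟨n, hn⟩ := exists_nat_ge (T / τ)
  obtain ⟨y, hy0, hy⟩ := step n
  have hTn : T ≤ n * τ := (div_le_iff₀ hτ).1 hn
  exact ⟨y, hy0, fun t ht => (hy t ⟨ht.1, ht.2.trans hTn⟩).mono (Icc_subset_Icc_right hTn)⟩

end ODE

/-! ### Truncation of the nonlinearity -/

/-- A globally Lipschitz coercive nonlinearity `f` with primitive `F`. -/
structure IsNonlin (f F : ℝ → ℝ) (K : ℝ≥0) (a b m : ℝ) : Prop where
  lip : LipschitzWith K f
  zero : f 0 = 0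
  hasDerivAt : ∀ x, HasDerivAt F (f x) x
  prim_zero : F 0 = 0
  coercive : ∀ u, a * u ^ 2 - b ≤ u * f u
  lower : ∀ u, -m ≤ F u

/-- The sign of `f` beyond radius `r` makes `F` grow away from the origin, so a lower bound on `[-r,
r]` is global. The bound is thus insensitive to the behaviour of `f` at infinity. -/
theorem prim_lower_bound {f F : ℝ → ℝ} {m r : ℝ} (hr : 0 ≤ r) (hF : ∀ x, HasDerivAt F (f x) x)
    (hpos : ∀ u, r ≤ |u| → 0 ≤ u * f u) (hm : ∀ u, |u| ≤ r → -m ≤ F u) (u : ℝ) : -m ≤ F u := by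
  rcases le_or_gt |u| r with h | h
  · exact hm u h
  have hc : Continuous F := continuous_iff_continuousAt.2 fun x => (hF x).continuousAt
  rcases le_or_gt 0 u with hu | hu
  · rw [abs_of_nonneg hu] at h
    have h1 : MonotoneOn F (Ici r) := by
      refine monotoneOn_of_deriv_nonneg (convex_Ici r) hc.continuousOn
        (fun x _ => (hF x).differentiableAt.differentiableWithinAt) fun x hx => ?_
      rw [interior_Ici, mem_Ioi] at hx
      rw [(hF x).deriv]
      have := hpos x (hx.le.trans (le_abs_self x))
      exact nonneg_of_mul_nonneg_right this (hr.trans_lt hx)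
    exact (hm r (by rw [abs_of_nonneg hr])).trans (h1 self_mem_Ici h.le h.le)
  · rw [abs_of_neg hu] at h
    have h1 : AntitoneOn F (Iic (-r)) := by
      refine antitoneOn_of_deriv_nonpos (convex_Iic (-r)) hc.continuousOn
        (fun x _ => (hF x).differentiableAt.differentiableWithinAt) fun x hx => ?_
      rw [interior_Iic, mem_Iio] at hx
      rw [(hF x).deriv]
      have := hpos x (by linarith [neg_le_abs x])
      nlinarith
    refine (hm (-r) (by rw [abs_neg, abs_of_nonneg hr])).trans (h1 ?_ self_mem_Iic ?_)
    · exact (by linarith : u ≤ -r)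
    · linarith

/-- Outside `[-R, R]` the derivative is continued with slope `a`. Coercivity at `±R` passes to the
continuation after halving `a`, and the lower bound of the primitive is decided on a fixed interval;
hence no constant except the Lipschitz one depends on `R`. -/
theorem IsBistable.exists_truncation {V : ℝ → ℝ} (hV : IsBistable V) :
    ∃ a b m R₁ : ℝ, 0 < a ∧ 0 < b ∧ 0 < m ∧ ∀ R, R₁ ≤ R →
      ∃ (f F : ℝ → ℝ) (K : ℝ≥0), IsNonlin f F K a b m ∧
        ∀ u, |u| ≤ R → f u = deriv V u ∧ F u = V u := by
  obtain ⟨a, b, ha, hb, hab⟩ := hV.coercive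
  have hVd : ∀ x, HasDerivAt V (deriv V x) x := fun x =>
    (hV.contDiff.differentiable (by norm_num) x).hasDerivAt
  have hv1 : ContDiff ℝ 1 (deriv V) :=
    ((contDiff_succ_iff_deriv (n := 2)).1 (by exact hV.contDiff)).2.2.of_le (by norm_num)
  -- Beyond this radius `(a/2) u² ≥ b`, so coercivity with the halved constant already forces `u
  -- f(u) ≥ 0`.
  set r := Real.sqrt (2 * b / a) with hr
  have hr0 : 0 < r := Real.sqrt_pos.2 (by positivity)
  have hr2 : a * r ^ 2 = 2 * b := by
    rw [hr, Real.sq_sqrt (by positivity)]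
    field_simp
  have hpos : ∀ f : ℝ → ℝ, (∀ u, a / 2 * u ^ 2 - b ≤ u * f u) → ∀ u, r ≤ |u| → 0 ≤ u * f u :=
    fun f hf u hu => by
    refine le_trans ?_ (hf u)
    have : r ^ 2 ≤ u ^ 2 := by
      rw [← sq_abs u]
      gcongr
    nlinarith
  obtain ⟨m, hm⟩ := isCompact_Icc.exists_bound_of_continuousOn
    (hV.contDiff.continuous.continuousOn (s := Icc (-r) r))
  have hm0 : 0 ≤ m := (norm_nonneg _).trans (hm 0 ⟨by linarith, hr0.le⟩)
  have hmV : ∀ u, |u| ≤ r → -(m + 1) ≤ V u := fun u hu => by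
    have := neg_le_of_abs_le (hm u (abs_le.1 hu))
    linarith
  have hab2 : ∀ u, a / 2 * u ^ 2 - b ≤ u * deriv V u := fun u =>
    le_trans (by nlinarith [sq_nonneg u]) (hab u)
  refine ⟨a / 2, b, m + 1, r, by positivity, hb, by positivity, fun R hR => ?_⟩
  have hR0 : 0 < R := hr0.trans_le hR
  have hbR : 2 * b ≤ a * R ^ 2 := by
    rw [← hr2]
    gcongr
  obtain ⟨K₀, hK₀⟩ := hv1.contDiffOn.exists_lipschitzOnWith (by norm_num) (convex_Icc (-R) R)
    isCompact_Icc
  -- The projection onto `[-R, R]`: `V' ∘ cl` is globally Lipschitz, and `a (x - cl x)` restores the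
  -- linear growth.
  set cl : ℝ → ℝ := fun x => max (-R) (min x R) with hcl
  have hcl1 : LipschitzWith 1 cl := (LipschitzWith.id.min_const R).const_max (-R)
  have hclm : ∀ x, cl x ∈ Icc (-R) R := fun x =>
    ⟨le_max_left _ _, max_le (by linarith) (min_le_right _ _)⟩
  have hcle : ∀ x, |x| ≤ R → cl x = x := fun x hx => by
    have := abs_le.1 hx
    simp only [hcl]
    rw [min_eq_left this.2, max_eq_right this.1]
  set f : ℝ → ℝ := fun x => deriv V (cl x) + a * (x - cl x) with hf
  have hflip : LipschitzWith (K₀ + a.toNNReal * (1 + 1)) f := by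
    refine LipschitzWith.add ?_ ?_
    · have := hK₀.comp (hcl1.lipschitzOnWith (s := univ)) (fun x _ => hclm x)
      rw [mul_one] at this
      exact lipschitzOnWith_univ.1 this
    · have h1 : LipschitzWith (1 + 1) fun x => x - cl x := LipschitzWith.id.sub hcl1
      refine LipschitzWith.of_dist_le_mul fun x y => ?_
      have := h1.dist_le_mul x y
      rw [Real.dist_eq] at this ⊢
      rw [← mul_sub, abs_mul, abs_of_pos ha, NNReal.coe_mul, mul_assoc,
        Real.coe_toNNReal a ha.le]
      exact mul_le_mul_of_nonneg_left this ha.le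
  have hfe : ∀ x, |x| ≤ R → f x = deriv V x := fun x hx => by
    simp only [hf, hcle x hx, sub_self, mul_zero, add_zero]
  set F : ℝ → ℝ := fun x => ∫ t in (0 : ℝ)..x, f t with hF
  have hFd : ∀ x, HasDerivAt F (f x) x := fun x =>
    (hflip.continuous.integral_hasStrictDerivAt _ _).hasDerivAt
  have hFe : ∀ x, |x| ≤ R → F x = V x := fun x hx => by
    have h1 : F x = ∫ t in (0 : ℝ)..x, deriv V t := by
      refine intervalIntegral.integral_congr fun t ht => hfe t ?_
      refine le_trans ?_ hx
      simpa using abs_sub_left_of_mem_uIcc ht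
    rw [h1, intervalIntegral.integral_eq_sub_of_hasDerivAt (fun t _ => hVd t)
      (hv1.continuous.intervalIntegrable _ _), hV.zero.1, sub_zero]
  have hcoer : ∀ u, a / 2 * u ^ 2 - b ≤ u * f u := fun u => by
    rcases le_or_gt |u| R with h | h
    · rw [hfe u h]
      exact hab2 u
    rcases le_or_gt 0 u with hu | hu
    · rw [abs_of_nonneg hu] at h
      have e : cl u = R := by
        simp only [hcl]
        rw [min_eq_right h.le, max_eq_right (by linarith)]
      have h1 := hab R
      have h2 : u * (a * R ^ 2 - b) ≤ u * (R * deriv V R) := mul_le_mul_of_nonneg_left h1 hu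
      -- The factor `R` allows the coercivity inequality at the point `R`, multiplied by `u`, to be
      -- inserted; the excess is absorbed through `2 b ≤ a R²`.
      have h3 : R * (a / 2 * u ^ 2 - b) ≤ R * (u * f u) := by
        simp only [hf, e]
        have h4 : 0 ≤ u * (a * R * (u - R)) := by
          have : 0 ≤ u - R := by linarith
          positivity
        nlinarith [mul_le_mul_of_nonneg_left hbR hu, mul_pos hR0 hb]
      exact le_of_mul_le_mul_left h3 hR0
    · rw [abs_of_neg hu] at h
      have e : cl u = -R := by
        simp only [hcl]
        rw [min_eq_left (by linarith), max_eq_left (by linarith)]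
      have h1 := hab (-R)
      have h2 : -u * (a * R ^ 2 - b) ≤ -u * (-R * deriv V (-R)) := by
        refine mul_le_mul_of_nonneg_left ?_ (by linarith)
        simpa using h1
      have h3 : R * (a / 2 * u ^ 2 - b) ≤ R * (u * f u) := by
        simp only [hf, e]
        have h4 : 0 ≤ -u * (a * R * (-u - R)) := by
          have h5 : 0 ≤ -u - R := by linarith
          have h6 : 0 ≤ -u := by linarith
          positivity
        nlinarith [mul_le_mul_of_nonneg_left hbR (by linarith : 0 ≤ -u), mul_pos hR0 hb]
      exact le_of_mul_le_mul_left h3 hR0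
  refine ⟨f, F, _, ⟨hflip, ?_, hFd, by simp [hF], hcoer,
    prim_lower_bound hr0.le hFd (hpos _ hcoer) fun u hu => ?_⟩,
    fun u hu => ⟨hfe u hu, hFe u hu⟩⟩
  · rw [hfe 0 (by simpa using hR0.le), hV.zero.2.1]
  · rw [hFe u (hu.trans hR)]
    exact hmV u hu

/-! ### Elements and curves in `H¹_ul` -/

/-- The element of `H¹_ul` with underlying function `f` and weak derivative `g`. -/
def mkH1 (f g : L2ul) (h : HasWeakDeriv f g) : H1ul := ⟨WithLp.toLp 2 (f, g), h⟩

theorem toL2_sub (u v : H1ul) : toL2 (u - v) = toL2 u - toL2 v := rfl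

theorem dx_sub (u v : H1ul) : dx (u - v) = dx u - dx v := rfl

theorem hasWeakDeriv_dx (u : H1ul) : HasWeakDeriv (toL2 u) (dx u) := u.2

theorem norm_toL2_le (u : H1ul) : ‖toL2 u‖ ≤ ‖u‖ := by
  refine le_of_sq_le_sq ?_ (norm_nonneg _)
  nlinarith [norm_sq_H1ul u, sq_nonneg ‖dx u‖]

theorem norm_dx_le (u : H1ul) : ‖dx u‖ ≤ ‖u‖ := by
  refine le_of_sq_le_sq ?_ (norm_nonneg _)
  nlinarith [norm_sq_H1ul u, sq_nonneg ‖toL2 u‖]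

theorem norm_H1ul_le (u : H1ul) : ‖u‖ ≤ ‖toL2 u‖ + ‖dx u‖ := by
  refine le_of_sq_le_sq ?_ (by positivity)
  nlinarith [norm_sq_H1ul u, norm_nonneg (toL2 u), norm_nonneg (dx u)]

theorem continuous_toL2 : Continuous toL2 :=
  (LipschitzWith.of_dist_le_mul (K := 1) fun u v => by
    rw [dist_eq_norm, dist_eq_norm, ← toL2_sub]
    simpa using norm_toL2_le (u - v)).continuous

theorem continuous_dx : Continuous dx :=
  (LipschitzWith.of_dist_le_mul (K := 1) fun u v => by
    rw [dist_eq_norm, dist_eq_norm, ← dx_sub]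
    simpa using norm_dx_le (u - v)).continuous

theorem continuousOn_H1ul {U : ℝ → H1ul} {S : Set ℝ} (h1 : ContinuousOn (fun t => toL2 (U t)) S)
    (h2 : ContinuousOn (fun t => dx (U t)) S) : ContinuousOn U S := fun t ht => by
  rw [ContinuousWithinAt, tendsto_iff_norm_sub_tendsto_zero]
  refine squeeze_zero (fun _ => norm_nonneg _) (fun s => norm_H1ul_le _) ?_
  have t1 := tendsto_iff_norm_sub_tendsto_zero.1 (h1 t ht).tendsto
  have t2 := tendsto_iff_norm_sub_tendsto_zero.1 (h2 t ht).tendsto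
  simpa [toL2_sub, dx_sub] using t1.add t2

/-! ### The pairing is linear -/

theorem integral_add_mul (f g : L2ul) {φ : ℝ → ℝ} (hφ : IsTest φ) :
    ∫ x, (f + g) x * φ x = (∫ x, f x * φ x) + ∫ x, g x * φ x := by
  obtain ⟨Φ, hΦ⟩ := exists_pairing hφ.1.continuous hφ.2
  simp only [← hΦ, map_add]

theorem integral_sub_mul (f g : L2ul) {φ : ℝ → ℝ} (hφ : IsTest φ) :
    ∫ x, (f - g) x * φ x = (∫ x, f x * φ x) - ∫ x, g x * φ x := by
  obtain ⟨Φ, hΦ⟩ := exists_pairing hφ.1.continuous hφ.2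
  simp only [← hΦ, map_sub]

theorem integral_smul_mul (c : ℝ) (f : L2ul) {φ : ℝ → ℝ} (hφ : IsTest φ) :
    ∫ x, (c • f) x * φ x = c * ∫ x, f x * φ x := by
  obtain ⟨Φ, hΦ⟩ := exists_pairing hφ.1.continuous hφ.2
  simp only [← hΦ, map_smul, smul_eq_mul]

theorem integral_neg_mul (f : L2ul) {φ : ℝ → ℝ} (hφ : IsTest φ) :
    ∫ x, (-f) x * φ x = -∫ x, f x * φ x := by
  obtain ⟨Φ, hΦ⟩ := exists_pairing hφ.1.continuous hφ.2
  simp only [← hΦ, map_neg]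

theorem _root_.HasDerivWithinAt.pairing {w : ℝ → L2ul} {w' : L2ul} {S : Set ℝ} {t : ℝ}
    (h : HasDerivWithinAt w w' S t) {φ : ℝ → ℝ} (hφ : IsTest φ) :
    HasDerivWithinAt (fun s => ∫ x, w s x * φ x) (∫ x, w' x * φ x) S t := by
  obtain ⟨Φ, hΦ⟩ := exists_pairing hφ.1.continuous hφ.2
  simp only [← hΦ]
  exact Φ.hasFDerivAt.comp_hasDerivWithinAt t h

/-! ### The system in characteristic coordinates -/

theorem Tr_cancel {a b : ℝ} (h : a + b = 0) (f : L2ul) : Tr a (Tr b f) = f := by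
  rw [Tr_Tr, h, Tr_zero]

/-- The right-hand side `-γ (u_t + N(u))`, where `u_t = (p + q) / 2`. -/
def force (γ : ℝ) (N : L2ul → L2ul) (u p q : L2ul) : L2ul :=
  -(γ • ((1 / 2 : ℝ) • (p + q) + N u))

/-- The first order system satisfied on `[0,T]` by `u`, `p = u_t + c u_x` and `q = u_t - c u_x`. -/
structure CharSol (c γ T : ℝ) (N : L2ul → L2ul) (u p q : ℝ → L2ul) : Prop where
  du : ∀ t ∈ Icc 0 T, HasDerivWithinAt u ((1 / 2 : ℝ) • (p t + q t)) (Icc 0 T) t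
  dp : CharTransport c T p fun t => force γ N (u t) (p t) (q t)
  dq : CharTransport (-c) T q fun t => force γ N (u t) (p t) (q t)

/-- The constraint `c u_x = (p - q) / 2`. -/
def Compat (c : ℝ) (u p q : L2ul) : Prop := HasWeakDeriv u ((1 / (2 * c)) • (p - q) : L2ul)

theorem CharSol.mono {c γ T T' : ℝ} {N : L2ul → L2ul} {u p q : ℝ → L2ul}
    (h : CharSol c γ T N u p q) (hT : T' ≤ T) : CharSol c γ T' N u p q := by
  have hs : Icc 0 T' ⊆ Icc 0 T := Icc_subset_Icc_right hT
  exact ⟨fun t ht => (h.du t (hs ht)).mono hs, fun t ht => (h.dp t (hs ht)).mono hs,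
    fun t ht => (h.dq t (hs ht)).mono hs⟩

theorem CharSol.congr {c γ T : ℝ} {N N' : L2ul → L2ul} {u p q : ℝ → L2ul}
    (h : CharSol c γ T N u p q) (hN : ∀ t ∈ Icc 0 T, N (u t) = N' (u t)) :
    CharSol c γ T N' u p q := by
  refine ⟨h.du, fun t ht => ?_, fun t ht => ?_⟩
  · have := h.dp t ht
    simp only [force, hN t ht] at this
    exact this
  · have := h.dq t ht
    simp only [force, hN t ht] at this
    exact this

/-- The forces cancel in the difference of the two transport equations, leaving `(p - q)_t = c (p +
q)_x = 2 c (u_t)_x` in the weak sense. So `u_x - (p - q) / (2c)` is constant in time as a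
distribution, and compatible data stay in `H¹_ul`. -/
theorem CharSol.compat {c γ T : ℝ} (hc : 0 < c) {N : L2ul → L2ul} {u p q : ℝ → L2ul}
    (h : CharSol c γ T N u p q) (h0 : Compat c (u 0) (p 0) (q 0)) :
    ∀ t ∈ Icc 0 T, Compat c (u t) (p t) (q t) := by
  intro t ht φ hφ
  have hd : ∀ s ∈ Icc 0 T, HasDerivWithinAt (fun s => (∫ x, u s x * deriv φ x)
      + 1 / (2 * c) * ((∫ x, p s x * φ x) - ∫ x, q s x * φ x)) 0 (Icc 0 T) s := fun s hs => by
    have h1 := (h.du s hs).pairing hφ.deriv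
    have h2 := h.dp.weakTransport φ hφ s hs
    have h3 := h.dq.weakTransport φ hφ s hs
    refine (h1.add ((h2.sub h3).const_mul _)).congr_deriv ?_
    rw [integral_smul_mul _ _ hφ.deriv, integral_add_mul _ _ hφ.deriv]
    field_simp
    ring
  have hconst := constant_of_has_deriv_right_zero (fun s hs => (hd s hs).continuousWithinAt)
    (fun s hs => (hd s (Ico_subset_Icc_self hs)).mono_of_mem_nhdsWithin
      (mem_nhdsGE_of_mem_Ico hs)) t ht
  have h00 := h0 φ hφ
  rw [integral_smul_mul _ _ hφ, integral_sub_mul _ _ hφ] at h00 ⊢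
  linarith

/-- Under the constraint, `u_t = c u_x + q`. Thus `u` can be differentiated along the
characteristics of `p`, as is needed for the combination `α p + u/2` in the energy. -/
theorem CharSol.charTransport_u_left {c γ T : ℝ} (hc : 0 < c) {N : L2ul → L2ul}
    {u p q : ℝ → L2ul} (h : CharSol c γ T N u p q)
    (hcomp : ∀ t ∈ Icc 0 T, Compat c (u t) (p t) (q t)) : CharTransport c T u q := by
  refine WeakTransport.charTransport (fun φ hφ t ht => ?_)
    (fun t ht => (h.du t ht).continuousWithinAt) h.dq.continuousOn
  refine ((h.du t ht).pairing hφ).congr_deriv ?_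
  rw [hcomp t ht φ hφ, integral_smul_mul _ _ hφ, integral_smul_mul _ _ hφ,
    integral_sub_mul _ _ hφ, integral_add_mul _ _ hφ]
  field_simp
  ring

theorem CharSol.charTransport_u_right {c γ T : ℝ} (hc : 0 < c) {N : L2ul → L2ul}
    {u p q : ℝ → L2ul} (h : CharSol c γ T N u p q)
    (hcomp : ∀ t ∈ Icc 0 T, Compat c (u t) (p t) (q t)) : CharTransport (-c) T u p := by
  refine WeakTransport.charTransport (fun φ hφ t ht => ?_)
    (fun t ht => (h.du t ht).continuousWithinAt) h.dp.continuousOn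
  refine ((h.du t ht).pairing hφ).congr_deriv ?_
  rw [hcomp t ht φ hφ, integral_smul_mul _ _ hφ, integral_smul_mul _ _ hφ,
    integral_sub_mul _ _ hφ, integral_add_mul _ _ hφ]
  field_simp
  ring

/-- The vector field of the system in the unknowns `(u, T_{ct} p, T_{-ct} q)`. -/
def charField (c γ : ℝ) (N : L2ul → L2ul) (t : ℝ) (y : L2ul × L2ul × L2ul) :
    L2ul × L2ul × L2ul :=
  ((1 / 2 : ℝ) • (Tr (-c * t) y.2.1 + Tr (c * t) y.2.2),
    Tr (c * t) (force γ N y.1 (Tr (-c * t) y.2.1) (Tr (c * t) y.2.2)),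
    Tr (-c * t) (force γ N y.1 (Tr (-c * t) y.2.1) (Tr (c * t) y.2.2)))

theorem norm_half_add_le {a b : L2ul} {d : ℝ} (ha : ‖a‖ ≤ d) (hb : ‖b‖ ≤ d) :
    ‖(1 / 2 : ℝ) • (a + b)‖ ≤ d := by
  rw [norm_smul, Real.norm_of_nonneg (by norm_num)]
  linarith [norm_add_le a b]

/-- Translations being isometries, the time-dependent conjugation leaves the Lipschitz constant
independent of `t`. -/
theorem lipschitzWith_charField (c γ : ℝ) {N : L2ul → L2ul} {K : ℝ≥0} (hN : LipschitzWith K N)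
    (t : ℝ) : LipschitzWith (1 + ‖γ‖₊ * (1 + K)) (charField c γ N t) := by
  refine LipschitzWith.of_dist_le_mul fun y z => ?_
  set d := dist y z with hd
  have d1 : ‖y.1 - z.1‖ ≤ d := by rw [← dist_eq_norm]; exact le_max_left _ _
  have d2 : ‖y.2.1 - z.2.1‖ ≤ d := by
    rw [← dist_eq_norm]; exact (le_max_left _ _).trans (le_max_right _ _)
  have d3 : ‖y.2.2 - z.2.2‖ ≤ d := by
    rw [← dist_eq_norm]; exact (le_max_right _ _).trans (le_max_right _ _)
  have hd0 : 0 ≤ d := dist_nonneg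
  have e1 : ‖(1 / 2 : ℝ) • (Tr (-c * t) y.2.1 + Tr (c * t) y.2.2)
      - (1 / 2 : ℝ) • (Tr (-c * t) z.2.1 + Tr (c * t) z.2.2)‖ ≤ d := by
    rw [← smul_sub, add_sub_add_comm, ← map_sub, ← map_sub]
    exact norm_half_add_le (by rwa [(Tr _).norm_map]) (by rwa [(Tr _).norm_map])
  have e2 : ‖force γ N y.1 (Tr (-c * t) y.2.1) (Tr (c * t) y.2.2)
      - force γ N z.1 (Tr (-c * t) z.2.1) (Tr (c * t) z.2.2)‖ ≤ |γ| * ((1 + K) * d) := by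
    rw [force, force, neg_sub_neg, ← smul_sub, norm_smul, Real.norm_eq_abs, norm_sub_rev]
    have h1 := hN.dist_le_mul y.1 z.1
    rw [dist_eq_norm, dist_eq_norm] at h1
    gcongr
    rw [add_sub_add_comm]
    refine (norm_add_le _ _).trans ?_
    have : (K : ℝ) * ‖y.1 - z.1‖ ≤ K * d := by gcongr
    linarith
  have hg : (0 : ℝ) ≤ |γ| * (1 + K) := by positivity
  simp only [NNReal.coe_add, NNReal.coe_one, NNReal.coe_mul, coe_nnnorm, Real.norm_eq_abs]
  refine max_le ?_ (max_le ?_ ?_)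
  · rw [dist_eq_norm]
    refine e1.trans ?_
    nlinarith
  · show dist (Tr _ _) (Tr _ _) ≤ _
    rw [(Tr _).dist_map, dist_eq_norm]
    refine e2.trans ?_
    nlinarith
  · show dist (Tr _ _) (Tr _ _) ≤ _
    rw [(Tr _).dist_map, dist_eq_norm]
    refine e2.trans ?_
    nlinarith

theorem continuous_charField (c γ : ℝ) {N : L2ul → L2ul}
    (y : L2ul × L2ul × L2ul) : Continuous fun t => charField c γ N t y := by
  have hT : ∀ (l : ℝ) {w : ℝ → L2ul}, Continuous w → Continuous fun t : ℝ => Tr (l * t) (w t) :=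
    fun l w hw => continuous_Tr.comp ((continuous_const.mul continuous_id).prodMk hw)
  have h1 := hT (-c) (w := fun _ => y.2.1) continuous_const
  have h2 := hT c (w := fun _ => y.2.2) continuous_const
  have h3 : Continuous fun t => (1 / 2 : ℝ) • (Tr (-c * t) y.2.1 + Tr (c * t) y.2.2) :=
    (h1.add h2).const_smul (1 / 2 : ℝ)
  have hf : Continuous fun t => force γ N y.1 (Tr (-c * t) y.2.1) (Tr (c * t) y.2.2) :=
    ((h3.add continuous_const).const_smul γ).neg
  exact h3.prodMk ((hT c hf).prodMk (hT (-c) hf))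

theorem CharSol.hasDerivWithinAt {c γ T : ℝ} {N : L2ul → L2ul} {u p q : ℝ → L2ul}
    (h : CharSol c γ T N u p q) :
    ∀ t ∈ Icc 0 T, HasDerivWithinAt (fun t => (u t, Tr (c * t) (p t), Tr (-c * t) (q t)))
      (charField c γ N t (u t, Tr (c * t) (p t), Tr (-c * t) (q t))) (Icc 0 T) t := fun t ht => by
  refine ((h.du t ht).prodMk ((h.dp t ht).prodMk (h.dq t ht))).congr_deriv ?_
  simp only [charField, Tr_cancel (show -c * t + c * t = 0 by ring),
    Tr_cancel (show c * t + -c * t = 0 by ring)]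

theorem exists_charSol (c γ : ℝ) {N : L2ul → L2ul} {K : ℝ≥0} (hN : LipschitzWith K N)
    (u₀ p₀ q₀ : L2ul) (T : ℝ) :
    ∃ u p q : ℝ → L2ul, u 0 = u₀ ∧ p 0 = p₀ ∧ q 0 = q₀ ∧ CharSol c γ T N u p q := by
  obtain ⟨y, hy0, hy⟩ := exists_hasDerivWithinAt_global
    (lipschitzWith_charField c γ hN) (continuous_charField c γ) (u₀, p₀, q₀) T
  have k1 : ∀ (r : ℝ) (f : L2ul), Tr (c * r) (Tr (-c * r) f) = f := fun r => Tr_cancel (by ring)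
  have k2 : ∀ (r : ℝ) (f : L2ul), Tr (-c * r) (Tr (c * r) f) = f := fun r => Tr_cancel (by ring)
  refine ⟨fun t => (y t).1, fun t => Tr (-c * t) (y t).2.1, fun t => Tr (c * t) (y t).2.2,
    by simp [hy0], by simp [hy0], by simp [hy0], fun t ht => ?_, fun t ht => ?_, fun t ht => ?_⟩
  · exact (hasFDerivAt_fst (𝕜 := ℝ)).comp_hasDerivWithinAt t (hy t ht)
  · simp only [k1]
    exact (hasFDerivAt_fst (𝕜 := ℝ)).comp_hasDerivWithinAt t
      ((hasFDerivAt_snd (𝕜 := ℝ)).comp_hasDerivWithinAt t (hy t ht))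
  · simp only [k2]
    exact (hasFDerivAt_snd (𝕜 := ℝ)).comp_hasDerivWithinAt t
      ((hasFDerivAt_snd (𝕜 := ℝ)).comp_hasDerivWithinAt t (hy t ht))

/-- Lipschitz dependence on the data. -/
theorem CharSol.norm_sub_le {c γ T : ℝ} {N : L2ul → L2ul} {K : ℝ≥0} (hN : LipschitzWith K N)
    {u p q u' p' q' : ℝ → L2ul} (h : CharSol c γ T N u p q) (h' : CharSol c γ T N u' p' q')
    {δ : ℝ} (hu : ‖u 0 - u' 0‖ ≤ δ) (hp : ‖p 0 - p' 0‖ ≤ δ) (hq : ‖q 0 - q' 0‖ ≤ δ) :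
    ∀ t ∈ Icc 0 T, ‖u t - u' t‖ ≤ δ * Real.exp ((1 + |γ| * (1 + K)) * t) ∧
      ‖p t - p' t‖ ≤ δ * Real.exp ((1 + |γ| * (1 + K)) * t) ∧
      ‖q t - q' t‖ ≤ δ * Real.exp ((1 + |γ| * (1 + K)) * t) := by
  intro t ht
  have h1 := dist_le_of_hasDerivWithinAt (lipschitzWith_charField c γ hN) h.hasDerivWithinAt
    h'.hasDerivWithinAt t ht
  have h0 : dist (u 0, Tr (c * 0) (p 0), Tr (-c * 0) (q 0))
      (u' 0, Tr (c * 0) (p' 0), Tr (-c * 0) (q' 0)) ≤ δ := by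
    refine max_le ?_ (max_le ?_ ?_)
    · rwa [dist_eq_norm]
    · show dist (Tr _ _) (Tr _ _) ≤ _
      rwa [(Tr _).dist_map, dist_eq_norm]
    · show dist (Tr _ _) (Tr _ _) ≤ _
      rwa [(Tr _).dist_map, dist_eq_norm]
  simp only [NNReal.coe_add, NNReal.coe_one, NNReal.coe_mul, coe_nnnorm, Real.norm_eq_abs] at h1
  have h2 := h1.trans (mul_le_mul_of_nonneg_right h0 (Real.exp_pos _).le)
  have h3 := max_le_iff.1 h2
  have h4 := max_le_iff.1 h3.2
  refine ⟨by simpa [dist_eq_norm] using h3.1, ?_, ?_⟩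
  · have := h4.1
    simp only [(Tr _).dist_map] at this
    rwa [dist_eq_norm] at this
  · have := h4.2
    simp only [(Tr _).dist_map] at this
    rwa [dist_eq_norm] at this

/-! ### Weak solutions and the characteristic system -/

section Weak

variable {α : ℝ} {V : ℝ → ℝ} {u₀ : H1ul} {u₁ : L2ul} {u : ℝ → H1ul}

theorem IsSolution.hasDerivWithinAt (h : IsSolution α V u₀ u₁ u) {t : ℝ} (ht : 0 ≤ t) :
    HasDerivWithinAt (fun s => toL2 (u s)) (timeDeriv u t) (Ici 0) t :=
  (h.contDiffOn.differentiableOn (by norm_num) t ht).hasDerivWithinAt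

theorem IsSolution.continuousOn_timeDeriv (h : IsSolution α V u₀ u₁ u) :
    ContinuousOn (timeDeriv u) (Ici 0) :=
  h.contDiffOn.continuousOn_derivWithin (uniqueDiffOn_Ici 0) le_rfl

/-- The weak equation gives `(u_t)_t = c² (u_x)_x` plus the force, and the definition of the weak
derivative gives `(u_x)_t = (u_t)_x`; the combinations with coefficient `±c` are the transport
equations. Truncation is harmless because `f` and `V'` agree on the values of `u`. -/
theorem CharSol.of_isSolution (h : IsSolution α V u₀ u₁ u) {c : ℝ} (hαc : α * c ^ 2 = 1) {T : ℝ}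
    {f : ℝ → ℝ} {K : ℝ≥0} (hf : LipschitzWith K f) (h0 : f 0 = 0)
    (hfV : ∀ t ∈ Icc 0 T, ∀ᵐ x, f (toL2 (u t) x) = deriv V (toL2 (u t) x)) :
    CharSol c (c ^ 2) T (nem f K hf h0) (fun t => toL2 (u t))
      (fun t => timeDeriv u t + c • dx (u t)) (fun t => timeDeriv u t - c • dx (u t)) := by
  have hsub : Icc 0 T ⊆ Ici (0 : ℝ) := fun t ht => ht.1
  have cu : ContinuousOn (fun t => toL2 (u t)) (Icc 0 T) :=
    continuous_toL2.comp_continuousOn (h.continuousOn.mono hsub)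
  have cx : ContinuousOn (fun t => dx (u t)) (Icc 0 T) :=
    continuous_dx.comp_continuousOn (h.continuousOn.mono hsub)
  have ct : ContinuousOn (timeDeriv u) (Icc 0 T) := h.continuousOn_timeDeriv.mono hsub
  have cN : ContinuousOn (fun t => nem f K hf h0 (toL2 (u t))) (Icc 0 T) :=
    (lipschitzWith_nem hf h0).continuous.comp_continuousOn cu
  have cG : ContinuousOn (fun t => -(c ^ 2 • (timeDeriv u t + nem f K hf h0 (toL2 (u t)))))
      (Icc 0 T) := by
    have h1 : ContinuousOn (fun t => timeDeriv u t + nem f K hf h0 (toL2 (u t))) (Icc 0 T) :=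
      ct.add cN
    have h2 : ContinuousOn (fun t => c ^ 2 • (timeDeriv u t + nem f K hf h0 (toL2 (u t))))
        (Icc 0 T) := h1.const_smul (c ^ 2)
    exact h2.neg
  have cxc : ContinuousOn (fun t => c • dx (u t)) (Icc 0 T) := cx.const_smul c
  have hforce : ∀ t, force (c ^ 2) (nem f K hf h0) (toL2 (u t)) (timeDeriv u t + c • dx (u t))
      (timeDeriv u t - c • dx (u t))
      = -(c ^ 2 • (timeDeriv u t + nem f K hf h0 (toL2 (u t)))) := fun t => by
    rw [force]
    congr 3
    module
  have weak : ∀ φ, IsTest φ → ∀ t ∈ Icc 0 T, ∃ A : ℝ,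
      HasDerivWithinAt (fun s => ∫ x, timeDeriv u s x * φ x) A (Icc 0 T) t ∧
      HasDerivWithinAt (fun s => ∫ x, dx (u s) x * φ x) (-∫ x, timeDeriv u t x * deriv φ x)
        (Icc 0 T) t ∧
      A = -c ^ 2 * (∫ x, dx (u t) x * deriv φ x) +
        ∫ x, (-(c ^ 2 • (timeDeriv u t + nem f K hf h0 (toL2 (u t))))) x * φ x := by
    intro φ hφ t ht
    obtain ⟨A, hA⟩ := h.equation φ hφ
    obtain ⟨hA1, hA2⟩ := hA t ht.1
    refine ⟨A t, hA1.mono hsub, ?_, ?_⟩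
    · have h1 := (((h.hasDerivWithinAt ht.1).mono hsub).pairing hφ.deriv).neg
      refine h1.congr (fun s _ => ?_) ?_
      · rw [Pi.neg_apply, hasWeakDeriv_dx (u s) φ hφ, neg_neg]
      · rw [Pi.neg_apply, hasWeakDeriv_dx (u t) φ hφ, neg_neg]
    · rw [integral_neg_mul _ hφ, integral_smul_mul _ _ hφ, integral_add_mul _ _ hφ]
      have e : ∫ x, nem f K hf h0 (toL2 (u t)) x * φ x = ∫ x, deriv V (toL2 (u t) x) * φ x := by
        refine integral_congr_ae ?_
        filter_upwards [coeFn_nem hf h0 (toL2 (u t)), hfV t ht] with x h1 h2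
        rw [h1, h2]
      rw [e]
      linear_combination c ^ 2 * hA2 - A t * hαc
  refine ⟨fun t ht => ?_, ?_, ?_⟩
  · refine ((h.hasDerivWithinAt ht.1).mono hsub).congr_deriv ?_
    module
  · simp only [hforce]
    refine WeakTransport.charTransport (fun φ hφ t ht => ?_) (ct.add cxc) cG
    obtain ⟨A, h1, h2, h3⟩ := weak φ hφ t ht
    refine ((h1.add (h2.const_mul c)).congr (fun s _ => ?_) ?_).congr_deriv ?_
    · rw [integral_add_mul _ _ hφ, integral_smul_mul _ _ hφ]; rfl
    · rw [integral_add_mul _ _ hφ, integral_smul_mul _ _ hφ]; rfl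
    · rw [integral_add_mul _ _ hφ.deriv, integral_smul_mul _ _ hφ.deriv, h3]
      ring
  · simp only [hforce]
    refine WeakTransport.charTransport (fun φ hφ t ht => ?_) (ct.sub cxc) cG
    obtain ⟨A, h1, h2, h3⟩ := weak φ hφ t ht
    refine ((h1.sub (h2.const_mul c)).congr (fun s _ => ?_) ?_).congr_deriv ?_
    · rw [integral_sub_mul _ _ hφ, integral_smul_mul _ _ hφ]; rfl
    · rw [integral_sub_mul _ _ hφ, integral_smul_mul _ _ hφ]; rfl
    · rw [integral_sub_mul _ _ hφ.deriv, integral_smul_mul _ _ hφ.deriv, h3]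
      ring

theorem compat_of_H1ul {c : ℝ} (hc : 0 < c) (w : H1ul) (v : L2ul) :
    Compat c (toL2 w) (v + c • dx w) (v - c • dx w) := by
  have e : (1 / (2 * c)) • (v + c • dx w - (v - c • dx w)) = dx w := by
    rw [add_sub_sub_cancel, ← two_smul ℝ, smul_smul, smul_smul]
    have : 1 / (2 * c) * 2 * c = 1 := by field_simp
    rw [this, one_smul]
  rw [Compat, e]
  exact hasWeakDeriv_dx w

/-- The truncation may change with `T`: every requirement is local in time, and near `t` only the
system on `[0, t+1]` matters. -/
theorem isSolution_of_charSol {c : ℝ} (hc : 0 < c) (hαc : α * c ^ 2 = 1) {w p q : ℝ → L2ul}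
    (hw : ∀ t, 0 ≤ t → toL2 (u t) = w t) (hx : ∀ t, 0 ≤ t → dx (u t) = (1 / (2 * c)) • (p t - q t))
    (hsol : ∀ T, 0 < T → ∃ (f : ℝ → ℝ) (K : ℝ≥0) (hf : LipschitzWith K f) (h0 : f 0 = 0),
      CharSol c (c ^ 2) T (nem f K hf h0) w p q ∧
        ∀ t ∈ Icc 0 T, ∀ᵐ x, f (w t x) = deriv V (w t x)) :
    IsSolution α V (u 0) ((1 / 2 : ℝ) • (p 0 + q 0)) u := by
  have hnhds : ∀ t : ℝ, 0 ≤ t → Icc 0 (t + 1) ∈ 𝓝[Ici 0] t := fun t ht => by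
    rw [← Ici_inter_Iic]
    exact inter_mem_nhdsWithin _ (Iic_mem_nhds (by linarith))
  have hmem : ∀ t : ℝ, 0 ≤ t → t ∈ Icc 0 (t + 1) := fun t ht => ⟨ht, by linarith⟩
  have hd : ∀ t, 0 ≤ t →
      HasDerivWithinAt (fun s => toL2 (u s)) ((1 / 2 : ℝ) • (p t + q t)) (Ici 0) t := fun t ht => by
    obtain ⟨f, K, hf, h0, hs, -⟩ := hsol (t + 1) (by linarith)
    exact ((hs.du t (hmem t ht)).mono_of_mem_nhdsWithin (hnhds t ht)).congr
      (fun s hs => hw s hs) (hw t ht)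
  have htd : ∀ t, 0 ≤ t → timeDeriv u t = (1 / 2 : ℝ) • (p t + q t) := fun t ht =>
    (hd t ht).derivWithin (uniqueDiffOn_Ici 0 t ht)
  have cp : ContinuousOn p (Ici 0) := fun t ht => by
    obtain ⟨f, K, hf, h0, hs, -⟩ := hsol (t + 1) (by linarith [mem_Ici.1 ht])
    exact (hs.dp.continuousOn t (hmem t ht)).mono_of_mem_nhdsWithin (hnhds t ht)
  have cq : ContinuousOn q (Ici 0) := fun t ht => by
    obtain ⟨f, K, hf, h0, hs, -⟩ := hsol (t + 1) (by linarith [mem_Ici.1 ht])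
    exact (hs.dq.continuousOn t (hmem t ht)).mono_of_mem_nhdsWithin (hnhds t ht)
  refine ⟨?_, ?_, rfl, htd 0 le_rfl, fun φ hφ => ?_⟩
  · refine continuousOn_H1ul (fun t ht => (hd t ht).continuousWithinAt) ?_
    exact ((cp.sub cq).const_smul (1 / (2 * c))).congr fun t ht => hx t ht
  · rw [show (1 : WithTop ℕ∞) = 0 + 1 by norm_num,
      contDiffOn_succ_iff_derivWithin (uniqueDiffOn_Ici 0)]
    refine ⟨fun t ht => (hd t ht).differentiableWithinAt, by simp, ?_⟩
    rw [contDiffOn_zero]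
    exact ((cp.add cq).const_smul (1 / 2 : ℝ)).congr fun t ht => htd t ht
  · refine ⟨fun t => c ^ 2 * (-(∫ x, dx (u t) x * deriv φ x)
      - (∫ x, deriv V (toL2 (u t) x) * φ x) - ∫ x, timeDeriv u t x * φ x), fun t ht => ⟨?_, ?_⟩⟩
    · obtain ⟨f, K, hf, h0, hs, hfV⟩ := hsol (t + 1) (by linarith)
      have h1 := hs.dp.weakTransport φ hφ t (hmem t ht)
      have h2 := hs.dq.weakTransport φ hφ t (hmem t ht)
      have h3 := ((h1.add h2).const_mul (1 / 2 : ℝ)).mono_of_mem_nhdsWithin (hnhds t ht)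
      have hpair : ∀ s, 0 ≤ s → ∫ x, timeDeriv u s x * φ x
          = 1 / 2 * ((∫ x, p s x * φ x) + ∫ x, q s x * φ x) := fun s hs => by
        rw [htd s hs, integral_smul_mul _ _ hφ, integral_add_mul _ _ hφ]
      refine (h3.congr (fun s hs => hpair s hs) (hpair t ht)).congr_deriv ?_
      have e : ∫ x, nem f K hf h0 (w t) x * φ x = ∫ x, deriv V (toL2 (u t) x) * φ x := by
        rw [hw t ht]
        refine integral_congr_ae ?_
        filter_upwards [coeFn_nem hf h0 (w t), hfV t (hmem t ht)] with x h1 h2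
        rw [h1, h2]
      beta_reduce
      rw [force, integral_neg_mul _ hφ, integral_smul_mul _ _ hφ, ← htd t ht,
        integral_add_mul _ _ hφ, e, hx t ht, integral_smul_mul _ _ hφ.deriv,
        integral_sub_mul _ _ hφ.deriv]
      field_simp
      ring
    · linear_combination (-(∫ x, dx (u t) x * deriv φ x)
        - (∫ x, deriv V (toL2 (u t) x) * φ x) - ∫ x, timeDeriv u t x * φ x) * hαc

end Weak

/-! ### The potential energy -/

section Potential

variable {f F : ℝ → ℝ} {K : ℝ≥0} {a b m : ℝ}

/-- The Nemytskii operator of an admissible nonlinearity. -/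
def IsNonlin.N (h : IsNonlin f F K a b m) : L2ul → L2ul := nem f K h.lip h.zero

theorem IsNonlin.coeFn_N (h : IsNonlin f F K a b m) (u : L2ul) :
    (h.N u : ℝ → ℝ) =ᵐ[volume] fun x => f (u x) := coeFn_nem h.lip h.zero u

theorem IsNonlin.lipschitzWith_N (h : IsNonlin f F K a b m) : LipschitzWith K h.N :=
  lipschitzWith_nem h.lip h.zero

theorem IsNonlin.continuous_F (h : IsNonlin f F K a b m) : Continuous F :=
  continuous_iff_continuousAt.2 fun x => (h.hasDerivAt x).continuousAt

theorem IsNonlin.taylor (h : IsNonlin f F K a b m) (x y : ℝ) :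
    |F y - F x - f x * (y - x)| ≤ K * (y - x) ^ 2 := by
  have hd : ∀ z, HasDerivAt (fun z => F z - f x * z) (f z - f x) z := fun z =>
    ((h.hasDerivAt z).sub ((hasDerivAt_id z).const_mul (f x))).congr_deriv (by simp)
  have := (convex_uIcc x y).norm_image_sub_le_of_norm_hasDerivWithin_le
    (f := fun z => F z - f x * z) (C := K * |y - x|)
    (fun z _ => (hd z).hasDerivWithinAt) (fun z hz => (h.lip.norm_sub_le z x).trans ?_)
    left_mem_uIcc right_mem_uIcc
  · rw [Real.norm_eq_abs, Real.norm_eq_abs] at this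
    calc |F y - F x - f x * (y - x)| = |F y - f x * y - (F x - f x * x)| := by congr 1; ring
      _ ≤ _ := this
      _ = _ := by rw [mul_assoc, abs_mul_abs_self, sq]
  · exact mul_le_mul_of_nonneg_left (abs_sub_left_of_mem_uIcc hz) K.coe_nonneg

theorem IsNonlin.abs_F_le (h : IsNonlin f F K a b m) (x : ℝ) : |F x| ≤ K * x ^ 2 := by
  simpa [h.zero, h.prim_zero] using h.taylor 0 x

theorem IsNonlin.integrable_wt_F (h : IsNonlin f F K a b m) {κ : ℝ}
    (hκ : 0 < κ) (ξ : ℝ) (u : L2ul) :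
    Integrable fun x => wt κ ξ x * F (u x) := by
  refine ((integrable_wt_mul hκ ξ u u).const_mul (K : ℝ)).mono'
    ((continuous_wt κ ξ).aestronglyMeasurable.mul
      (h.continuous_F.comp_aestronglyMeasurable (aesm u))) (.of_forall fun x => ?_)
  rw [Real.norm_eq_abs, abs_mul, abs_of_pos (wt_pos _ _ _)]
  have := mul_le_mul_of_nonneg_left (h.abs_F_le (u x)) (wt_pos κ ξ x).le
  linarith

theorem IsNonlin.abs_potential_sub_le (h : IsNonlin f F K a b m) {κ : ℝ}
    (hκ : 0 < κ) (ξ : ℝ) (u v : L2ul) :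
    |(∫ x, wt κ ξ x * F (v x)) - (∫ x, wt κ ξ x * F (u x)) - J hκ ξ (h.N u) (v - u)|
      ≤ K * J hκ ξ (v - u) (v - u) := by
  have i1 := h.integrable_wt_F hκ ξ v
  have i2 := h.integrable_wt_F hκ ξ u
  have i3 := integrable_wt_mul hκ ξ (h.N u) (v - u)
  have i4 := integrable_wt_mul hκ ξ (v - u) (v - u)
  rw [J_apply, J_apply, ← integral_sub i1 i2, ← integral_sub (by exact i1.sub i2) i3,
    ← integral_const_mul]
  refine abs_integral_le_integral_abs.trans (integral_mono_ae
    ((i1.sub i2).sub i3).abs (i4.const_mul _) ?_)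
  filter_upwards [h.coeFn_N u, coeFn_sub v u] with x h1 h2
  simp only [h1, h2]
  have := mul_le_mul_of_nonneg_left (h.taylor (u x) (v x)) (wt_pos κ ξ x).le
  calc |wt κ ξ x * F (v x) - wt κ ξ x * F (u x) - wt κ ξ x * (f (u x) * (v x - u x))|
      = wt κ ξ x * |F (v x) - F (u x) - f (u x) * (v x - u x)| := by
        rw [← mul_sub, ← mul_sub, abs_mul, abs_of_pos (wt_pos _ _ _)]
    _ ≤ _ := this
    _ = _ := by ring

/-- As `f` is Lipschitz, `F` has a quadratic Taylor remainder, so the functional differs from its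
linearization by `O(‖u r - u s‖²)`, which is `o(r - s)`. The Lipschitz constant enters qualitatively
only and does not reach the energy estimate. -/
theorem IsNonlin.hasDerivWithinAt_potential (h : IsNonlin f F K a b m) {κ : ℝ}
    (hκ : 0 < κ) (ξ : ℝ) {u : ℝ → L2ul}
    {u' : L2ul} {S : Set ℝ} {s : ℝ} (hu : HasDerivWithinAt u u' S s) :
    HasDerivWithinAt (fun r => ∫ x, wt κ ξ x * F (u r x)) (J hκ ξ (h.N (u s)) u') S s := by
  have h1 : HasDerivWithinAt (fun r => J hκ ξ (h.N (u s)) (u r)) (J hκ ξ (h.N (u s)) u') S s :=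
    (J hκ ξ (h.N (u s))).hasFDerivAt.comp_hasDerivWithinAt s hu
  have h2 : HasDerivWithinAt (fun r => (∫ x, wt κ ξ x * F (u r x)) - J hκ ξ (h.N (u s)) (u r))
      0 S s := by
    rw [hasDerivWithinAt_iff_isLittleO]
    have hO : (fun r => u r - u s) =O[𝓝[S] s] fun r => r - s :=
      hu.hasFDerivWithinAt.isBigO_sub
    have ho : (fun r => u r - u s) =o[𝓝[S] s] fun _ => (1 : ℝ) := by
      rw [Asymptotics.isLittleO_one_iff]
      simpa using hu.continuousWithinAt.tendsto.sub_const (u s)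
    have hO2 : (fun r => (∫ x, wt κ ξ x * F (u r x)) - J hκ ξ (h.N (u s)) (u r)
        - ((∫ x, wt κ ξ x * F (u s x)) - J hκ ξ (h.N (u s)) (u s)) - (r - s) • (0 : ℝ))
        =O[𝓝[S] s] fun r => ‖u r - u s‖ * ‖u r - u s‖ := by
      refine Asymptotics.IsBigO.of_bound (K * wtC κ) (.of_forall fun r => ?_)
      have e := h.abs_potential_sub_le hκ ξ (u s) (u r)
      rw [map_sub] at e
      have e2 := (le_abs_self _).trans (abs_J_le hκ ξ (u r - u s) (u r - u s))
      rw [Real.norm_eq_abs, Real.norm_of_nonneg (by positivity), smul_zero, sub_zero]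
      calc _ = |(∫ x, wt κ ξ x * F (u r x)) - (∫ x, wt κ ξ x * F (u s x))
            - (J hκ ξ (h.N (u s)) (u r) - J hκ ξ (h.N (u s)) (u s))| := by congr 1; ring
        _ ≤ _ := e
        _ ≤ K * (wtC κ * (‖u r - u s‖ * ‖u r - u s‖)) := by gcongr
        _ = _ := by ring
    refine hO2.trans_isLittleO ?_
    have := ho.norm_left.mul_isBigO hO.norm_left
    simpa using this
  refine ((h2.add h1).congr (fun r _ => ?_) ?_).congr_deriv (zero_add _)
  · simp
  · simp

theorem IsNonlin.le_J_N (h : IsNonlin f F K a b m) {κ : ℝ}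
    (hκ : 0 < κ) (hb : 0 ≤ b) (ξ : ℝ) (u : L2ul) :
    a * J hκ ξ u u - b * wtC κ ≤ J hκ ξ u (h.N u) := by
  have i1 := integrable_wt_mul hκ ξ u u
  have h1 : a * J hκ ξ u u - b * ∫ x, wt κ ξ x ≤ J hκ ξ u (h.N u) := by
    rw [J_apply, J_apply, ← integral_const_mul, ← integral_const_mul,
      ← integral_sub (i1.const_mul _) ((integrable_wt hκ ξ).const_mul _)]
    refine integral_mono_ae ((i1.const_mul _).sub ((integrable_wt hκ ξ).const_mul _))
      (integrable_wt_mul hκ ξ u (h.N u)) ?_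
    filter_upwards [h.coeFn_N u] with x hx
    simp only [hx]
    have := mul_le_mul_of_nonneg_left (h.coercive (u x)) (wt_pos κ ξ x).le
    calc _ = wt κ ξ x * (a * u x ^ 2 - b) := by ring
      _ ≤ _ := this
  have := mul_le_mul_of_nonneg_left (integral_wt_le_wtC hκ.le ξ) hb
  linarith

theorem IsNonlin.potential_ge (h : IsNonlin f F K a b m) {κ : ℝ}
    (hκ : 0 < κ) (hm : 0 ≤ m) (ξ : ℝ) (u : L2ul) :
    -(m * wtC κ) ≤ ∫ x, wt κ ξ x * F (u x) := by
  have h1 : -(m * ∫ x, wt κ ξ x) ≤ ∫ x, wt κ ξ x * F (u x) := by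
    rw [← integral_const_mul, ← integral_neg]
    refine integral_mono ((integrable_wt hκ ξ).const_mul _).neg (h.integrable_wt_F hκ ξ u)
      fun x => ?_
    have := mul_le_mul_of_nonneg_left (h.lower (u x)) (wt_pos κ ξ x).le
    simp only
    linarith
  have := mul_le_mul_of_nonneg_left (integral_wt_le_wtC hκ.le ξ) hm
  linarith

end Potential

/-! ### The weighted energy -/

/-- A change of variables moves the translation onto the weight, which varies by a factor at most
`e^{κ|η|}`. This replaces integration by parts against the derivative of the weight. -/
theorem J_le_exp_mul_J_Tr {κ : ℝ} (hκ : 0 < κ) (ξ η : ℝ) (f : L2ul) :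
    J hκ ξ f f ≤ Real.exp (κ * |η|) * J hκ ξ (Tr η f) (Tr η f) := by
  rw [J_apply, J_apply, ← integral_const_mul,
    ← integral_sub_right_eq_self (fun x => wt κ ξ x * (f x * f x)) η]
  refine integral_mono_ae ((integrable_wt_mul hκ ξ f f).comp_sub_right η)
    ((integrable_wt_mul hκ ξ (Tr η f) (Tr η f)).const_mul _) ?_
  filter_upwards [coeFn_Tr η f] with x hx
  simp only [hx]
  have h1 : wt κ ξ (x - η) ≤ Real.exp (κ * |η|) * wt κ ξ x := by
    simpa using wt_le_exp_mul hκ.le ξ (x - η) x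
  have h2 := mul_le_mul_of_nonneg_right h1 (mul_self_nonneg (f (x - η)))
  linarith

/-- The weighted energy centred at `ξ`. -/
def energy {κ : ℝ} (hκ : 0 < κ) (α : ℝ) (F : ℝ → ℝ) (ξ : ℝ) (u p q : L2ul) : ℝ :=
  1 / 2 * J hκ ξ (α • p + (1 / 2 : ℝ) • u) (α • p + (1 / 2 : ℝ) • u)
    + 1 / 2 * J hκ ξ (α • q + (1 / 2 : ℝ) • u) (α • q + (1 / 2 : ℝ) • u)
    + 1 / 4 * J hκ ξ u u + 2 * α * ∫ x, wt κ ξ x * F (u x)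

/-- The weighted square norm centred at `ξ`. -/
def sqNorm {κ : ℝ} (hκ : 0 < κ) (ξ : ℝ) (u p q : L2ul) : ℝ :=
  J hκ ξ u u + J hκ ξ p p + J hκ ξ q q

theorem J_add_self_le {κ : ℝ} (hκ : 0 < κ) (ξ α : ℝ) (p u : L2ul) :
    J hκ ξ (α • p + (1 / 2 : ℝ) • u) (α • p + (1 / 2 : ℝ) • u)
      ≤ 2 * α ^ 2 * J hκ ξ p p + 1 / 2 * J hκ ξ u u := by
  have h := J_self_nonneg hκ ξ (α • p - (1 / 2 : ℝ) • u)
  simp only [map_add, map_sub, map_smul, add_apply, sub_apply, smul_apply,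
    smul_eq_mul] at h ⊢
  rw [J_comm hκ ξ u p] at *
  nlinarith

/-- The difference of the two sides is the form evaluated at `α p + u`. -/
theorem J_le_add_self {κ : ℝ} (hκ : 0 < κ) (ξ α : ℝ) (p u : L2ul) :
    α ^ 2 * J hκ ξ p p ≤ 2 * J hκ ξ (α • p + (1 / 2 : ℝ) • u) (α • p + (1 / 2 : ℝ) • u)
      + 1 / 2 * J hκ ξ u u := by
  have h := J_self_nonneg hκ ξ (α • p + u)
  simp only [map_add, map_smul, add_apply, smul_apply, smul_eq_mul] at h ⊢
  rw [J_comm hκ ξ u p] at *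
  nlinarith

/-- The left side is the formal derivative of the energy without the drift of the weight. The
coefficients of the energy are those for which the products of `p + q` with `u` and with `n` cancel,
leaving damping in `p`, `q` and the coercive term in `u`. -/
theorem energy_slope_identity {κ : ℝ} (hκ : 0 < κ) (ξ α : ℝ) (u p q n g v : L2ul)
    (hv : v = (1 / 2 : ℝ) • (p + q)) (hg : α • g = -(v + n)) :
    J hκ ξ (α • p + (1 / 2 : ℝ) • u) (α • g + (1 / 2 : ℝ) • q)
      + J hκ ξ (α • q + (1 / 2 : ℝ) • u) (α • g + (1 / 2 : ℝ) • p)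
      + 1 / 2 * J hκ ξ u v + 2 * α * J hκ ξ n v
      = -(α / 2 * (J hκ ξ p p + J hκ ξ q q)) - J hκ ξ u n := by
  rw [hg, hv]
  simp only [map_add, map_neg, map_smul, add_apply, smul_apply, smul_eq_mul]
  rw [J_comm hκ ξ q p, J_comm hκ ξ n p, J_comm hκ ξ n q]
  ring

theorem tendsto_slope_right {E : ℝ → ℝ} {E' T s : ℝ} (hs : s ∈ Ico 0 T)
    (h : HasDerivWithinAt E E' (Icc 0 T) s) : Tendsto (slope E s) (𝓝[>] s) (𝓝 E') := by
  have h1 : HasDerivWithinAt E E' (Ici s) s :=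
    h.mono_of_mem_nhdsWithin (mem_nhdsGE_of_mem_Ico hs)
  exact (hasDerivWithinAt_iff_tendsto_slope' self_notMem_Ioi).1 (hasDerivWithinAt_Ioi_iff_Ici.2 h1)

/-! ### Dissipation of the weighted energy -/

section Dissipation

variable {f F : ℝ → ℝ} {K : ℝ≥0} {a b m : ℝ}

/-- The energy inequality, in the form of a bound on the upper right Dini derivative. -/
theorem eventually_slope_energy_lt (h : IsNonlin f F K a b m) {κ : ℝ} (hκ : 0 < κ) (hb : 0 ≤ b)
    {α c T : ℝ} (hc : 0 < c) (hαc : α * c ^ 2 = 1) (hκ1 : κ * c * α ^ 2 ≤ α / 4)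
    (hκ2 : κ * c ≤ a) {u p q : ℝ → L2ul} (hsol : CharSol c (c ^ 2) T h.N u p q)
    (hcomp : ∀ t ∈ Icc 0 T, Compat c (u t) (p t) (q t)) (ξ : ℝ) {s : ℝ} (hs : s ∈ Ico 0 T)
    {r : ℝ} (hr : -(min (α / 4) (a / 2) * sqNorm hκ ξ (u s) (p s) (q s)) + b * wtC κ < r) :
    ∀ᶠ z in 𝓝[>] s, slope (fun t => energy hκ α F ξ (u t) (p t) (q t)) s z < r := by
  have hs' : s ∈ Icc 0 T := Ico_subset_Icc_self hs
  set G := force (c ^ 2) h.N (u s) (p s) (q s) with hG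
  set v : L2ul := (1 / 2 : ℝ) • (p s + q s) with hv
  have hαG : α • G = -(v + h.N (u s)) := by
    rw [hG, force, smul_neg, smul_smul, hαc, one_smul]
  -- the frozen curves
  have frozen : ∀ (l : ℝ) (w k : ℝ → L2ul), CharTransport l T w k →
      HasDerivWithinAt (fun t => Tr (l * (t - s)) (w t)) (k s) (Icc 0 T) s := fun l w k hw => by
    have h1 := (Tr (-(l * s))).toContinuousLinearMap.hasFDerivAt.comp_hasDerivWithinAt s (hw s hs')
    refine (h1.congr (fun t _ => ?_) ?_).congr_deriv ?_
    · simp only [Function.comp, LinearIsometry.coe_toContinuousLinearMap, Tr_Tr]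
      congr 2; ring
    · simp only [Function.comp, LinearIsometry.coe_toContinuousLinearMap, Tr_Tr]
      congr 2; ring
    · simp only [LinearIsometry.coe_toContinuousLinearMap, Tr_Tr]
      rw [neg_add_cancel, Tr_zero]
  have dup := frozen _ _ _ (hsol.charTransport_u_left hc hcomp)
  have duq := frozen _ _ _ (hsol.charTransport_u_right hc hcomp)
  have dp := (frozen _ _ _ hsol.dp).const_smul α |>.add (dup.const_smul (1 / 2 : ℝ))
  have dq := (frozen _ _ _ hsol.dq).const_smul α |>.add (duq.const_smul (1 / 2 : ℝ))
  set P : ℝ → L2ul := fun t => α • Tr (c * (t - s)) (p t) + (1 / 2 : ℝ) • Tr (c * (t - s)) (u t)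
    with hP
  set Q : ℝ → L2ul := fun t => α • Tr (-c * (t - s)) (q t)
    + (1 / 2 : ℝ) • Tr (-c * (t - s)) (u t) with hQ
  have dP : HasDerivWithinAt P (α • G + (1 / 2 : ℝ) • q s) (Icc 0 T) s := dp
  have dQ : HasDerivWithinAt Q (α • G + (1 / 2 : ℝ) • p s) (Icc 0 T) s := dq
  have hPs : P s = α • p s + (1 / 2 : ℝ) • u s := by simp [hP]
  have hQs : Q s = α • q s + (1 / 2 : ℝ) • u s := by simp [hQ]
  have dJ : ∀ {w : ℝ → L2ul} {w' : L2ul}, HasDerivWithinAt w w' (Icc 0 T) s →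
      HasDerivWithinAt (fun t => J hκ ξ (w t) (w t)) (2 * J hκ ξ (w s) w') (Icc 0 T) s :=
    fun {w w'} hw => by
    have h1 := (((J hκ ξ).hasFDerivAt.comp_hasDerivWithinAt s hw).clm_apply hw)
    refine h1.congr_deriv ?_
    rw [J_comm hκ ξ w' (w s)]
    simp only [Function.comp]
    ring
  -- The energy itself need not be differentiable, as `p` and `q` are so only along characteristics.
  -- This differentiable majorant touches it at `s` and lies above it afterwards, so its derivative
  -- bounds the upper right Dini derivative; the exponential pays for translating against the
  -- weight.
  set Ψ : ℝ → ℝ := fun t => Real.exp (κ * (c * (t - s))) * (1 / 2 * J hκ ξ (P t) (P t)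
    + 1 / 2 * J hκ ξ (Q t) (Q t)) + 1 / 4 * J hκ ξ (u t) (u t)
    + 2 * α * ∫ x, wt κ ξ x * F (u t x) with hΨ
  have dexp : HasDerivWithinAt (fun t => Real.exp (κ * (c * (t - s)))) (κ * c) (Icc 0 T) s := by
    have h1 : HasDerivAt (fun t => κ * (c * (t - s))) (κ * c) s := by
      have := (((hasDerivAt_id s).sub_const s).const_mul c).const_mul κ
      simpa using this
    have := h1.exp.hasDerivWithinAt (s := Icc 0 T)
    simpa using this
  have dΨ := ((dexp.mul (((dJ dP).const_mul (1 / 2)).add ((dJ dQ).const_mul (1 / 2)))).add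
    ((dJ (hsol.du s hs')).const_mul (1 / 4))).add
    ((h.hasDerivWithinAt_potential hκ ξ (hsol.du s hs')).const_mul (2 * α))
  have tΨ : Tendsto (slope Ψ s) (𝓝[>] s) (𝓝 _) := tendsto_slope_right hs dΨ
  have hle : ∀ z, s < z → energy hκ α F ξ (u z) (p z) (q z) ≤ Ψ z := fun z hz => by
    have k1 := J_le_exp_mul_J_Tr hκ ξ (c * (z - s)) (α • p z + (1 / 2 : ℝ) • u z)
    have k2 := J_le_exp_mul_J_Tr hκ ξ (-c * (z - s)) (α • q z + (1 / 2 : ℝ) • u z)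
    have hpos : 0 ≤ c * (z - s) := mul_nonneg hc.le (by linarith)
    rw [abs_of_nonneg hpos] at k1
    rw [neg_mul, abs_neg, abs_of_nonneg hpos, ← neg_mul] at k2
    have e1 : Tr (c * (z - s)) (α • p z + (1 / 2 : ℝ) • u z) = P z := by
      simp only [hP, map_add, map_smul]
    have e2 : Tr (-c * (z - s)) (α • q z + (1 / 2 : ℝ) • u z) = Q z := by
      simp only [hQ, map_add, map_smul]
    rw [e1] at k1
    rw [e2] at k2
    simp only [energy, hΨ]
    linarith
  have heq : energy hκ α F ξ (u s) (p s) (q s) = Ψ s := by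
    simp only [energy, hΨ, hPs, hQs, sub_self, mul_zero, Real.exp_zero, one_mul]
  have key := energy_slope_identity hκ ξ α (u s) (p s) (q s) (h.N (u s)) G v hv hαG
  have concl : ∀ L, Tendsto (slope Ψ s) (𝓝[>] s) (𝓝 L) → L < r →
      ∀ᶠ z in 𝓝[>] s, slope (fun t => energy hκ α F ξ (u t) (p t) (q t)) s z < r := by
    intro L hL hLr
    filter_upwards [hL.eventually_lt_const hLr, self_mem_nhdsWithin] with z hz hsz
    refine lt_of_le_of_lt ?_ hz
    rw [mem_Ioi] at hsz
    rw [slope_def_field, slope_def_field, heq]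
    have : 0 < z - s := by linarith
    gcongr
    exact hle z hsz
  refine concl _ tΨ (lt_of_le_of_lt ?_ hr)
  · simp only [Pi.add_apply, hPs, hQs, sub_self, mul_zero, Real.exp_zero, one_mul]
    rw [← hv]
    have b1 := J_add_self_le hκ ξ α (p s) (u s)
    have b2 := J_add_self_le hκ ξ α (q s) (u s)
    have b3 := h.le_J_N hκ hb ξ (u s)
    have n1 := J_self_nonneg hκ ξ (p s)
    have n2 := J_self_nonneg hκ ξ (q s)
    have n3 := J_self_nonneg hκ ξ (u s)
    have m1 := min_le_left (α / 4) (a / 2)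
    have m2 := min_le_right (α / 4) (a / 2)
    have hκc : 0 < κ * c := mul_pos hκ hc
    simp only [sqNorm]
    have c1 : min (α / 4) (a / 2) * (J hκ ξ (u s) (u s) + J hκ ξ (p s) (p s) + J hκ ξ (q s) (q s))
        ≤ a / 2 * J hκ ξ (u s) (u s) + α / 4 * (J hκ ξ (p s) (p s) + J hκ ξ (q s) (q s)) := by
      nlinarith
    -- The drift of the weight contributes half of this quantity; by the choice of `κ` it uses up at
    -- most half of the dissipation in `p`, `q` and in `u`.
    have c2 : κ * c * (J hκ ξ (α • p s + (1 / 2 : ℝ) • u s) (α • p s + (1 / 2 : ℝ) • u s)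
        + J hκ ξ (α • q s + (1 / 2 : ℝ) • u s) (α • q s + (1 / 2 : ℝ) • u s))
        ≤ κ * c * (2 * α ^ 2 * (J hκ ξ (p s) (p s) + J hκ ξ (q s) (q s)) + J hκ ξ (u s) (u s)) :=
      mul_le_mul_of_nonneg_left (by linarith) hκc.le
    have c3 := mul_le_mul_of_nonneg_right hκ1 (add_nonneg n1 n2)
    have c4 := mul_le_mul_of_nonneg_right hκ2 n3
    linarith

end Dissipation

/-! ### Bounds for the weighted energy -/

section EnergyBounds

variable {f F : ℝ → ℝ} {K : ℝ≥0} {a b m : ℝ}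

theorem sqNorm_nonneg {κ : ℝ} (hκ : 0 < κ) (ξ : ℝ) (u p q : L2ul) : 0 ≤ sqNorm hκ ξ u p q :=
  add_nonneg (add_nonneg (J_self_nonneg _ _ _) (J_self_nonneg _ _ _)) (J_self_nonneg _ _ _)

theorem IsNonlin.sqNorm_le_energy (h : IsNonlin f F K a b m) {κ : ℝ} (hκ : 0 < κ) (hm : 0 ≤ m)
    {α : ℝ} (hα : 0 < α) (ξ : ℝ) (u p q : L2ul) :
    sqNorm hκ ξ u p q
      ≤ (4 / α ^ 2 + 4) * (energy hκ α F ξ u p q + 2 * α * (m * wtC κ)) := by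
  have h1 := J_le_add_self hκ ξ α p u
  have h2 := J_le_add_self hκ ξ α q u
  have h3 := mul_le_mul_of_nonneg_left (h.potential_ge hκ hm ξ u) (by positivity : 0 ≤ 2 * α)
  have n1 := J_self_nonneg hκ ξ u
  have n2 := J_self_nonneg hκ ξ (α • p + (1 / 2 : ℝ) • u)
  have n3 := J_self_nonneg hκ ξ (α • q + (1 / 2 : ℝ) • u)
  set A := 1 / 2 * J hκ ξ (α • p + (1 / 2 : ℝ) • u) (α • p + (1 / 2 : ℝ) • u)
    + 1 / 2 * J hκ ξ (α • q + (1 / 2 : ℝ) • u) (α • q + (1 / 2 : ℝ) • u)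
    + 1 / 4 * J hκ ξ u u with hA
  have hE : A ≤ energy hκ α F ξ u p q + 2 * α * (m * wtC κ) := by
    simp only [energy]
    linarith
  have hu : J hκ ξ u u ≤ 4 * A := by linarith
  have hpq : J hκ ξ p p + J hκ ξ q q ≤ 4 / α ^ 2 * A := by
    rw [div_mul_eq_mul_div, le_div_iff₀ (by positivity)]
    linarith
  calc sqNorm hκ ξ u p q ≤ (4 / α ^ 2 + 4) * A := by
        simp only [sqNorm]
        linarith
    _ ≤ _ := by gcongr

theorem IsNonlin.energy_le (h : IsNonlin f F K a b m) {κ : ℝ} (hκ : 0 < κ) {α B : ℝ}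
    (hα : 0 < α) (ξ : ℝ) (u p q : L2ul) (hB : ∀ᵐ x, |F (u x)| ≤ B) :
    energy hκ α F ξ u p q
      ≤ wtC κ * (α ^ 2 * (‖p‖ ^ 2 + ‖q‖ ^ 2) + ‖u‖ ^ 2 + 2 * α * B) := by
  have hB0 : 0 ≤ B := by
    obtain ⟨x, hx⟩ := hB.exists
    exact (abs_nonneg _).trans hx
  have h1 := J_add_self_le hκ ξ α p u
  have h2 := J_add_self_le hκ ξ α q u
  have b1 := (le_abs_self _).trans (abs_J_le hκ ξ p p)
  have b2 := (le_abs_self _).trans (abs_J_le hκ ξ q q)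
  have b3 := (le_abs_self _).trans (abs_J_le hκ ξ u u)
  have n3 := J_self_nonneg hκ ξ u
  have hI : ∫ x, wt κ ξ x * F (u x) ≤ B * wtC κ := by
    refine le_trans (b := ∫ x, B * wt κ ξ x) (integral_mono_ae (h.integrable_wt_F hκ ξ u)
      ((integrable_wt hκ ξ).const_mul _) ?_) ?_
    · filter_upwards [hB] with x hx
      have := mul_le_mul_of_nonneg_left ((le_abs_self _).trans hx) (wt_pos κ ξ x).le
      linarith
    · rw [integral_const_mul]
      exact mul_le_mul_of_nonneg_left (integral_wt_le_wtC hκ.le ξ) hB0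
  have c1 := mul_le_mul_of_nonneg_left b1 (sq_nonneg α)
  have c2 := mul_le_mul_of_nonneg_left b2 (sq_nonneg α)
  have c3 := mul_le_mul_of_nonneg_left hI (by positivity : 0 ≤ 2 * α)
  simp only [energy]
  nlinarith

theorem norm_sq_le_of_sqNorm {κ : ℝ} (hκ : 0 < κ) {u p q : L2ul} {B : ℝ}
    (h : ∀ ξ, sqNorm hκ ξ u p q ≤ B) :
    ‖u‖ ^ 2 ≤ Real.exp κ * B ∧ ‖p‖ ^ 2 ≤ Real.exp κ * B ∧ ‖q‖ ^ 2 ≤ Real.exp κ * B := by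
  refine ⟨norm_sq_le_of_J hκ fun ξ => le_trans ?_ (h ξ),
    norm_sq_le_of_J hκ fun ξ => le_trans ?_ (h ξ),
    norm_sq_le_of_J hκ fun ξ => le_trans ?_ (h ξ)⟩ <;>
  · have n1 := J_self_nonneg hκ ξ u
    have n2 := J_self_nonneg hκ ξ p
    have n3 := J_self_nonneg hκ ξ q
    simp only [sqNorm]
    linarith

theorem abs_J_self_sub_le {κ : ℝ} (hκ : 0 < κ) (ξ : ℝ) (f g : L2ul) :
    |J hκ ξ f f - J hκ ξ g g| ≤ wtC κ * ((‖f‖ + ‖g‖) * ‖f - g‖) := by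
  have e : J hκ ξ f f - J hκ ξ g g = J hκ ξ (f - g) f + J hκ ξ g (f - g) := by
    simp only [map_sub, sub_apply]
    ring
  rw [e]
  refine (abs_add_le _ _).trans ((add_le_add (abs_J_le _ _ _ _) (abs_J_le _ _ _ _)).trans ?_)
  exact le_of_eq (by ring)

/-- The energy is continuous in time, uniformly with respect to the centre of the weight. -/
theorem IsNonlin.exists_energy_modulus (h : IsNonlin f F K a b m) {κ : ℝ} (hκ : 0 < κ) {α : ℝ}
    (hα : 0 < α) {u p q : ℝ → L2ul} {S : Set ℝ} {s : ℝ} (hu : ContinuousWithinAt u S s)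
    (hp : ContinuousWithinAt p S s) (hq : ContinuousWithinAt q S s) :
    ∃ η : ℝ → ℝ, Tendsto η (𝓝[S] s) (𝓝 0) ∧ ∀ ξ r,
      |energy hκ α F ξ (u r) (p r) (q r) - energy hκ α F ξ (u s) (p s) (q s)| ≤ η r := by
  have tmod : ∀ w : ℝ → L2ul, ContinuousWithinAt w S s →
      Tendsto (fun r => wtC κ * ((‖w r‖ + ‖w s‖) * ‖w r - w s‖)) (𝓝[S] s) (𝓝 0) :=
    fun w hw => by
    have t1 := tendsto_iff_norm_sub_tendsto_zero.1 hw.tendsto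
    simpa using ((hw.tendsto.norm.add_const ‖w s‖).mul t1).const_mul (wtC κ)
  have t0 := tendsto_iff_norm_sub_tendsto_zero.1 hu.tendsto
  have hP : ContinuousWithinAt (fun r => α • p r + (1 / 2 : ℝ) • u r) S s :=
    (hp.const_smul α).add (hu.const_smul (1 / 2 : ℝ))
  have hQ : ContinuousWithinAt (fun r => α • q r + (1 / 2 : ℝ) • u r) S s :=
    (hq.const_smul α).add (hu.const_smul (1 / 2 : ℝ))
  have tI : Tendsto (fun r => K * (wtC κ * (‖u r - u s‖ * ‖u r - u s‖))
      + wtC κ * (‖h.N (u s)‖ * ‖u r - u s‖)) (𝓝[S] s) (𝓝 0) := by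
    simpa using (((t0.mul t0).const_mul (wtC κ)).const_mul (K : ℝ)).add
      ((t0.const_mul ‖h.N (u s)‖).const_mul (wtC κ))
  have tall := ((((tmod _ hP).const_mul (1 / 2)).add ((tmod _ hQ).const_mul (1 / 2))).add
    ((tmod _ hu).const_mul (1 / 4))).add (tI.const_mul (2 * α))
  rw [mul_zero, mul_zero, mul_zero, add_zero, add_zero, add_zero] at tall
  refine ⟨_, tall, fun ξ r => ?_⟩
  have e1 := abs_le.1 (abs_J_self_sub_le hκ ξ (α • p r + (1 / 2 : ℝ) • u r)
    (α • p s + (1 / 2 : ℝ) • u s))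
  have e2 := abs_le.1 (abs_J_self_sub_le hκ ξ (α • q r + (1 / 2 : ℝ) • u r)
    (α • q s + (1 / 2 : ℝ) • u s))
  have e3 := abs_le.1 (abs_J_self_sub_le hκ ξ (u r) (u s))
  have e4 : |(∫ x, wt κ ξ x * F (u r x)) - ∫ x, wt κ ξ x * F (u s x)|
      ≤ K * (wtC κ * (‖u r - u s‖ * ‖u r - u s‖)) + wtC κ * (‖h.N (u s)‖ * ‖u r - u s‖) := by
    have k1 := h.abs_potential_sub_le hκ ξ (u s) (u r)
    have k2 := abs_J_le hκ ξ (h.N (u s)) (u r - u s)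
    have k3 := mul_le_mul_of_nonneg_left
      ((le_abs_self _).trans (abs_J_le hκ ξ (u r - u s) (u r - u s))) K.coe_nonneg
    have k1' := abs_le.1 k1
    have k2' := abs_le.1 k2
    exact abs_le.2 ⟨by linarith, by linarith⟩
  have e4' := abs_le.1 e4
  have l1 := mul_le_mul_of_nonneg_left e4'.1 (by positivity : 0 ≤ 2 * α)
  have l2 := mul_le_mul_of_nonneg_left e4'.2 (by positivity : 0 ≤ 2 * α)
  simp only [energy]
  exact abs_le.2 ⟨by linarith, by linarith⟩

theorem IsNonlin.continuousWithinAt_energy (h : IsNonlin f F K a b m) {κ : ℝ} (hκ : 0 < κ) {α : ℝ}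
    (hα : 0 < α) {u p q : ℝ → L2ul} {S : Set ℝ} {s : ℝ} (hu : ContinuousWithinAt u S s)
    (hp : ContinuousWithinAt p S s) (hq : ContinuousWithinAt q S s) (ξ : ℝ) :
    ContinuousWithinAt (fun r => energy hκ α F ξ (u r) (p r) (q r)) S s := by
  obtain ⟨η, hη, hb⟩ := h.exists_energy_modulus hκ hα hu hp hq
  rw [ContinuousWithinAt, tendsto_iff_norm_sub_tendsto_zero]
  exact squeeze_zero (fun _ => norm_nonneg _) (fun r => hb ξ r) hη

/-- The decay rate of the weight is taken so small that its drift at speed `c` is absorbed by the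
damping and by the coercivity. -/
theorem exists_rate {α c a : ℝ} (hα : 0 < α) (hc : 0 < c) (ha : 0 < a) :
    ∃ κ : ℝ, 0 < κ ∧ κ * c * α ^ 2 ≤ α / 4 ∧ κ * c ≤ a := by
  refine ⟨min (1 / (4 * c * α)) (a / c), lt_min (by positivity) (by positivity), ?_, ?_⟩
  · calc min (1 / (4 * c * α)) (a / c) * c * α ^ 2 ≤ 1 / (4 * c * α) * c * α ^ 2 := by
          gcongr
          exact min_le_left _ _
      _ = α / 4 := by field_simp
  · calc min (1 / (4 * c * α)) (a / c) * c ≤ a / c * c := by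
          gcongr
          exact min_le_right _ _
      _ = a := by field_simp

theorem CharSol.continuousOn_u {c γ T : ℝ} {N : L2ul → L2ul} {u p q : ℝ → L2ul}
    (h : CharSol c γ T N u p q) : ContinuousOn u (Icc 0 T) :=
  fun t ht => (h.du t ht).continuousWithinAt

/-- Dropping the dissipation leaves growth at the constant rate `b wtC κ`, uniformly in the centre.
-/
theorem IsNonlin.energy_le_add (h : IsNonlin f F K a b m) {κ : ℝ} (hκ : 0 < κ) (ha : 0 < a)
    (hb : 0 ≤ b) {α c T : ℝ} (hc : 0 < c) (hα : 0 < α) (hαc : α * c ^ 2 = 1)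
    (hκ1 : κ * c * α ^ 2 ≤ α / 4) (hκ2 : κ * c ≤ a) {u p q : ℝ → L2ul}
    (hsol : CharSol c (c ^ 2) T h.N u p q) (h0 : Compat c (u 0) (p 0) (q 0)) (ξ : ℝ) :
    ∀ t ∈ Icc 0 T, energy hκ α F ξ (u t) (p t) (q t)
      ≤ energy hκ α F ξ (u 0) (p 0) (q 0) + b * wtC κ * t := by
  have hd : ∀ x, HasDerivAt (fun t => energy hκ α F ξ (u 0) (p 0) (q 0) + b * wtC κ * t)
      (b * wtC κ) x := fun x => by
    simpa using ((hasDerivAt_id x).const_mul (b * wtC κ)).const_add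
      (energy hκ α F ξ (u 0) (p 0) (q 0))
  refine image_le_of_liminf_slope_right_le_deriv_boundary
    (fun t ht => h.continuousWithinAt_energy hκ hα (hsol.continuousOn_u t ht)
      (hsol.dp.continuousOn t ht) (hsol.dq.continuousOn t ht) ξ) (by simp)
    (fun x _ => (hd x).continuousAt.continuousWithinAt) (fun x _ => (hd x).hasDerivWithinAt)
    fun s hs r hr => (eventually_slope_energy_lt h hκ hb hc hαc hκ1 hκ2 hsol
      (hsol.compat hc h0) ξ hs (lt_of_le_of_lt ?_ hr)).frequently
  have : 0 ≤ min (α / 4) (a / 2) * sqNorm hκ ξ (u s) (p s) (q s) :=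
    mul_nonneg (le_min (by positivity) (by positivity)) (sqNorm_nonneg _ _ _ _ _)
  linarith

end EnergyBounds

/-- A priori bound on bounded time intervals, independent of the Lipschitz constant of the
nonlinearity. -/
theorem exists_apriori_bound {α c a b m : ℝ} (hα : 0 < α) (hc : 0 < c) (hαc : α * c ^ 2 = 1)
    (ha : 0 < a) (hb : 0 ≤ b) (hm : 0 ≤ m) (M B T : ℝ) :
    ∃ M' : ℝ, 0 ≤ M' ∧ ∀ {f F : ℝ → ℝ} {K : ℝ≥0} (h : IsNonlin f F K a b m) {T' : ℝ}
      {u p q : ℝ → L2ul}, T' ≤ T → CharSol c (c ^ 2) T' h.N u p q → Compat c (u 0) (p 0) (q 0) →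
      ‖u 0‖ ≤ M → ‖p 0‖ ≤ M → ‖q 0‖ ≤ M → (∀ᵐ x, |F (u 0 x)| ≤ B) →
      ∀ t ∈ Icc 0 T', ‖u t‖ ≤ M' ∧ ‖p t‖ ≤ M' ∧ ‖q t‖ ≤ M' := by
  obtain ⟨κ, hκ, hκ1, hκ2⟩ := exists_rate hα hc ha
  have hW := wtC_nonneg κ
  set E₀ := wtC κ * (α ^ 2 * (M ^ 2 + M ^ 2) + M ^ 2 + 2 * α * B) + b * wtC κ * T with hE₀
  set D := Real.exp κ * ((4 / α ^ 2 + 4) * (E₀ + 2 * α * (m * wtC κ))) with hD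
  refine ⟨Real.sqrt D, Real.sqrt_nonneg _, ?_⟩
  intro f F K h T' u p q hT hsol h0 hu hp hq hB t ht
  have hmain : ∀ ξ, sqNorm hκ ξ (u t) (p t) (q t)
      ≤ (4 / α ^ 2 + 4) * (E₀ + 2 * α * (m * wtC κ)) := fun ξ => by
    refine (h.sqNorm_le_energy hκ hm hα ξ _ _ _).trans ?_
    gcongr
    refine (h.energy_le_add hκ ha hb hc hα hαc hκ1 hκ2 hsol h0 ξ t ht).trans ?_
    have e := h.energy_le hκ hα ξ (u 0) (p 0) (q 0) hB
    have ht' : b * wtC κ * t ≤ b * wtC κ * T := by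
      gcongr
      exact ht.2.trans hT
    have e2 : wtC κ * (α ^ 2 * (‖p 0‖ ^ 2 + ‖q 0‖ ^ 2) + ‖u 0‖ ^ 2 + 2 * α * B)
        ≤ wtC κ * (α ^ 2 * (M ^ 2 + M ^ 2) + M ^ 2 + 2 * α * B) := by gcongr
    linarith
  obtain ⟨h1, h2, h3⟩ := norm_sq_le_of_sqNorm hκ hmain
  exact ⟨Real.le_sqrt_of_sq_le h1, Real.le_sqrt_of_sq_le h2, Real.le_sqrt_of_sq_le h3⟩

/-! ### Well-posedness -/

/-- `V` coincides on arbitrarily large intervals with potentials having Lipschitz derivative and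
satisfying uniform coercivity bounds. -/
structure HasTruncations (V : ℝ → ℝ) (a b m R₁ : ℝ) : Prop where
  a_pos : 0 < a
  b_pos : 0 < b
  m_pos : 0 < m
  continuous : Continuous V
  exists_isNonlin : ∀ R, R₁ ≤ R → ∃ (f F : ℝ → ℝ) (K : ℝ≥0), IsNonlin f F K a b m ∧
    ∀ u, |u| ≤ R → f u = deriv V u ∧ F u = V u

theorem IsBistable.hasTruncations {V : ℝ → ℝ} (hV : IsBistable V) :
    ∃ a b m R₁ : ℝ, HasTruncations V a b m R₁ := by
  obtain ⟨a, b, m, R₁, ha, hb, hm, h⟩ := hV.exists_truncation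
  exact ⟨a, b, m, R₁, ha, hb, hm, hV.contDiff.continuous, h⟩

theorem ae_abs_le_of_norm_le {u : H1ul} {B : ℝ} (hB : ‖u‖ ≤ B) : ∀ᵐ x, |toL2 u x| ≤ 2 * B := by
  filter_upwards [ae_sq_le_norm_sq u] with x hx
  have h0 := norm_nonneg u
  exact abs_le_of_sq_le_sq (by nlinarith) (by linarith)

theorem exists_abs_le_of_abs_le {V : ℝ → ℝ} (hV : Continuous V) (r : ℝ) :
    ∃ B, 0 ≤ B ∧ ∀ u, |u| ≤ r → |V u| ≤ B := by
  obtain ⟨B, hB⟩ := (isCompact_Icc (a := -r) (b := r)).exists_bound_of_continuousOn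
    hV.continuousOn
  exact ⟨max B 0, le_max_right _ _, fun u hu => (hB u (abs_le.1 hu)).trans (le_max_left _ _)⟩

theorem norm_dx_coord_le {c : ℝ} (hc : 0 < c) {p q : L2ul} {M : ℝ} (hp : ‖p‖ ≤ M) (hq : ‖q‖ ≤ M) :
    ‖(1 / (2 * c)) • (p - q)‖ ≤ M / c := by
  rw [norm_smul, Real.norm_of_nonneg (by positivity)]
  calc 1 / (2 * c) * ‖p - q‖ ≤ 1 / (2 * c) * (M + M) := by
        gcongr
        exact (norm_sub_le _ _).trans (add_le_add hp hq)
    _ = M / c := by field_simp; ring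

theorem norm_add_smul_le {c : ℝ} (hc : 0 < c) {v g : L2ul} {M : ℝ} (hv : ‖v‖ ≤ M) (hg : ‖g‖ ≤ M) :
    ‖v + c • g‖ ≤ (1 + c) * M ∧ ‖v - c • g‖ ≤ (1 + c) * M := by
  have h : ‖c • g‖ ≤ c * M := by
    rw [norm_smul, Real.norm_of_nonneg hc.le]
    gcongr
  exact ⟨(norm_add_le _ _).trans (by linarith), (norm_sub_le _ _).trans (by linarith)⟩

section WellPosed

variable {α c a b m R₁ : ℝ} {V : ℝ → ℝ}

/-- The bound is fixed before the truncation level. Any level above it makes the truncation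
invisible to the solution; it is also large enough (at least `2M`) for the initial potential energy
to be computed with `V`. -/
theorem HasTruncations.exists_bound (hV : HasTruncations V a b m R₁) (hα : 0 < α) (hc : 0 < c)
    (hαc : α * c ^ 2 = 1) (M T : ℝ) :
    ∃ B : ℝ, 0 ≤ B ∧ ∀ {f F : ℝ → ℝ} {K : ℝ≥0} (h : IsNonlin f F K a b m) {R : ℝ}, B ≤ R →
      (∀ u, |u| ≤ R → F u = V u) → ∀ {T' : ℝ} {u p q : ℝ → L2ul}, T' ≤ T →
      CharSol c (c ^ 2) T' h.N u p q → ∀ (w : H1ul) (v : L2ul), u 0 = toL2 w →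
      p 0 = v + c • dx w → q 0 = v - c • dx w → ‖w‖ ≤ M → ‖v‖ ≤ M →
      ∀ t ∈ Icc 0 T', ∀ᵐ x, |u t x| ≤ B := by
  obtain ⟨BV, -, hBV⟩ := exists_abs_le_of_abs_le hV.continuous (2 * M)
  obtain ⟨M', hM'0, hM'⟩ := exists_apriori_bound hα hc hαc hV.a_pos hV.b_pos.le hV.m_pos.le
    ((1 + c) * M) BV T
  refine ⟨max (2 * M) (2 * (M' + M' / c)), le_max_of_le_right (by positivity), ?_⟩
  intro f F K h R hR hFV T' u p q hT hsol w v hu hp hq hw hv t ht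
  have hM : 0 ≤ M := (norm_nonneg _).trans hw
  have hcomp0 : Compat c (u 0) (p 0) (q 0) := by
    rw [hu, hp, hq]
    exact compat_of_H1ul hc w v
  obtain ⟨n1, n2⟩ := norm_add_smul_le hc hv ((norm_dx_le w).trans hw)
  obtain ⟨k1, k2, k3⟩ := hM' h hT hsol hcomp0
    (by rw [hu]; exact ((norm_toL2_le w).trans hw).trans (by nlinarith))
    (by rwa [hp]) (by rwa [hq])
    (by
      rw [hu]
      filter_upwards [ae_abs_le_of_norm_le hw] with x hx
      rw [hFV _ (hx.trans ((le_max_left _ _).trans hR))]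
      exact hBV _ hx) t ht
  have k4 : ‖mkH1 _ _ (hsol.compat hc hcomp0 t ht)‖ ≤ M' + M' / c :=
    (norm_H1ul_le _).trans (add_le_add k1 (norm_dx_coord_le hc k2 k3))
  filter_upwards [ae_abs_le_of_norm_le k4] with x hx
  exact hx.trans (le_max_right _ _)

/-- An `L^∞` bound for solutions on bounded time intervals, in terms of the size of the data. -/
theorem HasTruncations.exists_bound_solution (hV : HasTruncations V a b m R₁) (hα : 0 < α)
    (hc : 0 < c) (hαc : α * c ^ 2 = 1) (M T : ℝ) :
    ∃ B : ℝ, ∀ (w : H1ul) (v : L2ul) (u : ℝ → H1ul), IsSolution α V w v u → ‖w‖ ≤ M → ‖v‖ ≤ M →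
      ∀ t ∈ Icc 0 T, ∀ᵐ x, |toL2 (u t) x| ≤ B := by
  obtain ⟨B, -, hB⟩ := hV.exists_bound hα hc hαc M T
  refine ⟨B, fun w v u h hw hv => ?_⟩
  -- This bound depends on the individual solution and only serves to choose a level at which it
  -- solves the truncated system; the estimate then returns `B`, which does not depend on it.
  obtain ⟨C, hC⟩ := isCompact_Icc.exists_bound_of_continuousOn
    (h.continuousOn.mono (fun t ht => ht.1 : Icc 0 T ⊆ Ici 0))
  obtain ⟨f, F, K, hN, hfV⟩ := hV.exists_isNonlin (max R₁ (max B (2 * C))) (le_max_left _ _)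
  have hsol := CharSol.of_isSolution h hαc hN.lip hN.zero (T := T) fun t ht => by
    filter_upwards [ae_abs_le_of_norm_le (hC t ht)] with x hx
    exact (hfV _ (hx.trans ((le_max_right _ _).trans (le_max_right _ _)))).1
  exact hB hN ((le_max_left _ _).trans (le_max_right _ _)) (fun u hu => (hfV u hu).2) le_rfl
    hsol w v (by rw [h.initial]) (by rw [h.initial, h.initial_timeDeriv])
    (by rw [h.initial, h.initial_timeDeriv]) hw hv

/-- Solutions depend in a Lipschitz way on data in a bounded set. -/
theorem HasTruncations.exists_lipschitz_bound (hV : HasTruncations V a b m R₁) (hα : 0 < α)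
    (hc : 0 < c) (hαc : α * c ^ 2 = 1) (M T : ℝ) :
    ∃ L : ℝ, 0 ≤ L ∧ ∀ (w w' : H1ul) (v v' : L2ul) (u u' : ℝ → H1ul), IsSolution α V w v u →
      IsSolution α V w' v' u' → ‖w‖ ≤ M → ‖v‖ ≤ M → ‖w'‖ ≤ M → ‖v'‖ ≤ M →
      ∀ δ : ℝ, ‖w - w'‖ ≤ δ → ‖v - v'‖ ≤ δ → ∀ t ∈ Icc 0 T,
        ‖u t - u' t‖ ≤ L * δ ∧ ‖timeDeriv u t - timeDeriv u' t‖ ≤ L * δ := by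
  obtain ⟨B, hB⟩ := hV.exists_bound_solution hα hc hαc M T
  obtain ⟨f, F, K, hN, hfV⟩ := hV.exists_isNonlin (max R₁ B) (le_max_left _ _)
  set E := (1 + c) * Real.exp ((1 + |c ^ 2| * (1 + K)) * T) with hE
  have hE0 : 0 ≤ E := by positivity
  refine ⟨E + E / c, by positivity, ?_⟩
  intro w w' v v' u u' h h' hw hv hw' hv' δ hwδ hvδ t ht
  have hδ : 0 ≤ δ := (norm_nonneg _).trans hwδ
  have hs := CharSol.of_isSolution h hαc hN.lip hN.zero (T := T) fun t ht => by
    filter_upwards [hB w v u h hw hv t ht] with x hx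
    exact (hfV _ (hx.trans (le_max_right _ _))).1
  have hs' := CharSol.of_isSolution h' hαc hN.lip hN.zero (T := T) fun t ht => by
    filter_upwards [hB w' v' u' h' hw' hv' t ht] with x hx
    exact (hfV _ (hx.trans (le_max_right _ _))).1
  have hdx : ‖dx w - dx w'‖ ≤ δ := by
    rw [← dx_sub]
    exact (norm_dx_le _).trans hwδ
  obtain ⟨n1, n2⟩ := norm_add_smul_le hc hvδ hdx
  have e1 : ∀ (x x' y y' : L2ul), x + c • y - (x' + c • y') = x - x' + c • (y - y') :=
    fun x x' y y' => by module
  have e2 : ∀ (x x' y y' : L2ul), x - c • y - (x' - c • y') = x - x' - c • (y - y') :=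
    fun x x' y y' => by module
  obtain ⟨k1, k2, k3⟩ := hs.norm_sub_le hN.lipschitzWith_N hs' (δ := (1 + c) * δ)
    (by
      simp only [h.initial, h'.initial]
      rw [← toL2_sub]
      exact ((norm_toL2_le _).trans hwδ).trans (by nlinarith))
    (by simpa only [h.initial, h'.initial, h.initial_timeDeriv, h'.initial_timeDeriv, e1] using n1)
    (by simpa only [h.initial, h'.initial, h.initial_timeDeriv, h'.initial_timeDeriv, e2] using n2)
    t ht
  simp only [e1, e2, ← toL2_sub, ← dx_sub] at k1 k2 k3
  have hexp : (1 + c) * δ * Real.exp ((1 + |c ^ 2| * (1 + K)) * t) ≤ E * δ := by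
    have : Real.exp ((1 + |c ^ 2| * (1 + K)) * t) ≤ Real.exp ((1 + |c ^ 2| * (1 + K)) * T) := by
      gcongr
      exact ht.2
    calc _ ≤ (1 + c) * δ * Real.exp ((1 + |c ^ 2| * (1 + K)) * T) := by gcongr
      _ = E * δ := by rw [hE]; ring
  replace k1 := k1.trans hexp
  replace k2 := k2.trans hexp
  replace k3 := k3.trans hexp
  have m1 := norm_dx_coord_le hc k2 k3
  have m2 := norm_half_add_le k2 k3
  rw [show (1 / (2 * c)) • (timeDeriv u t - timeDeriv u' t + c • dx (u t - u' t)
      - (timeDeriv u t - timeDeriv u' t - c • dx (u t - u' t))) = dx (u t - u' t) by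
    rw [add_sub_sub_cancel, ← two_smul ℝ, smul_smul, smul_smul,
      show 1 / (2 * c) * 2 * c = 1 by field_simp, one_smul]] at m1
  rw [show (1 / 2 : ℝ) • (timeDeriv u t - timeDeriv u' t + c • dx (u t - u' t)
      + (timeDeriv u t - timeDeriv u' t - c • dx (u t - u' t)))
      = timeDeriv u t - timeDeriv u' t by module] at m2
  refine ⟨(norm_H1ul_le _).trans ((add_le_add k1 m1).trans (le_of_eq (by ring))), m2.trans ?_⟩
  have : 0 ≤ E / c * δ := by positivity
  linarith

theorem HasTruncations.solution_unique (hV : HasTruncations V a b m R₁) (hα : 0 < α) (hc : 0 < c)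
    (hαc : α * c ^ 2 = 1) {w : H1ul} {v : L2ul} {u u' : ℝ → H1ul} (h : IsSolution α V w v u)
    (h' : IsSolution α V w v u') : EqOn u u' (Ici 0) := fun t ht => by
  obtain ⟨L, -, hL⟩ := hV.exists_lipschitz_bound hα hc hαc (max ‖w‖ ‖v‖) t
  have := (hL w w v v u u' h h' (le_max_left _ _) (le_max_right _ _) (le_max_left _ _)
    (le_max_right _ _) 0 (by simp) (by simp) t ⟨ht, le_rfl⟩).1
  rw [mul_zero] at this
  exact sub_eq_zero.1 (norm_le_zero_iff.1 this)

theorem HasTruncations.continuous_dependence (hV : HasTruncations V a b m R₁) (hα : 0 < α)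
    (hc : 0 < c) (hαc : α * c ^ 2 = 1) {u₀ : H1ul} {u₁ : L2ul} {u : ℝ → H1ul}
    (h : IsSolution α V u₀ u₁ u) (T : ℝ) {ε : ℝ} (hε : 0 < ε) :
    ∃ δ : ℝ, 0 < δ ∧ ∀ (v₀ : H1ul) (v₁ : L2ul) (v : ℝ → H1ul), IsSolution α V v₀ v₁ v →
      ‖v₀ - u₀‖ ^ 2 + ‖v₁ - u₁‖ ^ 2 < δ ^ 2 →
      ∀ t ∈ Icc 0 T, ‖v t - u t‖ ^ 2 + ‖timeDeriv v t - timeDeriv u t‖ ^ 2 < ε ^ 2 := by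
  obtain ⟨L, hL0, hL⟩ := hV.exists_lipschitz_bound hα hc hαc (max ‖u₀‖ ‖u₁‖ + 1) T
  -- The bound `1` keeps the perturbed data in the ball where `L` is valid; the other makes each of
  -- the two norms at most `ε/2`.
  refine ⟨min 1 (ε / (2 * (L + 1))), by positivity, ?_⟩
  intro v₀ v₁ v hv hd t ht
  set δ := min 1 (ε / (2 * (L + 1))) with hδ
  have hδ0 : 0 ≤ δ := by positivity
  have d1 : ‖v₀ - u₀‖ ≤ δ := le_of_sq_le_sq (by nlinarith [sq_nonneg ‖v₁ - u₁‖]) hδ0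
  have d2 : ‖v₁ - u₁‖ ≤ δ := le_of_sq_le_sq (by nlinarith [sq_nonneg ‖v₀ - u₀‖]) hδ0
  have hδ1 : δ ≤ 1 := min_le_left _ _
  have n1 : ‖v₀‖ ≤ max ‖u₀‖ ‖u₁‖ + 1 := by
    have := norm_le_norm_add_norm_sub' v₀ u₀
    linarith [le_max_left ‖u₀‖ ‖u₁‖]
  have n2 : ‖v₁‖ ≤ max ‖u₀‖ ‖u₁‖ + 1 := by
    have := norm_le_norm_add_norm_sub' v₁ u₁
    linarith [le_max_right ‖u₀‖ ‖u₁‖]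
  obtain ⟨k1, k2⟩ := hL v₀ u₀ v₁ u₁ v u hv h n1 n2 (by linarith [le_max_left ‖u₀‖ ‖u₁‖])
    (by linarith [le_max_right ‖u₀‖ ‖u₁‖]) δ d1 d2 t ht
  have hLδ : L * δ ≤ ε / 2 := by
    have : δ ≤ ε / (2 * (L + 1)) := min_le_right _ _
    calc L * δ ≤ (L + 1) * (ε / (2 * (L + 1))) := by gcongr; linarith
      _ = ε / 2 := by field_simp
  have s1 := pow_le_pow_left₀ (norm_nonneg _) (k1.trans hLδ) 2
  have s2 := pow_le_pow_left₀ (norm_nonneg _) (k2.trans hLδ) 2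
  nlinarith

/-- A bounded solution on `[0,T]` of the characteristic system for the potential `V`. -/
def IsBoundedCharSol (V : ℝ → ℝ) (c T : ℝ) (u p q : ℝ → L2ul) : Prop :=
  (∃ (f : ℝ → ℝ) (K : ℝ≥0) (hf : LipschitzWith K f) (h0 : f 0 = 0),
      CharSol c (c ^ 2) T (nem f K hf h0) u p q ∧
        ∀ t ∈ Icc 0 T, ∀ᵐ x, f (u t x) = deriv V (u t x)) ∧
    ∃ R : ℝ, ∀ t ∈ Icc 0 T, ∀ᵐ x, |u t x| ≤ R

theorem CharSol.congr_fun {γ T : ℝ} {N : L2ul → L2ul} {u p q u' p' q' : ℝ → L2ul}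
    (h : CharSol c γ T N u p q) (he : ∀ t ∈ Icc 0 T, u' t = u t ∧ p' t = p t ∧ q' t = q t) :
    CharSol c γ T N u' p' q' := by
  refine ⟨fun t ht => ?_, fun t ht => ?_, fun t ht => ?_⟩
  · obtain ⟨e1, e2, e3⟩ := he t ht
    rw [e2, e3]
    exact (h.du t ht).congr (fun s hs => (he s hs).1) e1
  · have := (h.dp t ht).congr (f₁ := fun s => Tr (c * s) (p' s))
      (fun s hs => by rw [(he s hs).2.1]) (by rw [(he t ht).2.1])
    beta_reduce at this
    rw [← (he t ht).1, ← (he t ht).2.1, ← (he t ht).2.2] at this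
    exact this
  · have := (h.dq t ht).congr (f₁ := fun s => Tr (-c * s) (q' s))
      (fun s hs => by rw [(he s hs).2.2]) (by rw [(he t ht).2.2])
    beta_reduce at this
    rw [← (he t ht).1, ← (he t ht).2.1, ← (he t ht).2.2] at this
    exact this

theorem IsBoundedCharSol.mono {T T' : ℝ} {u p q : ℝ → L2ul} (h : IsBoundedCharSol V c T u p q)
    (hT : T' ≤ T) : IsBoundedCharSol V c T' u p q := by
  obtain ⟨⟨f, K, hf, h0, hs, hfV⟩, R, hR⟩ := h
  have hsub : Icc 0 T' ⊆ Icc 0 T := Icc_subset_Icc_right hT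
  exact ⟨⟨f, K, hf, h0, hs.mono hT, fun t ht => hfV t (hsub ht)⟩, R, fun t ht => hR t (hsub ht)⟩

/-- The two solutions may come with different truncations; above both of their bounds a single one
serves for both, and Gronwall with equal data concludes. -/
theorem HasTruncations.charSol_unique (hV : HasTruncations V a b m R₁) {T : ℝ}
    {u p q u' p' q' : ℝ → L2ul} (h : IsBoundedCharSol V c T u p q)
    (h' : IsBoundedCharSol V c T u' p' q') (hu : u 0 = u' 0) (hp : p 0 = p' 0) (hq : q 0 = q' 0) :
    ∀ t ∈ Icc 0 T, u t = u' t ∧ p t = p' t ∧ q t = q' t := by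
  obtain ⟨⟨f, K, hf, h0, hs, hfV⟩, R, hR⟩ := h
  obtain ⟨⟨f', K', hf', h0', hs', hfV'⟩, R', hR'⟩ := h'
  obtain ⟨g, G, L, hN, hgV⟩ := hV.exists_isNonlin (max R₁ (max R R')) (le_max_left _ _)
  have k : CharSol c (c ^ 2) T hN.N u p q := hs.congr fun t ht => L2ul_ext (by
    filter_upwards [coeFn_nem hf h0 (u t), hN.coeFn_N (u t), hfV t ht, hR t ht] with x h1 h2 h3 h4
    rw [h1, h2, h3, (hgV _ (h4.trans ((le_max_left _ _).trans (le_max_right _ _)))).1])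
  have k' : CharSol c (c ^ 2) T hN.N u' p' q' := hs'.congr fun t ht => L2ul_ext (by
    filter_upwards [coeFn_nem hf' h0' (u' t), hN.coeFn_N (u' t), hfV' t ht, hR' t ht]
      with x h1 h2 h3 h4
    rw [h1, h2, h3, (hgV _ (h4.trans ((le_max_right _ _).trans (le_max_right _ _)))).1])
  intro t ht
  have := k.norm_sub_le hN.lipschitzWith_N k' (δ := 0) (by simp [hu]) (by simp [hp]) (by simp [hq])
    t ht
  simp only [zero_mul] at this
  exact ⟨sub_eq_zero.1 (norm_le_zero_iff.1 this.1), sub_eq_zero.1 (norm_le_zero_iff.1 this.2.1),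
    sub_eq_zero.1 (norm_le_zero_iff.1 this.2.2)⟩

theorem HasTruncations.exists_boundedCharSol (hV : HasTruncations V a b m R₁) (hα : 0 < α)
    (hc : 0 < c) (hαc : α * c ^ 2 = 1) (w : H1ul) (v : L2ul) (T : ℝ) :
    ∃ u p q : ℝ → L2ul, u 0 = toL2 w ∧ p 0 = v + c • dx w ∧ q 0 = v - c • dx w ∧
      IsBoundedCharSol V c T u p q := by
  obtain ⟨B, -, hB⟩ := hV.exists_bound hα hc hαc (max ‖w‖ ‖v‖) T
  obtain ⟨f, F, K, hN, hfV⟩ := hV.exists_isNonlin (max R₁ B) (le_max_left _ _)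
  obtain ⟨u, p, q, hu, hp, hq, hs⟩ := exists_charSol c (c ^ 2) hN.lipschitzWith_N (toL2 w)
    (v + c • dx w) (v - c • dx w) T
  have hb := hB hN (le_max_right R₁ B) (fun u hu => (hfV u hu).2) le_rfl hs w v hu hp hq
    (le_max_left _ _) (le_max_right _ _)
  refine ⟨u, p, q, hu, hp, hq, ⟨f, K, hN.lip, hN.zero, hs, fun t ht => ?_⟩, B, hb⟩
  filter_upwards [hb t ht] with x hx
  exact (hfV _ (hx.trans (le_max_right _ _))).1

theorem HasTruncations.exists_solution (hV : HasTruncations V a b m R₁) (hα : 0 < α) (hc : 0 < c)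
    (hαc : α * c ^ 2 = 1) (w : H1ul) (v : L2ul) : ∃ u : ℝ → H1ul, IsSolution α V w v u := by
  choose U P Q hU hP hQ hs using
    fun n : ℕ => hV.exists_boundedCharSol hα hc hαc w v (n : ℝ)
  have hagree : ∀ {k n : ℕ}, k ≤ n → ∀ t ∈ Icc (0 : ℝ) k,
      U k t = U n t ∧ P k t = P n t ∧ Q k t = Q n t := fun {k n} hkn =>
    hV.charSol_unique (hs k) ((hs n).mono (by exact_mod_cast hkn)) (by rw [hU, hU])
      (by rw [hP, hP]) (by rw [hQ, hQ])
  have hcomp : ∀ (n : ℕ), ∀ t ∈ Icc (0 : ℝ) n, Compat c (U n t) (P n t) (Q n t) := fun n => by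
    obtain ⟨⟨f, K, hf, h0, h, -⟩, -⟩ := hs n
    exact h.compat hc (by rw [hU, hP, hQ]; exact compat_of_H1ul hc w v)
  have hmem : ∀ t : ℝ, 0 ≤ t → t ∈ Icc (0 : ℝ) ⌈t⌉₊ := fun t ht => ⟨ht, Nat.le_ceil t⟩
  -- The solutions on `[0, n]` agree where they overlap, so at time `t` the one on `[0, ⌈t⌉]` is
  -- taken; values at negative times play no role.
  set u : ℝ → H1ul := fun t => if ht : 0 ≤ t then mkH1 _ _ (hcomp ⌈t⌉₊ t (hmem t ht)) else 0
    with hu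
  have hut : ∀ t (ht : 0 ≤ t), u t = mkH1 _ _ (hcomp ⌈t⌉₊ t (hmem t ht)) := fun t ht => dif_pos ht
  have hsol := isSolution_of_charSol (u := u) (w := fun t => U ⌈t⌉₊ t) (p := fun t => P ⌈t⌉₊ t)
    (q := fun t => Q ⌈t⌉₊ t) (V := V) hc hαc (fun t ht => by rw [hut t ht]; rfl)
    (fun t ht => by rw [hut t ht]; rfl) (fun T hT => by
      obtain ⟨⟨f, K, hf, h0, h, hfV⟩, -⟩ := hs ⌈T⌉₊
      have hTn : T ≤ ⌈T⌉₊ := Nat.le_ceil T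
      have hag : ∀ t ∈ Icc 0 T, U ⌈t⌉₊ t = U ⌈T⌉₊ t ∧ P ⌈t⌉₊ t = P ⌈T⌉₊ t ∧
          Q ⌈t⌉₊ t = Q ⌈T⌉₊ t := fun t ht =>
        hagree (Nat.ceil_le_ceil ht.2) t (hmem t ht.1)
      refine ⟨f, K, hf, h0, (h.mono hTn).congr_fun hag, fun t ht => ?_⟩
      rw [(hag t ht).1]
      exact hfV t ⟨ht.1, ht.2.trans hTn⟩)
  have hu0 : u 0 = w := by
    rw [hut 0 le_rfl]
    exact toL2_injective (hU _)
  have hv0 : (1 / 2 : ℝ) • (P ⌈(0 : ℝ)⌉₊ 0 + Q ⌈(0 : ℝ)⌉₊ 0) = v := by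
    rw [hP, hQ]
    module
  rw [hu0] at hsol
  rw [hv0] at hsol
  exact ⟨u, hsol⟩

end WellPosed

/-! ### The absorbing ball -/

/-- A family of functions, equicontinuous in time, whose members decrease with speed one whenever
they are comparable to a large upper bound of the family, stays below a `1`-Lipschitz barrier. -/
theorem le_barrier {ι : Type*} {E : ι → ℝ → ℝ} {B : ℝ → ℝ} {T k : ℝ} (hk : 0 < k)
    (hB : Continuous B) (hBk : ∀ t, k ≤ B t) (hB1 : ∀ s t, s ≤ t → B s - (t - s) ≤ B t)
    (hmod : ∀ s ∈ Icc 0 T, ∃ η : ℝ → ℝ, Tendsto η (𝓝[Icc 0 T] s) (𝓝 0) ∧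
      ∀ i r, |E i r - E i s| ≤ η r)
    (hdini : ∀ s ∈ Ico 0 T, ∀ S, k ≤ S → (∀ i, E i s ≤ S) → ∀ i, 2 / 3 * S ≤ E i s →
      ∀ r, -1 < r → ∀ᶠ z in 𝓝[>] s, slope (E i) s z < r)
    (h0 : ∀ i, E i 0 ≤ B 0) : ∀ t ∈ Icc 0 T, ∀ i, E i t ≤ B t := by
  have hcont : ∀ i, ContinuousOn (E i) (Icc 0 T) := fun i s hs => by
    obtain ⟨η, hη, hb⟩ := hmod s hs
    rw [ContinuousWithinAt, tendsto_iff_norm_sub_tendsto_zero]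
    exact squeeze_zero (fun _ => norm_nonneg _) (fun r => hb i r) hη
  have hclosed : IsClosed ({t | ∀ i, E i t ≤ B t} ∩ Icc 0 T) := by
    have : {t | ∀ i, E i t ≤ B t} ∩ Icc 0 T
        = Icc 0 T ∩ ⋂ i, {t | t ∈ Icc 0 T ∧ E i t ≤ B t} := by
      ext t
      rw [mem_inter_iff, mem_inter_iff, mem_iInter]
      exact ⟨fun h => ⟨h.2, fun i => ⟨h.2, h.1 i⟩⟩, fun h => ⟨fun i => (h.2 i).2, h.1⟩⟩
    rw [this]
    exact isClosed_Icc.inter (isClosed_iInter fun i =>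
      isClosed_Icc.isClosed_le (hcont i) hB.continuousOn)
  -- Continuous induction: from a time `s` at which all members lie below the barrier, reach some
  -- later time with the same property.
  refine fun t ht => hclosed.Icc_subset_of_forall_exists_gt h0 ?_ ht
  rintro s ⟨hs, hsT⟩ y hy
  rw [mem_Ioi] at hy
  have hS : 0 < B s := hk.trans_le (hBk s)
  obtain ⟨η, hη, hb⟩ := hmod s (Ico_subset_Icc_self hsT)
  have ev : ∀ᶠ r in 𝓝[≥] s, η r < B s / 16 ∧ B s * (15 / 16) < B r := by
    have h1 : 𝓝[≥] s ≤ 𝓝[Icc 0 T] s :=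
      nhdsWithin_le_of_mem (mem_nhdsGE_of_mem_Ico hsT)
    exact ((hη.mono_left h1).eventually_lt_const (by positivity)).and
      (mem_nhdsWithin_of_mem_nhds (hB.continuousAt.eventually_const_lt (by linarith)))
  obtain ⟨w, hw, hsub⟩ := mem_nhdsGE_iff_exists_Icc_subset.1 ev
  obtain ⟨z, hz1, hz2⟩ := exists_between (lt_min hy (lt_min hw hsT.2))
  have hzy : z < y := hz2.trans_le (min_le_left _ _)
  have hzw : z < w := hz2.trans_le ((min_le_right _ _).trans (min_le_left _ _))
  have hzT : z < T := hz2.trans_le ((min_le_right _ _).trans (min_le_right _ _))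
  have hnear : ∀ r ∈ Icc s z, (∀ i, |E i r - E i s| ≤ B s / 16) ∧ B s * (15 / 16) < B r :=
    fun r hr => by
    have := hsub ⟨hr.1, hr.2.trans hzw.le⟩
    exact ⟨fun i => (hb i r).trans this.1.le, this.2⟩
  refine ⟨z, fun i => ?_, hz1, hzy.le⟩
  -- On `[s, z]` each member moves by at most `B s / 16`. A low member ends below `14/16 B s < B z`.
  -- A high one stays above `12/16 B s`, which exceeds `2/3` of the common bound `17/16 B s`, so it
  -- decreases with speed one and the barrier is no faster.
  rcases lt_or_ge (E i s) (13 / 16 * B s) with hlt | hge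
  · obtain ⟨h1, h2⟩ := hnear z ⟨hz1.le, le_rfl⟩
    have := (abs_le.1 (h1 i)).2
    linarith
  · have hd : ∀ x, HasDerivAt (fun r => E i s - (r - s)) (-1) x := fun x => by
      simpa using ((hasDerivAt_id x).sub_const s).const_sub (E i s)
    have key := image_le_of_liminf_slope_right_le_deriv_boundary
      ((hcont i).mono (Icc_subset_Icc hsT.1 hzT.le)) (B := fun r => E i s - (r - s)) (by simp)
      (fun x _ => (hd x).continuousAt.continuousWithinAt)
      (fun x _ => (hd x).hasDerivWithinAt) (fun x hx r hr =>
        (hdini x ⟨hsT.1.trans hx.1, hx.2.trans hzT⟩ (17 / 16 * B s) (by linarith [hBk s])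
          (fun j => by
            have := (abs_le.1 ((hnear x ⟨hx.1, hx.2.le⟩).1 j)).2
            linarith [hs j]) i (by
            have := (abs_le.1 ((hnear x ⟨hx.1, hx.2.le⟩).1 i)).1
            linarith) r hr).frequently) (x := z) ⟨hz1.le, le_rfl⟩
    have := hB1 s z hz1.le
    linarith [hs i]

/-- On each side of `ξ`, beyond distance `L`, the weight is exactly `e^{-κL}` times the weight
recentred at the corresponding point `ξ ± L`. -/
theorem wt_le_of_le_abs {κ ξ x L : ℝ} (hL : 0 ≤ L) (h : L ≤ |x - ξ|) :
    wt κ ξ x ≤ Real.exp (-(κ * L)) * (wt κ (ξ - L) x + wt κ (ξ + L) x) := by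
  have p1 := wt_pos κ (ξ - L) x
  have p2 := wt_pos κ (ξ + L) x
  have e := Real.exp_pos (-(κ * L))
  rcases le_abs.1 h with h | h
  · have : wt κ ξ x = Real.exp (-(κ * L)) * wt κ (ξ + L) x := by
      rw [wt, wt, ← Real.exp_add, abs_of_nonneg (by linarith), abs_of_nonneg (by linarith)]
      congr 1
      ring
    rw [this]
    gcongr
    linarith
  · have : wt κ ξ x = Real.exp (-(κ * L)) * wt κ (ξ - L) x := by
      rw [wt, wt, ← Real.exp_add, abs_of_nonpos (by linarith), abs_of_nonpos (by linarith)]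
      congr 1
      ring
    rw [this]
    gcongr
    linarith

/-! ### The energy density -/

section Localization

variable {f F : ℝ → ℝ} {K : ℝ≥0} {a b m : ℝ}

/-- The nonnegative density of the energy. -/
def dens (α m : ℝ) (F : ℝ → ℝ) (u p q : L2ul) (x : ℝ) : ℝ :=
  1 / 2 * ((α • p + (1 / 2 : ℝ) • u) x * (α • p + (1 / 2 : ℝ) • u) x)
    + 1 / 2 * ((α • q + (1 / 2 : ℝ) • u) x * (α • q + (1 / 2 : ℝ) • u) x)
    + 1 / 4 * (u x * u x) + 2 * α * (F (u x) + m)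

theorem IsNonlin.dens_nonneg (h : IsNonlin f F K a b m) {α : ℝ} (hα : 0 < α) (u p q : L2ul)
    (x : ℝ) : 0 ≤ dens α m F u p q x := by
  have h1 := mul_self_nonneg ((α • p + (1 / 2 : ℝ) • u) x)
  have h2 := mul_self_nonneg ((α • q + (1 / 2 : ℝ) • u) x)
  have h3 := mul_self_nonneg (u x)
  have h4 : 0 ≤ 2 * α * (F (u x) + m) := mul_nonneg (by positivity) (by linarith [h.lower (u x)])
  simp only [dens]
  linarith

theorem IsNonlin.integral_wt_mul_dens (h : IsNonlin f F K a b m) {κ : ℝ} (hκ : 0 < κ) (α ξ : ℝ)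
    (u p q : L2ul) : Integrable (fun x => wt κ ξ x * dens α m F u p q x) ∧
      ∫ x, wt κ ξ x * dens α m F u p q x
        = energy hκ α F ξ u p q + 2 * α * m * ∫ x, wt κ ξ x := by
  have i1 := (integrable_wt_mul hκ ξ (α • p + (1 / 2 : ℝ) • u)
    (α • p + (1 / 2 : ℝ) • u)).const_mul (1 / 2)
  have i2 := (integrable_wt_mul hκ ξ (α • q + (1 / 2 : ℝ) • u)
    (α • q + (1 / 2 : ℝ) • u)).const_mul (1 / 2)
  have i3 := (integrable_wt_mul hκ ξ u u).const_mul (1 / 4)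
  have i4 := (h.integrable_wt_F hκ ξ u).const_mul (2 * α)
  have i5 := (integrable_wt hκ ξ).const_mul (2 * α * m)
  have e : (fun x => wt κ ξ x * dens α m F u p q x) = fun x =>
      1 / 2 * (wt κ ξ x * ((α • p + (1 / 2 : ℝ) • u) x * (α • p + (1 / 2 : ℝ) • u) x))
      + 1 / 2 * (wt κ ξ x * ((α • q + (1 / 2 : ℝ) • u) x * (α • q + (1 / 2 : ℝ) • u) x))
      + 1 / 4 * (wt κ ξ x * (u x * u x)) + 2 * α * (wt κ ξ x * F (u x))
      + 2 * α * m * wt κ ξ x := by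
    funext x
    simp only [dens]
    ring
  rw [e]
  refine ⟨(((i1.add i2).add i3).add i4).add i5, ?_⟩
  rw [integral_add (by exact ((i1.add i2).add i3).add i4) i5,
    integral_add (by exact (i1.add i2).add i3) i4, integral_add (by exact i1.add i2) i3,
    integral_add i1 i2]
  simp only [integral_const_mul, energy, J_apply]

end Localization

/-! ### Local bounds and absorption -/

section Absorbing

variable {α c a b m R₁ : ℝ} {V : ℝ → ℝ}

/-- The local Sobolev inequality on `[x, x+1]`, an interval within distance `L + 1` of the centre,
with `u_x` expressed through `p - q`. -/
theorem ae_sq_le_of_sqNorm {κ : ℝ} (hκ : 0 < κ) (hc : 0 < c) {u p q : L2ul}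
    (h : Compat c u p q) (ξ L : ℝ) :
    ∀ᵐ x, |x - ξ| ≤ L →
      u x ^ 2 ≤ 2 * Real.exp (κ * (L + 1)) * (1 + 1 / (2 * c ^ 2)) * sqNorm hκ ξ u p q := by
  set g : L2ul := (1 / (2 * c)) • (p - q) with hg
  obtain ⟨U, hU, hae, hd⟩ := exists_continuous_rep (mkH1 u g h)
  filter_upwards [hae] with x hx hxL
  have hx' : u x = U x := hx
  have hr : ∀ y ∈ Icc x (x + 1), |y - ξ| ≤ L + 1 := fun y hy => by
    have h1 := abs_le.1 hxL
    exact abs_le.2 ⟨by linarith [hy.1], by linarith [hy.2]⟩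
  have k1 := rep_sq_le hU hae hd x
  have k2 : ∫ t in Icc x (x + 1), u t * u t ≤ Real.exp (κ * (L + 1)) * J hκ ξ u u :=
    integral_Icc_le_J hκ u hr
  have k3 : ∫ t in Icc x (x + 1), g t * g t ≤ Real.exp (κ * (L + 1)) * J hκ ξ g g :=
    integral_Icc_le_J hκ g hr
  have k4 : J hκ ξ g g ≤ 1 / (2 * c ^ 2) * (J hκ ξ p p + J hκ ξ q q) := by
    have := J_self_nonneg hκ ξ (p + q)
    have e : J hκ ξ g g = 1 / (4 * c ^ 2) * J hκ ξ (p - q) (p - q) := by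
      rw [hg]
      simp only [map_smul, smul_apply, smul_eq_mul]
      field_simp
      ring
    have e2 : J hκ ξ (p - q) (p - q) ≤ 2 * (J hκ ξ p p + J hκ ξ q q) := by
      simp only [map_add, map_sub, add_apply, sub_apply] at this ⊢
      linarith
    rw [e]
    calc _ ≤ 1 / (4 * c ^ 2) * (2 * (J hκ ξ p p + J hκ ξ q q)) := by gcongr
      _ = _ := by field_simp; ring
  have n1 := J_self_nonneg hκ ξ u
  have n2 := J_self_nonneg hκ ξ p
  have n3 := J_self_nonneg hκ ξ q
  have k5 : J hκ ξ u u + J hκ ξ g g ≤ (1 + 1 / (2 * c ^ 2)) * sqNorm hκ ξ u p q := by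
    have : 0 ≤ 1 / (2 * c ^ 2) * J hκ ξ u u := by positivity
    simp only [sqNorm]
    linarith
  rw [hx']
  calc U x ^ 2 ≤ 2 * (Real.exp (κ * (L + 1)) * J hκ ξ u u)
        + 2 * (Real.exp (κ * (L + 1)) * J hκ ξ g g) :=
        k1.trans (add_le_add (mul_le_mul_of_nonneg_left k2 zero_le_two)
          (mul_le_mul_of_nonneg_left k3 zero_le_two))
    _ = 2 * Real.exp (κ * (L + 1)) * (J hκ ξ u u + J hκ ξ g g) := by ring
    _ ≤ 2 * Real.exp (κ * (L + 1)) * ((1 + 1 / (2 * c ^ 2)) * sqNorm hκ ξ u p q) := by gcongr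
    _ = _ := by ring

/-- If the weighted square norm at `ξ` is bounded, the energy at `ξ` is at most half the supremum
of the energies, up to a constant. -/
theorem HasTruncations.exists_local_bound (hV : HasTruncations V a b m R₁) (hα : 0 < α)
    (hc : 0 < c) {κ : ℝ} (hκ : 0 < κ) (M : ℝ) :
    ∃ Φ : ℝ, ∀ {f F : ℝ → ℝ} {K : ℝ≥0}, IsNonlin f F K a b m → ∀ {R : ℝ},
      (∀ u, |u| ≤ R → F u = V u) → ∀ {u p q : L2ul}, Compat c u p q → (∀ᵐ x, |u x| ≤ R) →
      ∀ {S ξ : ℝ}, (∀ η, energy hκ α F η u p q + 2 * α * m * wtC κ ≤ S) →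
      sqNorm hκ ξ u p q ≤ M → energy hκ α F ξ u p q + 2 * α * m * wtC κ ≤ S / 2 + Φ := by
  -- Then `e^{-κL} = e^{-3} ≤ 1/4`, so the two energies centred at `ξ ± L` contribute at most `S/2`
  -- together.
  set L := 3 / κ with hL
  have hL0 : 0 ≤ L := by positivity
  have hexp : Real.exp (-(κ * L)) ≤ 1 / 4 := by
    rw [hL, mul_div_cancel₀ _ hκ.ne', Real.exp_neg, ← one_div]
    have := Real.add_one_le_exp (3 : ℝ)
    exact one_div_le_one_div_of_le (by norm_num) (by linarith)
  obtain ⟨B, hB0, hB⟩ := exists_abs_le_of_abs_le hV.continuous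
    (Real.sqrt (2 * Real.exp (κ * (L + 1)) * (1 + 1 / (2 * c ^ 2)) * M))
  refine ⟨(α ^ 2 + 1) * M + 2 * α * (B + m) * wtC κ + 2 * α * m * wtC κ, ?_⟩
  intro f F K h R hFV u p q hcomp hR S ξ hS hM
  have hm := hV.m_pos
  have hW := integral_wt_le_wtC hκ.le ξ
  have I := fun η => h.integral_wt_mul_dens hκ α η u p q
  have hI : ∀ η, ∫ x, wt κ η x * dens α m F u p q x ≤ S := fun η => by
    rw [(I η).2]
    refine le_trans ?_ (hS η)
    gcongr
    exact integral_wt_le_wtC hκ.le η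
  set P : L2ul := α • p + (1 / 2 : ℝ) • u with hP
  set Q : L2ul := α • q + (1 / 2 : ℝ) • u with hQ
  have j1 := integrable_wt_mul hκ ξ P P
  have j2 := integrable_wt_mul hκ ξ Q Q
  have j3 := integrable_wt_mul hκ ξ u u
  have j4 := integrable_wt hκ ξ
  have l1 := ((I (ξ - L)).1.add (I (ξ + L)).1).const_mul (Real.exp (-(κ * L)))
  have l2 := ((j1.const_mul (1 / 2)).add (j2.const_mul (1 / 2))).add (j3.const_mul (1 / 4))
  have l3 := j4.const_mul (2 * α * (B + m))
  have main : ∫ x, wt κ ξ x * dens α m F u p q x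
      ≤ Real.exp (-(κ * L)) * ((∫ x, wt κ (ξ - L) x * dens α m F u p q x)
        + ∫ x, wt κ (ξ + L) x * dens α m F u p q x)
      + (1 / 2 * J hκ ξ P P + 1 / 2 * J hκ ξ Q Q + 1 / 4 * J hκ ξ u u)
      + 2 * α * (B + m) * ∫ x, wt κ ξ x := by
    have e : Real.exp (-(κ * L)) * ((∫ x, wt κ (ξ - L) x * dens α m F u p q x)
        + ∫ x, wt κ (ξ + L) x * dens α m F u p q x)
      + (1 / 2 * J hκ ξ P P + 1 / 2 * J hκ ξ Q Q + 1 / 4 * J hκ ξ u u)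
      + 2 * α * (B + m) * ∫ x, wt κ ξ x = ∫ x, (Real.exp (-(κ * L))
        * (wt κ (ξ - L) x * dens α m F u p q x + wt κ (ξ + L) x * dens α m F u p q x)
      + (1 / 2 * (wt κ ξ x * (P x * P x)) + 1 / 2 * (wt κ ξ x * (Q x * Q x))
        + 1 / 4 * (wt κ ξ x * (u x * u x))) + 2 * α * (B + m) * wt κ ξ x) := by
      rw [integral_add (by exact l1.add l2) l3, integral_add (by exact l1) (by exact l2),
        integral_const_mul, integral_add (I (ξ - L)).1 (I (ξ + L)).1,
        integral_add (by exact (j1.const_mul _).add (j2.const_mul _)) (j3.const_mul _),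
        integral_add (j1.const_mul _) (j2.const_mul _)]
      simp only [integral_const_mul, J_apply]
    rw [e]
    refine integral_mono_ae (I ξ).1 ((l1.add l2).add l3) ?_
    filter_upwards [ae_sq_le_of_sqNorm hκ hc hcomp ξ L, hR] with x hx hxR
    have w0 := wt_pos κ ξ x
    have d0 := h.dens_nonneg hα u p q x
    -- Far from `ξ` the nonnegative density is charged to the shifted weights. Near `ξ` the function
    -- is bounded, hence so is `V(u)`, and the quadratic part is kept as it is.
    rcases le_total L |x - ξ| with hLx | hLx
    · have h1 := mul_le_mul_of_nonneg_right (wt_le_of_le_abs (κ := κ) hL0 hLx) d0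
      have h2 : 0 ≤ 1 / 2 * (wt κ ξ x * (P x * P x)) + 1 / 2 * (wt κ ξ x * (Q x * Q x))
          + 1 / 4 * (wt κ ξ x * (u x * u x)) := by
        have := mul_nonneg w0.le (mul_self_nonneg (P x))
        have := mul_nonneg w0.le (mul_self_nonneg (Q x))
        have := mul_nonneg w0.le (mul_self_nonneg (u x))
        linarith
      have h3 : 0 ≤ 2 * α * (B + m) * wt κ ξ x := by positivity
      calc wt κ ξ x * dens α m F u p q x ≤ _ := h1
        _ = Real.exp (-(κ * L)) * (wt κ (ξ - L) x * dens α m F u p q x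
            + wt κ (ξ + L) x * dens α m F u p q x) := by ring
        _ ≤ _ := by linarith
    · have hu : |u x| ≤ Real.sqrt (2 * Real.exp (κ * (L + 1)) * (1 + 1 / (2 * c ^ 2)) * M) := by
        rw [← Real.sqrt_sq_eq_abs]
        refine Real.sqrt_le_sqrt ((hx hLx).trans ?_)
        gcongr
      have hF : F (u x) ≤ B := by
        rw [hFV _ hxR]
        exact (le_abs_self _).trans (hB _ hu)
      have h1 : 0 ≤ Real.exp (-(κ * L)) * (wt κ (ξ - L) x * dens α m F u p q x
            + wt κ (ξ + L) x * dens α m F u p q x) := by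
        have := wt_pos κ (ξ - L) x
        have := wt_pos κ (ξ + L) x
        positivity
      have h2 : 2 * α * wt κ ξ x * F (u x) ≤ 2 * α * wt κ ξ x * B := by gcongr
      calc wt κ ξ x * dens α m F u p q x
          = (1 / 2 * (wt κ ξ x * (P x * P x)) + 1 / 2 * (wt κ ξ x * (Q x * Q x))
            + 1 / 4 * (wt κ ξ x * (u x * u x))) + (2 * α * wt κ ξ x * F (u x)
            + 2 * α * m * wt κ ξ x) := by
            simp only [dens]
            ring
        _ ≤ _ := by
            linarith
  have s1 : Real.exp (-(κ * L)) * ((∫ x, wt κ (ξ - L) x * dens α m F u p q x)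
      + ∫ x, wt κ (ξ + L) x * dens α m F u p q x) ≤ 1 / 4 * (S + S) := by
    have n1 : ∀ η, 0 ≤ ∫ x, wt κ η x * dens α m F u p q x := fun η =>
      integral_nonneg fun x => mul_nonneg (wt_pos _ _ _).le (h.dens_nonneg hα u p q x)
    exact mul_le_mul hexp (add_le_add (hI _) (hI _)) (add_nonneg (n1 _) (n1 _)) (by norm_num)
  have s2 : 1 / 2 * J hκ ξ P P + 1 / 2 * J hκ ξ Q Q + 1 / 4 * J hκ ξ u u ≤ (α ^ 2 + 1) * M := by
    have b1 := J_add_self_le hκ ξ α p u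
    have b2 := J_add_self_le hκ ξ α q u
    have n1 := J_self_nonneg hκ ξ u
    have n2 := J_self_nonneg hκ ξ p
    have n3 := J_self_nonneg hκ ξ q
    have n4 : 0 ≤ α ^ 2 * J hκ ξ u u := by positivity
    calc _ ≤ (α ^ 2 + 1) * sqNorm hκ ξ u p q := by
          simp only [sqNorm]
          linarith
      _ ≤ _ := by gcongr
  have s3 : 2 * α * (B + m) * ∫ x, wt κ ξ x ≤ 2 * α * (B + m) * wtC κ := by gcongr
  have s4 : 0 ≤ 2 * α * m * ∫ x, wt κ ξ x :=
    mul_nonneg (by positivity) (integral_nonneg fun x => (wt_pos _ _ _).le)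
  have s5 := (I ξ).2
  linarith

/-- All solutions eventually enter a ball that depends only on the equation. -/
theorem HasTruncations.exists_absorbing (hV : HasTruncations V a b m R₁) (hα : 0 < α)
    (hc : 0 < c) (hαc : α * c ^ 2 = 1) :
    ∃ D : ℝ, 0 ≤ D ∧ ∀ (w : H1ul) (v : L2ul) (u : ℝ → H1ul), IsSolution α V w v u →
      ∃ t₀ : ℝ, ∀ t, t₀ ≤ t → ‖u t‖ ≤ D ∧ ‖timeDeriv u t‖ ≤ D := by
  obtain ⟨κ, hκ, hκ1, hκ2⟩ := exists_rate hα hc hV.a_pos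
  set θ := min (α / 4) (a / 2) with hθ
  have ha := hV.a_pos
  have hb := hV.b_pos
  have hm := hV.m_pos
  have hθ0 : 0 < θ := by positivity
  have hW := wtC_nonneg κ
  -- Above this threshold for the square norm, the dissipation exceeds the constant source by more
  -- than one.
  obtain ⟨Φ, hΦ⟩ := hV.exists_local_bound hα hc hκ ((b * wtC κ + 1) / θ)
  -- For `S ≥ k` one has `S/2 + Φ < 2S/3`, the fraction required by the barrier argument.
  set k := 6 * |Φ| + 1 with hk
  have hk0 : 0 < k := by positivity
  set D := Real.sqrt (Real.exp κ * ((4 / α ^ 2 + 4) * k)) with hD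
  have hD0 : 0 ≤ D := Real.sqrt_nonneg _
  refine ⟨D + D / c, by positivity, fun w v u h => ?_⟩
  obtain ⟨BV, -, hBV⟩ := exists_abs_le_of_abs_le hV.continuous (2 * ‖w‖)
  set β := wtC κ * (α ^ 2 * (‖v + c • dx w‖ ^ 2 + ‖v - c • dx w‖ ^ 2) + ‖toL2 w‖ ^ 2
    + 2 * α * BV) + 2 * α * m * wtC κ with hβ
  refine ⟨max 0 (β - k), fun t ht => ?_⟩
  have ht0 : 0 ≤ t := (le_max_left _ _).trans ht
  obtain ⟨B, hB⟩ := hV.exists_bound_solution hα hc hαc (max ‖w‖ ‖v‖) t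
  replace hB := hB w v u h (le_max_left _ _) (le_max_right _ _)
  -- The truncation depends on `t` and on the data, but `Φ`, `k`, `κ` and `θ` were fixed beforehand
  -- and do not.
  obtain ⟨f, F, K, hN, hfV⟩ := hV.exists_isNonlin (max R₁ (max B (2 * ‖w‖))) (le_max_left _ _)
  have huR : ∀ s ∈ Icc 0 t, ∀ᵐ x, |toL2 (u s) x| ≤ max R₁ (max B (2 * ‖w‖)) := fun s hs => by
    filter_upwards [hB s hs] with x hx
    exact hx.trans ((le_max_left _ _).trans (le_max_right _ _))
  have hsol : CharSol c (c ^ 2) t hN.N _ _ _ :=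
    CharSol.of_isSolution h hαc hN.lip hN.zero (T := t) fun s hs => by
      filter_upwards [huR s hs] with x hx
      exact (hfV _ hx).1
  set p : ℝ → L2ul := fun t => timeDeriv u t + c • dx (u t) with hp
  set q : ℝ → L2ul := fun t => timeDeriv u t - c • dx (u t) with hq
  have hcomp : ∀ s ∈ Icc 0 t, Compat c (toL2 (u s)) (p s) (q s) := fun s _ =>
    compat_of_H1ul hc (u s) (timeDeriv u s)
  -- The barrier starts above all initial energies, descends at unit speed and stops at `k`, which
  -- it has reached by time `max 0 (β - k)`.
  have key := le_barrier (E := fun ξ s => energy hκ α F ξ (toL2 (u s)) (p s) (q s)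
      + 2 * α * m * wtC κ) (B := fun s => max k (β - s)) (T := t) hk0 (by fun_prop)
    (fun s => le_max_left _ _) (fun s r hsr => by
      rcases max_cases k (β - s) with ⟨e, -⟩ | ⟨e, -⟩
      · rw [e]
        linarith [le_max_left k (β - r)]
      · rw [e]
        linarith [le_max_right k (β - r)])
    (fun s hs => by
      obtain ⟨η, hη, hη'⟩ := hN.exists_energy_modulus hκ hα (hsol.continuousOn_u s hs)
        (hsol.dp.continuousOn s hs) (hsol.dq.continuousOn s hs)
      exact ⟨η, hη, fun ξ r => by simpa using hη' ξ r⟩)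
    (fun s hs S hS hES ξ hξ r hr => by
      have hs' := Ico_subset_Icc_self hs
      -- Were the square norm at `ξ` below the threshold, the local bound would put this energy
      -- below `2S/3`.
      have hbig : (b * wtC κ + 1) / θ < sqNorm hκ ξ (toL2 (u s)) (p s) (q s) := by
        by_contra! hcon
        have h1 := hΦ hN (fun u hu => (hfV u hu).2) (hcomp s hs') (huR s hs') hES hcon
        have h2 := le_abs_self Φ
        linarith
      rw [div_lt_iff₀ hθ0] at hbig
      have h1 := eventually_slope_energy_lt hN hκ hb.le hc hαc hκ1 hκ2 hsol hcomp ξ hs (r := r)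
        (by linarith)
      filter_upwards [h1] with z hz
      simpa [slope_def_field] using hz)
    (fun ξ => by
      refine le_trans ?_ (le_max_right _ _)
      have h1 := hN.energy_le hκ hα ξ (toL2 (u 0)) (p 0) (q 0) (B := BV) (by
        rw [h.initial]
        filter_upwards [ae_abs_le_of_norm_le (le_refl ‖w‖)] with x hx
        rw [(hfV _ (hx.trans ((le_max_right _ _).trans (le_max_right _ _)))).2]
        exact hBV _ hx)
      simp only [hp, hq, h.initial, h.initial_timeDeriv] at h1 ⊢
      linarith) t ⟨ht0, le_rfl⟩
  have hmax : max k (β - t) = k := max_eq_left (by linarith [le_max_right 0 (β - k)])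
  have hsq : ∀ ξ, sqNorm hκ ξ (toL2 (u t)) (p t) (q t) ≤ (4 / α ^ 2 + 4) * k := fun ξ => by
    refine (hN.sqNorm_le_energy hκ hm.le hα ξ _ _ _).trans ?_
    have := key ξ
    rw [hmax] at this
    gcongr
    linarith
  obtain ⟨n1, n2, n3⟩ := norm_sq_le_of_sqNorm hκ hsq
  replace n1 := Real.le_sqrt_of_sq_le n1
  replace n2 := Real.le_sqrt_of_sq_le n2
  replace n3 := Real.le_sqrt_of_sq_le n3
  have m1 := norm_dx_coord_le hc n2 n3
  have m2 := norm_half_add_le n2 n3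
  rw [show (1 / (2 * c)) • (p t - q t) = dx (u t) by
    rw [hp, hq]
    beta_reduce
    rw [add_sub_sub_cancel, ← two_smul ℝ, smul_smul, smul_smul,
      show 1 / (2 * c) * 2 * c = 1 by field_simp, one_smul]] at m1
  rw [show (1 / 2 : ℝ) • (p t + q t) = timeDeriv u t by
    rw [hp, hq]
    module] at m2
  have : 0 ≤ D / c := by positivity
  exact ⟨(norm_H1ul_le _).trans (add_le_add n1 m1), by linarith⟩

end Absorbing

end DampedWave

end

/-! ### The theorem -/

theorem proposition2p1 (α : ℝ) (hα : 0 < α) (V : ℝ → ℝ) (hV : DampedWave.IsBistable V) :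
    -- existence and uniqueness of the global solution
    (∀ (u₀ : DampedWave.H1ul) (u₁ : DampedWave.L2ul),
      ∃ u : ℝ → DampedWave.H1ul, DampedWave.IsSolution α V u₀ u₁ u ∧
        ∀ v : ℝ → DampedWave.H1ul, DampedWave.IsSolution α V u₀ u₁ v → EqOn v u (Ici 0)) ∧
    -- continuous dependence on the data, uniformly on compact time intervals
    (∀ (u₀ : DampedWave.H1ul) (u₁ : DampedWave.L2ul) (u : ℝ → DampedWave.H1ul),
      DampedWave.IsSolution α V u₀ u₁ u →
      ∀ T : ℝ, 0 < T → ∀ ε : ℝ, 0 < ε → ∃ δ : ℝ, 0 < δ ∧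
        ∀ (v₀ : DampedWave.H1ul) (v₁ : DampedWave.L2ul) (v : ℝ → DampedWave.H1ul),
          DampedWave.IsSolution α V v₀ v₁ v →
          ‖v₀ - u₀‖ ^ 2 + ‖v₁ - u₁‖ ^ 2 < δ ^ 2 →
          ∀ t ∈ Icc 0 T,
            ‖v t - u t‖ ^ 2
              + ‖DampedWave.timeDeriv v t - DampedWave.timeDeriv u t‖ ^ 2 < ε ^ 2) ∧
    -- absorbing ball
    (∃ K : ℝ, 0 < K ∧
      ∀ (u₀ : DampedWave.H1ul) (u₁ : DampedWave.L2ul) (u : ℝ → DampedWave.H1ul),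
        DampedWave.IsSolution α V u₀ u₁ u →
        limsup (fun t : ℝ => ((‖u t‖ ^ 2 + ‖DampedWave.timeDeriv u t‖ ^ 2 : ℝ) : EReal)) atTop
          ≤ (K : EReal)) := by
  obtain ⟨a, b, m, R₁, hT⟩ := hV.hasTruncations
  obtain ⟨c, hc, hαc⟩ : ∃ c : ℝ, 0 < c ∧ α * c ^ 2 = 1 := by
    refine ⟨1 / Real.sqrt α, by positivity, ?_⟩
    rw [div_pow, Real.sq_sqrt hα.le]
    field_simp
  refine ⟨fun u₀ u₁ => ?_, fun u₀ u₁ u h T _ ε hε =>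
    hT.continuous_dependence hα hc hαc h T hε, ?_⟩
  · obtain ⟨u, hu⟩ := hT.exists_solution hα hc hαc u₀ u₁
    exact ⟨u, hu, fun v hv => hT.solution_unique hα hc hαc hv hu⟩
  · obtain ⟨D, hD, h⟩ := hT.exists_absorbing hα hc hαc
    -- Each of the two norms is eventually at most `D`; the summand `1` makes the constant positive
    -- even if `D = 0`.
    refine ⟨2 * D ^ 2 + 1, by positivity, fun u₀ u₁ u hu => ?_⟩
    obtain ⟨t₀, ht₀⟩ := h u₀ u₁ u hu
    refine limsup_le_of_le (h := ?_)
    filter_upwards [eventually_ge_atTop t₀] with t ht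
    obtain ⟨h1, h2⟩ := ht₀ t ht
    have s1 := pow_le_pow_left₀ (norm_nonneg _) h1 2
    have s2 := pow_le_pow_left₀ (norm_nonneg _) h2 2
    exact EReal.coe_le_coe_iff.2 (by linarith)
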